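/- **Conventions.** An *ultrafilter* is a non-principal ultrafilter $\omega$ on $\mathbb N$; *scaling constants* are reals $d=(d_n)$ with $\lim_\omega d_n=\infty$. For metric spaces $(X_n,\mathrm{dist}_n)$ with base points $e_n\in X_n$, the ultralimit $\lim_\omega (X_n,\frac1{d_n}\mathrm{dist}_n)_e$ is the space of sequences $(x_n)$, $x_n\in X_n$, for which $\mathrm{dist}_n(x_n,e_n)/d_n$ is $\omega$-almost surely bounded, with distance $\lim_\omega \mathrm{dist}_n(x_n,y_n)/d_n$ and sequences at distance $0$ identified. If all $X_n$ equal $X$ it is the asymptotic cone $\mathrm{Con}^\omega(X;e,d)$; for $A_n\subseteq X$, $\lim_\omega A_n$ is the set of all classes of sequences with $x_n\in A_n$ $\omega$-almost surely. A complete geodesic metric space $F$ is *tree-graded* with respect to a collection of closed geodesic subsets (*pieces*) if $(T_1)$ two different pieces have at most one common point, and $(T_2)$ every simple geodesic triangle (a simple loop composed of three geodesics, or a single point) lies in one piece. A metric space $X$ is *asymptotically tree-graded* with respect to a collection $\mathcal A$ of subsets if every cone $\mathrm{Con}^\omega(X;e,d)$ is tree-graded with respect to the sets $\lim_\omega A_n$,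 where $A_n\in\mathcal A$ and $\mathrm{dist}(e_n,A_n)/d_n$ is bounded; here sequences $(A_n)$, $(B_n)$ with $A_n\ne B_n$ $\omega$-almost surely count as giving different pieces, so $\lim_\omega A_n\cap\lim_\omega B_n$ has at most one point. A finitely generated group, with a word metric, is asymptotically tree-graded with respect to subgroups $H_1,\dots,H_k$ if it is so with respect to the collection of all left cosets $gH_i$. A space is *without cut-points* if it has at least two points and the complement of every point is connected. A metric space $B$ is *unconstricted* if there are $\omega$ and $d$ such that for every $e$ the cone $\mathrm{Con}^\omega(B;e,d)$ is without cut-points; a finitely generated group is unconstricted if it is so with a word metric. A family $\mathcal A$ of geodesic metric spaces is *uniformly unconstricted* if for every sequence $A_n\in\mathcal A$ there are $\omega$ and $d$ such that for all $b_n\in A_n$ the ultralimit $\lim_\omega(A_n,\frac1{d_n}\mathrm{dist}_n)_b$ is without cut-points. Finitely generated groups carry word metrics, subsets of metric spaces the induced metrics. **Theorem.** (A) Let $G$ be a finitely generated group that is asymptotically tree-graded with respect to subgroups $H_1,\dots,H_k$, each of which is infinite and (finitely generated and) unconstricted. Let $G'$ be a finitely generated group quasi-isometric to $G$. Then $G'$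 is asymptotically tree-graded, with respect to every word metric, with respect to a finite collection of subgroups $S_1,\dots,S_m$, each of which is finitely generated and quasi-isometric to one of the $H_j$. (B) Let $X$ be a metric space that is asymptotically tree-graded with respect to a collection $\mathcal A$ of non-empty subsets such that 1. $\mathcal A$ (with the induced metrics) is a uniformly unconstricted family of geodesic spaces; 2. for some constant $c$, every point of every $A\in\mathcal A$ is at distance at most $c$ from a bi-infinite geodesic contained in $A$; 3. for some $x_0\in X$ and every $R>0$, the ball $B(x_0,R)$ meets only finitely many $A\in\mathcal A$. Let $G'$ be a finitely generated group quasi-isometric to $X$. Then there are $A_1,\dots,A_m\in\mathcal A$ and subgroups $S_1,\dots,S_m$ of $G'$ such that (I) every $A\in\mathcal A$ is quasi-isometric to some $A_i$; (II) every $S_i$ is finitely generated and quasi-isometric to $A_i$; (III) $G'$ is asymptotically tree-graded, with respect to every word metric, with respect to $S_1,\dots,S_m$. -/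

import Mathlib

open Filter Topology

noncomputable section

/-! ### Quasi-isometries -/

/-- `f` is a quasi-isometric embedding. -/
def IsQuasiIsometricEmbedding {X Y : Type*} [MetricSpace X] [MetricSpace Y] (f : X → Y) : Prop :=
  ∃ L C : ℝ, 1 ≤ L ∧ 0 ≤ C ∧ ∀ x x' : X,
    L⁻¹ * dist x x' - C ≤ dist (f x) (f x') ∧ dist (f x) (f x') ≤ L * dist x x' + C

/-- Two metric spaces are quasi-isometric: there are quasi-isometric embeddings in both directions
whose two composites are at finite distance from the identity maps. -/
def QuasiIsometric (X Y : Type*) [MetricSpace X] [MetricSpace Y] : Prop :=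
  ∃ (f : X → Y) (g : Y → X), IsQuasiIsometricEmbedding f ∧ IsQuasiIsometricEmbedding g ∧
    (∃ K : ℝ, ∀ x, dist (g (f x)) x ≤ K) ∧ (∃ K : ℝ, ∀ y, dist (f (g y)) y ≤ K)

/-! ### Geodesics and tree-graded spaces -/

/-- `s` is (the image of) a geodesic joining `x` to `y`. -/
def IsGeodesicSegment {X : Type*} [MetricSpace X] (s : Set X) (x y : X) : Prop :=
  ∃ γ : ℝ → X, γ 0 = x ∧ γ (dist x y) = y ∧
    (∀ a ∈ Set.Icc 0 (dist x y), ∀ b ∈ Set.Icc 0 (dist x y), dist (γ a) (γ b) = |a - b|) ∧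
    s = γ '' Set.Icc 0 (dist x y)

/-- Any two points of `A` are joined by a geodesic contained in `A`. -/
def IsGeodesicSubset {X : Type*} [MetricSpace X] (A : Set X) : Prop :=
  ∀ x ∈ A, ∀ y ∈ A, ∃ s : Set X, IsGeodesicSegment s x y ∧ s ⊆ A

/-- The complete geodesic metric space `F` is tree-graded with respect to the collection of
pieces `P`.  In `triangle` the three sides meet only in the common vertices, so that they form a
simple loop; the case `x = y = z` is the one-point triangle, so the pieces cover `F`. -/
structure IsTreeGraded (F : Type*) [MetricSpace F] (P : Set (Set F)) : Prop where
  complete : CompleteSpace F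
  geodesic : IsGeodesicSubset (Set.univ : Set F)
  piece_closed : ∀ M ∈ P, IsClosed M
  piece_geodesic : ∀ M ∈ P, IsGeodesicSubset M
  inter_subsingleton : ∀ M ∈ P, ∀ N ∈ P, M ≠ N → (M ∩ N).Subsingleton
  triangle : ∀ (x y z : F) (s t u : Set F),
    IsGeodesicSegment s x y → IsGeodesicSegment t y z → IsGeodesicSegment u z x →
    s ∩ t = {y} → t ∩ u = {z} → u ∩ s = {x} → ∃ M ∈ P, s ∪ t ∪ u ⊆ M

/-- `F` has no global cut-point.  By convention a one-point space has a cut-point. -/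
def HasNoCutPoint (F : Type*) [TopologicalSpace F] : Prop :=
  Nontrivial F ∧ ∀ p : F, IsPreconnected ({p}ᶜ : Set F)

/-! ### Ultralimits and asymptotic cones -/

/-- A sequence of scaling constants with `ω`-limit `∞`.  (Its existence forces the
ultrafilter `ω` to be non-principal.) -/
structure ScalingSeq (ω : Ultrafilter ℕ) where
  /-- the scaling constants -/
  val : ℕ → ℝ
  tendsto_val : Tendsto val (ω : Filter ℕ) atTop

/-- Sequences at finite distance from the observation point `e` in the rescaled
ultraproduct of the `X n`. -/
def UltraPts (X : ℕ → Type*) [∀ n, MetricSpace (X n)] {ω : Ultrafilter ℕ} (d : ScalingSeq ω)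
    (e : ∀ n, X n) : Type _ :=
  {x : ∀ n, X n // ∃ C : ℝ, ∀ᶠ n in (ω : Filter ℕ), dist (x n) (e n) / d.val n ≤ C}

namespace UltraPts

variable {X : ℕ → Type*} [∀ n, MetricSpace (X n)] {ω : Ultrafilter ℕ} {d : ScalingSeq ω}
  {e : ∀ n, X n}

/-- The pseudo-distance `lim_ω dist (x n) (y n) / d n`. -/
def limDist (x y : UltraPts X d e) : ℝ :=
  limUnder (ω : Filter ℕ) fun n => dist (x.1 n) (y.1 n) / d.val n

theorem tendsto_limDist (x y : UltraPts X d e) :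
    Tendsto (fun n => dist (x.1 n) (y.1 n) / d.val n) (ω : Filter ℕ) (𝓝 (limDist x y)) := by
  apply tendsto_nhds_limUnder
  obtain ⟨C, hC⟩ := x.2
  obtain ⟨C', hC'⟩ := y.2
  have hmem : ∀ᶠ n in (ω : Filter ℕ),
      dist (x.1 n) (y.1 n) / d.val n ∈ Set.Icc (0 : ℝ) (C + C') := by
    filter_upwards [hC, hC', d.tendsto_val.eventually_gt_atTop 0] with n h h' hpos
    refine ⟨by positivity, le_trans ?_ (add_le_add h h')⟩
    rw [← add_div]
    gcongr
    exact dist_triangle_right _ _ _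
  obtain ⟨a, -, ha⟩ := (isCompact_Icc (a := (0 : ℝ)) (b := C + C')).ultrafilter_le_nhds'
    (ω.map fun n => dist (x.1 n) (y.1 n) / d.val n) hmem
  exact ⟨a, ha⟩

instance : PseudoMetricSpace (UltraPts X d e) where
  dist := limDist
  dist_self x := by
    refine tendsto_nhds_unique (tendsto_limDist x x) ?_
    simp
  dist_comm x y := by
    refine tendsto_nhds_unique (tendsto_limDist x y) ?_
    simpa only [dist_comm] using tendsto_limDist y x
  dist_triangle x y z := by
    refine le_of_tendsto_of_tendsto (tendsto_limDist x z)
      ((tendsto_limDist x y).add (tendsto_limDist y z)) ?_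
    filter_upwards [d.tendsto_val.eventually_gt_atTop 0] with n hpos
    rw [← add_div]
    gcongr
    exact dist_triangle _ _ _

end UltraPts

/-- The ultralimit `lim_ω (X n, dist / d n)` with observation point `e`: the points at finite
distance from `e`, with points at distance `0` identified. -/
abbrev Ultralimit (X : ℕ → Type*) [∀ n, MetricSpace (X n)] {ω : Ultrafilter ℕ} (d : ScalingSeq ω)
    (e : ∀ n, X n) : Type _ :=
  SeparationQuotient (UltraPts X d e)

/-- The asymptotic cone `Con^ω (X; e, d)`. -/
abbrev AsymptoticCone (X : Type*) [MetricSpace X] {ω : Ultrafilter ℕ} (d : ScalingSeq ω)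
    (e : ℕ → X) : Type _ :=
  Ultralimit (fun _ => X) d e

/-- The limit set `lim_ω A n` in the asymptotic cone: all `lim_ω x n` with `x n ∈ A n`
`ω`-almost surely. -/
def limSet {X : Type*} [MetricSpace X] {ω : Ultrafilter ℕ} (d : ScalingSeq ω) (e : ℕ → X)
    (A : ℕ → Set X) : Set (AsymptoticCone X d e) :=
  {p | ∃ x : UltraPts (fun _ => X) d e,
    SeparationQuotient.mk x = p ∧ ∀ᶠ n in (ω : Filter ℕ), x.1 n ∈ A n}

/-- The collection `𝒜_ω` of the limit sets of the sequences `A n ∈ 𝒜` for which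
`dist (e n) (A n) / d n` is bounded. -/
def limPieces {X : Type*} [MetricSpace X] (𝒜 : Set (Set X)) {ω : Ultrafilter ℕ}
    (d : ScalingSeq ω) (e : ℕ → X) : Set (Set (AsymptoticCone X d e)) :=
  {M | ∃ A : ℕ → Set X, (∀ n, A n ∈ 𝒜) ∧
    (∃ C : ℝ, ∀ᶠ n in (ω : Filter ℕ), ∃ a ∈ A n, dist (e n) a / d.val n ≤ C) ∧
    M = limSet d e A}

/-- `X` is asymptotically tree-graded with respect to `𝒜`: every asymptotic cone is tree-graded
with respect to `𝒜_ω`.  The pieces in `𝒜_ω` are labelled by the ultrapower of `𝒜`: sequences that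
are `ω`-almost surely different give different pieces, so these too have at most one common point
(otherwise two members of `𝒜` at finite Hausdorff distance would go unnoticed, and every group
would be asymptotically tree-graded with respect to each finite index subgroup). -/
def IsAsymptoticallyTreeGraded {X : Type*} [MetricSpace X] (𝒜 : Set (Set X)) : Prop :=
  ∀ (ω : Ultrafilter ℕ) (d : ScalingSeq ω) (e : ℕ → X),
    IsTreeGraded (AsymptoticCone X d e) (limPieces 𝒜 d e) ∧
    ∀ A B : ℕ → Set X, (∀ n, A n ∈ 𝒜) → (∀ n, B n ∈ 𝒜) →
      (∀ᶠ n in (ω : Filter ℕ), A n ≠ B n) → (limSet d e A ∩ limSet d e B).Subsingleton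

/-! ### Unconstricted spaces -/

/-- For some ultrafilter and some scaling constants, no asymptotic cone of `B` has a cut-point,
whatever the observation point. -/
def IsUnconstricted (B : Type*) [MetricSpace B] : Prop :=
  ∃ (ω : Ultrafilter ℕ) (d : ScalingSeq ω), ∀ e : ℕ → B, HasNoCutPoint (AsymptoticCone B d e)

/-- A family of geodesic subspaces of `X` (with the induced metrics) is uniformly unconstricted. -/
def IsUniformlyUnconstricted {X : Type*} [MetricSpace X] (𝒜 : Set (Set X)) : Prop :=
  (∀ A ∈ 𝒜, IsGeodesicSubset A) ∧
  ∀ A : ℕ → Set X, (∀ n, A n ∈ 𝒜) →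
    ∃ (ω : Ultrafilter ℕ) (d : ScalingSeq ω), ∀ b : ∀ n, A n,
      HasNoCutPoint (Ultralimit (fun n => A n) d b)

/-! ### Finitely generated groups as metric spaces -/

/-- A finite generating set of `G`. -/
structure FinGenSet (G : Type*) [Group G] where
  /-- the generators -/
  gens : Finset G
  closure_gens : Subgroup.closure (gens : Set G) = ⊤

/-- The vertex set of the Cayley graph of `G` with respect to `S`, that is `G` itself, to be
equipped with the word metric. -/
def CayleyVertices {G : Type*} [Group G] (_S : FinGenSet G) : Type _ := G

namespace CayleyVertices

variable {G : Type*} [Group G] (S : FinGenSet G)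

/-- The Cayley graph: `a` and `b ≠ a` are adjacent if `a⁻¹ * b` is a generator or the inverse of a
generator. -/
def graph : SimpleGraph G := SimpleGraph.mulCayley (S.gens : Set G)

theorem graph_connected : (graph S).Connected := by
  have key : ∀ g ∈ Subgroup.closure (S.gens : Set G), ∀ a, (graph S).Reachable a (a * g) := by
    intro g hg
    induction hg using Subgroup.closure_induction with
    | mem x hx =>
      intro a
      by_cases h : a = a * x
      · rw [← h]
      · refine SimpleGraph.Adj.reachable ?_
        rw [graph, SimpleGraph.mulCayley_adj']
        exact ⟨h, x, hx, Or.inl rfl⟩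
    | one => intro a; simp
    | mul x y _ _ hx hy =>
      intro a
      rw [← mul_assoc]
      exact (hx a).trans (hy (a * x))
    | inv x _ hx =>
      intro a
      simpa using (hx (a * x⁻¹)).symm
  have : Nonempty G := ⟨1⟩
  refine SimpleGraph.Connected.mk fun a b => ?_
  have := key (a⁻¹ * b) (by rw [S.closure_gens]; trivial) a
  simpa using this

/-- The word metric: the path distance between vertices of the Cayley graph. -/
instance : MetricSpace (CayleyVertices S) where
  dist a b := ((graph S).dist a b : ℝ)
  dist_self a := Nat.cast_eq_zero.2 SimpleGraph.dist_self
  dist_comm a b := congrArg Nat.cast SimpleGraph.dist_comm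
  dist_triangle a b c := by exact_mod_cast (graph_connected S).dist_triangle
  eq_of_dist_eq_zero {a b} h := by
    have h' : (graph S).dist a b = 0 := by exact_mod_cast h
    exact (graph_connected S).dist_eq_zero_iff.1 h'

end CayleyVertices

/-- A group that is finitely generated and quasi-isometric, with a word metric, to `X`. -/
def GroupQuasiIsometricToSpace (G : Type*) [Group G] (X : Type*) [MetricSpace X] : Prop :=
  ∃ S : FinGenSet G, QuasiIsometric (CayleyVertices S) X

/-- Two finitely generated groups are quasi-isometric with respect to word metrics. -/
def GroupsQuasiIsometric (G G' : Type*) [Group G] [Group G'] : Prop :=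
  ∃ (S : FinGenSet G) (T : FinGenSet G'), QuasiIsometric (CayleyVertices S) (CayleyVertices T)

/-- A finitely generated group that is unconstricted with respect to a word metric. -/
def IsUnconstrictedGroup (G : Type*) [Group G] : Prop :=
  ∃ S : FinGenSet G, IsUnconstricted (CayleyVertices S)

/-- The collection of all left cosets `g H i`, as subsets of the Cayley graph. -/
def leftCosets {G : Type*} [Group G] (S : FinGenSet G) {k : ℕ} (H : Fin k → Subgroup G) :
    Set (Set (CayleyVertices S)) :=
  {A | ∃ (g : G) (i : Fin k), A = {x : G | g⁻¹ * x ∈ H i}}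

/-- `G`, with the word metric of `S`, is asymptotically tree-graded with respect to the subgroups
`H i`, that is, with respect to the collection of all their left cosets. -/
def IsGroupTreeGraded {G : Type*} [Group G] (S : FinGenSet G) {k : ℕ}
    (H : Fin k → Subgroup G) : Prop :=
  IsAsymptoticallyTreeGraded (leftCosets S H)

end

/-!
In a tree-graded space every geodesic from a point to a piece can be made to enter the piece through
one gate, and the gate is locally constant off the piece. Hence a connected set without cut-points
that has two points in a piece lies inside that piece. Applied in asymptotic cones, this shows that
a quasi-isometric copy of an unconstricted space stays, with uniform constants, near a single member
of `𝒜`; conversely two different members of `𝒜` have no common limit with two points, so that this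
member is unique.

A group `Γ` quasi-isometric to `X` therefore permutes `𝒜` coarsely. Since only finitely many members
of `𝒜` meet a given ball, there are finitely many orbits, and the stabilizer of each member acts
coboundedly on it. By the Milnor–Schwarz lemma the stabilizers of representatives are finitely
generated and quasi-isometric to members of `𝒜`, and their left cosets correspond to all the
members, which transfers the tree-graded structure of the cones of `X` to those of `Γ`.
-/

/-! ### Geodesics -/

/-- `γ` is a unit speed geodesic on the set of parameters `T`. -/
def IsGeodesicOn {X : Type*} [MetricSpace X] (γ : ℝ → X) (T : Set ℝ) : Prop :=
  ∀ u ∈ T, ∀ v ∈ T, dist (γ u) (γ v) = |u - v|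

namespace IsGeodesicOn

variable {X : Type*} [MetricSpace X] {γ η : ℝ → X} {S T : Set ℝ} {a b c : ℝ}

theorem of_le (h : ∀ u ∈ T, ∀ v ∈ T, u ≤ v → dist (γ u) (γ v) = v - u) : IsGeodesicOn γ T := by
  intro u hu v hv
  rcases le_total u v with huv | huv
  · rw [h u hu v hv huv, abs_sub_comm, abs_of_nonneg (sub_nonneg.2 huv)]
  · rw [dist_comm, h v hv u hu huv, abs_of_nonneg (sub_nonneg.2 huv)]

theorem dist_of_le (h : IsGeodesicOn γ T) {u v : ℝ} (hu : u ∈ T) (hv : v ∈ T) (huv : u ≤ v) :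
    dist (γ u) (γ v) = v - u := by
  rw [h u hu v hv, abs_sub_comm, abs_of_nonneg (sub_nonneg.2 huv)]

theorem mono (h : IsGeodesicOn γ T) (hST : S ⊆ T) : IsGeodesicOn γ S :=
  fun u hu v hv => h u (hST hu) v (hST hv)

theorem continuousOn (h : IsGeodesicOn γ T) : ContinuousOn γ T := by
  refine (LipschitzOnWith.of_dist_le_mul (K := 1) fun u hu v hv => ?_).continuousOn
  rw [h u hu v hv, Real.dist_eq, NNReal.coe_one, one_mul]

theorem injOn (h : IsGeodesicOn γ T) : Set.InjOn γ T := by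
  intro u hu v hv huv
  have := h u hu v hv
  rw [huv, dist_self] at this
  exact sub_eq_zero.1 (abs_eq_zero.1 this.symm)

theorem comp_const_sub (h : IsGeodesicOn γ (Set.Icc (c - b) (c - a))) :
    IsGeodesicOn (fun u => γ (c - u)) (Set.Icc a b) := by
  refine of_le fun u hu v hv huv => ?_
  rw [dist_comm, h.dist_of_le ⟨by linarith [hv.2], by linarith [hv.1]⟩
    ⟨by linarith [hu.2], by linarith [hu.1]⟩ (by linarith)]
  ring

theorem comp_sub_const (h : IsGeodesicOn γ (Set.Icc (a - c) (b - c))) :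
    IsGeodesicOn (fun u => γ (u - c)) (Set.Icc a b) := by
  refine of_le fun u hu v hv huv => ?_
  rw [h.dist_of_le ⟨by linarith [hu.1], by linarith [hu.2]⟩
    ⟨by linarith [hv.1], by linarith [hv.2]⟩ (by linarith)]
  ring

theorem exists_glue (hγ : IsGeodesicOn γ (Set.Icc a b)) (hη : IsGeodesicOn η (Set.Icc b c))
    (hab : a ≤ b) (hbc : b ≤ c) (hb : γ b = η b) (hac : dist (γ a) (η c) = c - a) :
    ∃ δ : ℝ → X, IsGeodesicOn δ (Set.Icc a c) ∧ Set.EqOn δ γ (Set.Icc a b) ∧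
      Set.EqOn δ η (Set.Icc b c) := by
  have across : ∀ u ∈ Set.Icc a b, ∀ v ∈ Set.Icc b c, dist (γ u) (η v) = v - u := by
    intro u hu v hv
    have ht := dist_triangle (γ u) (γ b) (η v)
    have hT := dist_triangle4 (γ a) (γ u) (η v) (η c)
    rw [hγ.dist_of_le hu ⟨hab, le_rfl⟩ hu.2, hb, hη.dist_of_le ⟨le_rfl, hbc⟩ hv hv.1] at ht
    rw [hγ.dist_of_le ⟨le_rfl, hab⟩ hu hu.1, hη.dist_of_le hv ⟨hbc, le_rfl⟩ hv.2, hac] at hT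
    linarith
  let δ : ℝ → X := fun u => if u ≤ b then γ u else η u
  have left : ∀ {u}, u ≤ b → δ u = γ u := fun hu => if_pos hu
  have right : ∀ {u}, b ≤ u → δ u = η u := fun {u} hu => by
    rcases hu.eq_or_lt with rfl | hu
    · rw [left le_rfl, hb]
    · exact if_neg hu.not_ge
  refine ⟨δ, of_le fun u hu v hv huv => ?_, fun u hu => left hu.2, fun u hu => right hu.1⟩
  rcases le_total v b with hvb | hbv
  · rw [left (huv.trans hvb), left hvb, hγ.dist_of_le ⟨hu.1, huv.trans hvb⟩ ⟨hv.1, hvb⟩ huv]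
  rcases le_total u b with hub | hbu
  · rw [left hub, right hbv, across u ⟨hu.1, hub⟩ v ⟨hbv, hv.2⟩]
  · rw [right hbu, right hbv, hη.dist_of_le ⟨hbu, hu.2⟩ ⟨hbv, hv.2⟩ huv]

end IsGeodesicOn

namespace IsGeodesicSegment

variable {X : Type*} [MetricSpace X] {s t u : Set X} {x y z p : X}

theorem of_isGeodesicOn {γ : ℝ → X} {a b : ℝ} (hab : a ≤ b) (h : IsGeodesicOn γ (Set.Icc a b)) :
    IsGeodesicSegment (γ '' Set.Icc a b) (γ a) (γ b) := by
  have hd : dist (γ a) (γ b) = b - a := h.dist_of_le ⟨le_rfl, hab⟩ ⟨hab, le_rfl⟩ hab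
  have hsub : IsGeodesicOn (fun u => γ (u - -a)) (Set.Icc 0 (b - a)) := by
    refine IsGeodesicOn.comp_sub_const ?_
    simpa using h
  refine ⟨_, by simp, by simp [hd], hd ▸ hsub, ?_⟩
  rw [hd, ← Set.image_image γ (fun u => u - -a), Set.image_sub_const_Icc]
  simp

theorem singleton (x : X) : IsGeodesicSegment {x} x x :=
  ⟨fun _ => x, rfl, rfl, by simp, by simp⟩

theorem exists_isGeodesicOn (h : IsGeodesicSegment s x y) :
    ∃ γ : ℝ → X, γ 0 = x ∧ γ (dist x y) = y ∧ IsGeodesicOn γ (Set.Icc 0 (dist x y)) ∧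
      s = γ '' Set.Icc 0 (dist x y) := h

theorem left_mem (h : IsGeodesicSegment s x y) : x ∈ s := by
  obtain ⟨γ, rfl, -, -, rfl⟩ := h.exists_isGeodesicOn
  exact Set.mem_image_of_mem γ ⟨le_rfl, dist_nonneg⟩

theorem symm (h : IsGeodesicSegment s x y) : IsGeodesicSegment s y x := by
  obtain ⟨γ, h0, h1, hγ, rfl⟩ := h.exists_isGeodesicOn
  refine ⟨fun u => γ (dist x y - u), by simpa using h1, by simpa [dist_comm y x] using h0,
    IsGeodesicOn.comp_const_sub ?_, ?_⟩
  · simpa [dist_comm y x] using hγ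
  · rw [← Set.image_image γ (fun u => dist x y - u), Set.image_const_sub_Icc, dist_comm y x]
    simp

theorem right_mem (h : IsGeodesicSegment s x y) : y ∈ s :=
  h.symm.left_mem

theorem isCompact (h : IsGeodesicSegment s x y) : IsCompact s := by
  obtain ⟨γ, -, -, hγ, rfl⟩ := h.exists_isGeodesicOn
  exact isCompact_Icc.image_of_continuousOn hγ.continuousOn

theorem isClosed (h : IsGeodesicSegment s x y) : IsClosed s :=
  h.isCompact.isClosed

theorem isPreconnected (h : IsGeodesicSegment s x y) : IsPreconnected s := by
  obtain ⟨γ, -, -, hγ, rfl⟩ := h.exists_isGeodesicOn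
  exact isPreconnected_Icc.image _ hγ.continuousOn

theorem exists_split (h : IsGeodesicSegment s x y) (hp : p ∈ s) :
    ∃ s₁ s₂, IsGeodesicSegment s₁ x p ∧ IsGeodesicSegment s₂ p y ∧ s₁ ∪ s₂ = s := by
  obtain ⟨γ, h0, h1, hγ, rfl⟩ := h.exists_isGeodesicOn
  obtain ⟨a, ha, rfl⟩ := hp
  have h₁ := of_isGeodesicOn ha.1 (hγ.mono (Set.Icc_subset_Icc le_rfl ha.2))
  have h₂ := of_isGeodesicOn ha.2 (hγ.mono (Set.Icc_subset_Icc ha.1 le_rfl))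
  refine ⟨_, _, h0 ▸ h₁, h1 ▸ h₂, ?_⟩
  rw [← Set.image_union, Set.Icc_union_Icc_eq_Icc ha.1 ha.2]

theorem dist_add (h : IsGeodesicSegment s x y) (hz : z ∈ s) :
    dist x z + dist z y = dist x y := by
  obtain ⟨γ, h0, h1, hγ, rfl⟩ := h.exists_isGeodesicOn
  obtain ⟨u, hu, rfl⟩ := hz
  have hl := hγ.dist_of_le ⟨le_rfl, dist_nonneg⟩ hu hu.1
  have hr := hγ.dist_of_le hu ⟨dist_nonneg, le_rfl⟩ hu.2
  rw [h0] at hl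
  rw [h1] at hr
  linarith

theorem eq_of_dist_eq (h : IsGeodesicSegment s x y) {v w : X} (hv : v ∈ s) (hw : w ∈ s)
    (hvw : dist x v = dist x w) : v = w := by
  obtain ⟨γ, rfl, -, hγ, rfl⟩ := h.exists_isGeodesicOn
  obtain ⟨a, ha, rfl⟩ := hv
  obtain ⟨b, hb, rfl⟩ := hw
  have h0 : (0 : ℝ) ∈ Set.Icc 0 (dist (γ 0) y) := ⟨le_rfl, dist_nonneg⟩
  rw [hγ.dist_of_le h0 ha ha.1, hγ.dist_of_le h0 hb hb.1] at hvw
  rw [sub_left_injective hvw]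

theorem eq_left_of_dist_le (h : IsGeodesicSegment s x y) (hz : z ∈ s) (hd : dist x y ≤ dist z y) :
    z = x :=
  (dist_le_zero.1 (by linarith [h.dist_add hz])).symm

theorem eq_singleton (h : IsGeodesicSegment s x x) : s = {x} :=
  Set.eq_singleton_iff_unique_mem.2
    ⟨h.left_mem, fun _ hw => h.eq_left_of_dist_le hw (by rw [dist_self]; exact dist_nonneg)⟩

theorem exists_mid (h : IsGeodesicSegment s x y) (hxy : x ≠ y) : ∃ m ∈ s, m ≠ x ∧ m ≠ y := by
  obtain ⟨γ, h0, h1, hγ, rfl⟩ := h.exists_isGeodesicOn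
  have hpos : 0 < dist x y := dist_pos.2 hxy
  have hm : dist x y / 2 ∈ Set.Icc 0 (dist x y) := ⟨by linarith, by linarith⟩
  refine ⟨_, Set.mem_image_of_mem γ hm, fun e => ?_, fun e => ?_⟩
  · have := hγ.injOn hm ⟨le_rfl, hpos.le⟩ (e.trans h0.symm)
    linarith
  · have := hγ.injOn hm ⟨hpos.le, le_rfl⟩ (e.trans h1.symm)
    linarith

theorem exists_sub (h : IsGeodesicSegment s x y) {a b : X} (ha : a ∈ s) (hb : b ∈ s) :
    ∃ r ⊆ s, IsGeodesicSegment r a b := by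
  obtain ⟨s₁, s₂, hs₁, hs₂, rfl⟩ := h.exists_split ha
  rcases hb with hb | hb
  · obtain ⟨-, r, -, hr, rfl⟩ := hs₁.exists_split hb
    exact ⟨r, Set.subset_union_right.trans Set.subset_union_left, hr.symm⟩
  · obtain ⟨r, -, hr, -, rfl⟩ := hs₂.exists_split hb
    exact ⟨r, Set.subset_union_left.trans Set.subset_union_right, hr⟩

theorem isGeodesicSubset (h : IsGeodesicSegment s x y) : IsGeodesicSubset s :=
  fun _ ha _ hb => let ⟨r, hr, hr'⟩ := h.exists_sub ha hb; ⟨r, hr', hr⟩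

theorem concat (hs : IsGeodesicSegment s x y) (ht : IsGeodesicSegment t y z)
    (hd : dist x z = dist x y + dist y z) : IsGeodesicSegment (s ∪ t) x z := by
  obtain ⟨γ, h0, hγy, hγ, rfl⟩ := hs.exists_isGeodesicOn
  obtain ⟨η, hηy, h1, hη, rfl⟩ := ht.exists_isGeodesicOn
  set a := dist x y
  set b := dist y z
  have ha : 0 ≤ a := dist_nonneg
  have hb : 0 ≤ b := dist_nonneg
  have hη' : IsGeodesicOn (fun u => η (u - a)) (Set.Icc a (a + b)) := by
    refine IsGeodesicOn.comp_sub_const ?_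
    simpa using hη
  obtain ⟨δ, hδ, hδγ, hδη⟩ := hγ.exists_glue hη' ha (le_add_of_nonneg_right hb)
    (by simp [hγy, hηy]) (by simpa [h0, h1] using hd)
  have hseg := of_isGeodesicOn (add_nonneg ha hb) hδ
  have himage : δ '' Set.Icc 0 (a + b) = γ '' Set.Icc 0 a ∪ η '' Set.Icc 0 b := by
    rw [← Set.Icc_union_Icc_eq_Icc ha (le_add_of_nonneg_right hb), Set.image_union, hδγ.image_eq,
      hδη.image_eq, ← Set.image_image η (fun u => u - a), Set.image_sub_const_Icc]
    simp
  rw [himage, hδγ ⟨le_rfl, ha⟩, hδη ⟨le_add_of_nonneg_right hb, le_rfl⟩, h0] at hseg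
  simpa [h1] using hseg

theorem exists_first (h : IsGeodesicSegment s x y) {M : Set X} (hM : IsClosed M) (hy : y ∈ M) :
    ∃ p, ∃ r ⊆ s, IsGeodesicSegment r x p ∧ r ∩ M = {p} := by
  obtain ⟨p, ⟨hps, hpM⟩, hmin⟩ := (h.isCompact.inter_right hM).exists_isMinOn
    ⟨y, h.right_mem, hy⟩ (continuous_const.dist continuous_id : Continuous (dist x)).continuousOn
  obtain ⟨r, hrs, hr⟩ := h.exists_sub h.left_mem hps
  refine ⟨p, r, hrs, hr, Set.eq_singleton_iff_unique_mem.2 ⟨⟨hr.right_mem, hpM⟩, ?_⟩⟩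
  rintro w ⟨hw, hwM⟩
  have hle : dist x p ≤ dist x w := hmin ⟨hrs hw, hwM⟩
  exact hr.symm.eq_left_of_dist_le hw (by rwa [dist_comm p, dist_comm w])

theorem exists_bridge (h : IsGeodesicSegment s x y) {M N : Set X} (hM : IsClosed M)
    (hN : IsClosed N) (hx : x ∈ M) (hy : y ∈ N) :
    ∃ a b, ∃ r ⊆ s, IsGeodesicSegment r a b ∧ r ∩ M = {a} ∧ r ∩ N = {b} := by
  obtain ⟨a, r, hrs, hr, hrM⟩ := h.symm.exists_first hM hx
  obtain ⟨b, q, hqr, hq, hqN⟩ := hr.symm.exists_first hN hy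
  have haM : a ∈ r ∩ M := hrM ▸ rfl
  refine ⟨a, b, q, hqr.trans hrs, hq, ?_, hqN⟩
  exact Set.Subset.antisymm (hrM ▸ Set.inter_subset_inter_left M hqr)
    (Set.singleton_subset_iff.2 ⟨hq.left_mem, haM.2⟩)

theorem isPreconnected_diff_left (h : IsGeodesicSegment s x y) : IsPreconnected (s \ {x}) := by
  obtain ⟨γ, rfl, -, hγ, rfl⟩ := h.exists_isGeodesicOn
  have h0 : (0 : ℝ) ∈ Set.Icc 0 (dist (γ 0) y) := ⟨le_rfl, dist_nonneg⟩
  rw [← Set.image_singleton, ← hγ.injOn.image_sdiff_subset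
    (Set.singleton_subset_iff.2 h0), Set.Icc_sdiff_left]
  exact isPreconnected_Ioc.image _
    (hγ.continuousOn.mono Set.Ioc_subset_Icc_self)

end IsGeodesicSegment

/-- `s`, `t`, `u` are geodesics from `x` to `y` to `z` to `x` that meet only in these common
endpoints. As in `IsTreeGraded.triangle`, the case `x = y = z` is allowed. -/
structure IsSimpleTriangle {X : Type*} [MetricSpace X] (s t u : Set X) (x y z : X) : Prop where
  fst : IsGeodesicSegment s x y
  snd : IsGeodesicSegment t y z
  trd : IsGeodesicSegment u z x
  inter_fst_snd : s ∩ t = {y}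
  inter_snd_trd : t ∩ u = {z}
  inter_trd_fst : u ∩ s = {x}

namespace IsSimpleTriangle

variable {X : Type*} [MetricSpace X] {s t u : Set X} {x y z p : X}

theorem rotate (h : IsSimpleTriangle s t u x y z) : IsSimpleTriangle t u s y z x :=
  ⟨h.snd, h.trd, h.fst, h.inter_snd_trd, h.inter_trd_fst, h.inter_fst_snd⟩

theorem isPreconnected (h : IsSimpleTriangle s t u x y z) : IsPreconnected (s ∪ t ∪ u) :=
  (h.fst.isPreconnected.union y h.fst.right_mem h.snd.left_mem h.snd.isPreconnected).union z
    (Or.inr h.snd.right_mem) h.trd.left_mem h.trd.isPreconnected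

theorem ne_rotate (h : IsSimpleTriangle s t u x y z) (hxy : x ≠ y) : y ≠ z := by
  rintro rfl
  have hy : y ∈ u ∩ s := ⟨h.trd.left_mem, h.fst.right_mem⟩
  rw [h.inter_trd_fst] at hy
  exact hxy hy.symm

theorem eq_singleton (h : IsSimpleTriangle s t u x x z) : s ∪ t ∪ u = {x} := by
  have hx : x ∈ t ∩ u := ⟨h.snd.left_mem, h.trd.right_mem⟩
  rw [h.inter_snd_trd] at hx
  obtain rfl : x = z := hx
  rw [h.fst.eq_singleton, h.snd.eq_singleton, h.trd.eq_singleton, Set.union_self, Set.union_self]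

theorem isPreconnected_diff_vertex (h : IsSimpleTriangle s t u x y z) (hxy : x ≠ y) :
    IsPreconnected ((s ∪ t ∪ u) \ {x}) := by
  have hxz : z ≠ x := h.rotate.ne_rotate (h.ne_rotate hxy)
  have hxt : x ∉ t := fun hx => hxy (h.inter_fst_snd.subset ⟨h.fst.left_mem, hx⟩)
  rw [Set.union_sdiff_distrib, Set.union_sdiff_distrib, Set.sdiff_singleton_eq_self hxt]
  have hs : IsPreconnected (s \ {x}) := h.fst.isPreconnected_diff_left
  have hu : IsPreconnected (u \ {x}) := h.trd.symm.isPreconnected_diff_left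
  have hy : y ∈ s \ {x} := ⟨h.fst.right_mem, hxy.symm⟩
  exact (hs.union y hy h.snd.left_mem h.snd.isPreconnected).union z
    (Or.inr h.snd.right_mem) ⟨h.trd.left_mem, hxz⟩ hu

theorem isPreconnected_diff_of_mem_side (h : IsSimpleTriangle s t u x y z) (hs : p ∈ s)
    (ht : p ∉ t) (hu : p ∉ u) : IsPreconnected ((s ∪ t ∪ u) \ {p}) := by
  have hxp : x ≠ p := fun e => hu (e ▸ h.trd.right_mem)
  have hyp : y ≠ p := fun e => ht (e ▸ h.snd.left_mem)
  obtain ⟨s₁, s₂, hs₁, hs₂, rfl⟩ := h.fst.exists_split hs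
  have hsplit : (s₁ ∪ s₂ ∪ t ∪ u) \ {p} = (s₂ \ {p} ∪ t) ∪ (u ∪ s₁ \ {p}) := by
    rw [Set.union_sdiff_distrib, Set.union_sdiff_distrib, Set.union_sdiff_distrib,
      Set.sdiff_singleton_eq_self ht, Set.sdiff_singleton_eq_self hu]
    ac_rfl
  rw [hsplit]
  refine IsPreconnected.union z (Or.inr h.snd.right_mem) (Or.inl h.trd.left_mem) ?_ ?_
  · exact hs₂.isPreconnected_diff_left.union y ⟨hs₂.right_mem, hyp⟩ h.snd.left_mem
      h.snd.isPreconnected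
  · exact h.trd.isPreconnected.union x h.trd.right_mem ⟨hs₁.left_mem, hxp⟩
      hs₁.symm.isPreconnected_diff_left

theorem isPreconnected_diff_of_mem (h : IsSimpleTriangle s t u x y z) (hxy : x ≠ y)
    (hs : p ∈ s) : IsPreconnected ((s ∪ t ∪ u) \ {p}) := by
  have hyz := h.ne_rotate hxy
  have hrot : s ∪ t ∪ u = t ∪ u ∪ s := by ac_rfl
  by_cases hu : p ∈ u
  · obtain rfl : p = x := h.inter_trd_fst.subset ⟨hu, hs⟩
    exact h.isPreconnected_diff_vertex hxy
  by_cases ht : p ∈ t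
  · obtain rfl : p = y := h.inter_fst_snd.subset ⟨hs, ht⟩
    exact hrot ▸ h.rotate.isPreconnected_diff_vertex hyz
  · exact h.isPreconnected_diff_of_mem_side hs ht hu

theorem isPreconnected_diff (h : IsSimpleTriangle s t u x y z) (hxy : x ≠ y) (p : X) :
    IsPreconnected ((s ∪ t ∪ u) \ {p}) := by
  have hyz := h.ne_rotate hxy
  by_cases hp : p ∈ s ∪ t ∪ u
  · obtain (hs | ht) | hu := hp
    · exact h.isPreconnected_diff_of_mem hxy hs
    · have := h.rotate.isPreconnected_diff_of_mem hyz ht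
      rwa [show t ∪ u ∪ s = s ∪ t ∪ u by ac_rfl] at this
    · have := h.rotate.rotate.isPreconnected_diff_of_mem (h.rotate.ne_rotate hyz) hu
      rwa [show u ∪ s ∪ t = s ∪ t ∪ u by ac_rfl] at this
  · rw [Set.sdiff_singleton_eq_self hp]
    exact h.isPreconnected

end IsSimpleTriangle

/-! ### Gates -/

/-- `p` is the gate of `x` in `M`: the point of `M` through which every geodesic from `x` to a
point of `M` can be made to pass. -/
structure IsGate {F : Type*} [MetricSpace F] (M : Set F) (x p : F) : Prop where
  mem : p ∈ M
  dist_eq : ∀ z ∈ M, dist x z = dist x p + dist p z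

namespace IsGate

variable {F : Type*} [MetricSpace F] {M g : Set F} {x p q w : F}

theorem dist_le (h : IsGate M x p) {z : F} (hz : z ∈ M) : dist x p ≤ dist x z := by
  linarith [h.dist_eq z hz, dist_nonneg (x := p) (y := z)]

theorem unique (hp : IsGate M x p) (hq : IsGate M x q) : p = q :=
  dist_le_zero.1 (by linarith [hp.dist_eq q hq.mem, hq.dist_le hp.mem])

theorem self (hx : x ∈ M) : IsGate M x x :=
  ⟨hx, fun z _ => by rw [dist_self, zero_add]⟩

theorem of_mem_segment (h : IsGate M x p) (hg : IsGeodesicSegment g x p) (hw : w ∈ g) :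
    IsGate M w p := by
  refine ⟨h.mem, fun z hz => le_antisymm (dist_triangle w p z) ?_⟩
  linarith [hg.dist_add hw, h.dist_eq z hz, dist_triangle x w z]

end IsGate

/-- Every simple geodesic triangle that meets `M` in at least two points is contained in `M`: the
property of the pieces of a tree-graded space from which their gates are obtained. -/
def AbsorbsTriangles {F : Type*} [MetricSpace F] (M : Set F) : Prop :=
  ∀ (x y z : F) (s t u : Set F), IsSimpleTriangle s t u x y z →
    ((s ∪ t ∪ u) ∩ M).Nontrivial → s ∪ t ∪ u ⊆ M

namespace AbsorbsTriangles

variable {F : Type*} [MetricSpace F] {M : Set F}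

theorem first_unique (hT : AbsorbsTriangles M) (hgM : IsGeodesicSubset M) {x p q : F}
    {s t : Set F} (hs : IsGeodesicSegment s x p) (ht : IsGeodesicSegment t x q)
    (hsM : s ∩ M = {p}) (htM : t ∩ M = {q}) : p = q := by
  by_contra hpq
  have hp : p ∈ s ∩ M := hsM ▸ rfl
  have hq : q ∈ t ∩ M := htM ▸ rfl
  obtain ⟨o, s', hs's, hs', hs't⟩ := hs.symm.exists_first ht.isClosed ht.left_mem
  have ho : o ∈ s' ∩ t := hs't ▸ rfl
  obtain ⟨t', ht't, ht'⟩ := ht.exists_sub ht.right_mem ho.2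
  obtain ⟨r, hr, hrM⟩ := hgM p hp.2 q hq.2
  have htri : IsSimpleTriangle s' r t' o p q := by
    refine ⟨hs'.symm, hr, ht', ?_, ?_, ?_⟩ <;> refine Set.eq_singleton_iff_unique_mem.2 ⟨?_, ?_⟩
    · exact ⟨hs'.left_mem, hr.left_mem⟩
    · exact fun w hw => hsM.subset ⟨hs's hw.1, hrM hw.2⟩
    · exact ⟨hr.right_mem, ht'.left_mem⟩
    · exact fun w hw => htM.subset ⟨ht't hw.2, hrM hw.1⟩
    · exact ⟨ht'.right_mem, hs'.right_mem⟩
    · exact fun w hw => hs't.subset ⟨hw.2, ht't hw.1⟩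
  have hsub := hT _ _ _ _ _ _ htri ⟨p, ⟨Or.inl (Or.inr hr.left_mem), hp.2⟩, q,
    ⟨Or.inl (Or.inr hr.right_mem), hq.2⟩, hpq⟩
  have hoM : o ∈ M := hsub (Or.inl (Or.inl hs'.right_mem))
  have hop : o = p := hsM.subset ⟨hs's ho.1, hoM⟩
  have hoq : o = q := htM.subset ⟨ho.2, hoM⟩
  exact hpq (hop.symm.trans hoq)

theorem exists_isGate (hT : AbsorbsTriangles M) (hF : IsGeodesicSubset (Set.univ : Set F))
    (hM : IsClosed M) (hgM : IsGeodesicSubset M) (hne : M.Nonempty) (x : F) :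
    ∃ p, IsGate M x p := by
  obtain ⟨z₀, hz₀⟩ := hne
  obtain ⟨s₀, hs₀, -⟩ := hF x trivial z₀ trivial
  obtain ⟨p, r, -, hr, hrM⟩ := hs₀.exists_first hM hz₀
  have hp : p ∈ r ∩ M := hrM ▸ rfl
  refine ⟨p, hp.2, fun z hz => ?_⟩
  obtain ⟨s, hs, -⟩ := hF x trivial z trivial
  obtain ⟨q, r', hr's, hr', hr'M⟩ := hs.exists_first hM hz
  obtain rfl := hT.first_unique hgM hr hr' hrM hr'M
  exact (hs.dist_add (hr's hr'.right_mem)).symm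

theorem gate_eq_of_disjoint (hT : AbsorbsTriangles M) (hF : IsGeodesicSubset (Set.univ : Set F))
    (hgM : IsGeodesicSubset M) {x y p q : F} (hp : IsGate M x p) (hq : IsGate M y q) {h : Set F}
    (hh : IsGeodesicSegment h x y) (hd : Disjoint h M) : p = q := by
  by_contra hpq
  obtain ⟨g, hg, -⟩ := hF x trivial p trivial
  obtain ⟨k, hk, -⟩ := hF y trivial q trivial
  obtain ⟨a, b, r, hrh, hr, hrg, hrk⟩ :=
    hh.exists_bridge hg.isClosed hk.isClosed hg.left_mem hk.left_mem
  have ha : a ∈ r ∩ g := hrg ▸ rfl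
  have hb : b ∈ r ∩ k := hrk ▸ rfl
  obtain ⟨g', hg'g, hg'⟩ := hg.exists_sub hg.right_mem ha.2
  obtain ⟨k', hk'k, hk'⟩ := hk.exists_sub hb.2 hk.right_mem
  obtain ⟨m, hm, hmM⟩ := hgM q hq.mem p hp.mem
  have hrM : ∀ w ∈ r, w ∉ M := fun w hw => Set.disjoint_left.1 hd (hrh hw)
  have htri : IsSimpleTriangle r (k' ∪ m) g' a b p := by
    refine ⟨hr, hk'.concat hm ((hq.of_mem_segment hk hb.2).dist_eq p hp.mem), hg', ?_, ?_, ?_⟩ <;>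
      refine Set.eq_singleton_iff_unique_mem.2 ⟨?_, ?_⟩
    · exact ⟨hr.right_mem, Or.inl hk'.left_mem⟩
    · rintro w ⟨hw, hwk | hwm⟩
      · exact hrk.subset ⟨hw, hk'k hwk⟩
      · exact absurd (hmM hwm) (hrM w hw)
    · exact ⟨Or.inr hm.right_mem, hg'.left_mem⟩
    · rintro w ⟨hwk | hwm, hwg⟩
      · exact absurd ((hp.of_mem_segment hg (hg'g hwg)).unique
          (hq.of_mem_segment hk (hk'k hwk))) hpq
      · exact (IsGate.self (hmM hwm)).unique (hp.of_mem_segment hg (hg'g hwg))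
    · exact ⟨hg'.right_mem, hr.left_mem⟩
    · exact fun w hw => hrg.subset ⟨hw.2, hg'g hw.1⟩
  have hsub := hT _ _ _ _ _ _ htri ⟨p, ⟨Or.inr hg'.left_mem, hp.mem⟩, q,
    ⟨Or.inl (Or.inr (Or.inl hk'.right_mem)), hq.mem⟩, hpq⟩
  exact hrM a ha.1 (hsub (Or.inr hg'.right_mem))

end AbsorbsTriangles

/-- `π` maps every point to its gate in `M`, and is constant along segments that avoid `M`. -/
structure IsGateMap {F : Type*} [MetricSpace F] (M : Set F) (π : F → F) : Prop where
  isGate : ∀ x, IsGate M x (π x)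
  const : ∀ x y s, IsGeodesicSegment s x y → Disjoint s M → π x = π y

theorem AbsorbsTriangles.exists_isGateMap {F : Type*} [MetricSpace F] {M : Set F}
    (hT : AbsorbsTriangles M) (hF : IsGeodesicSubset (Set.univ : Set F)) (hM : IsClosed M)
    (hgM : IsGeodesicSubset M) (hne : M.Nonempty) : ∃ π : F → F, IsGateMap M π := by
  choose π hπ using hT.exists_isGate hF hM hgM hne
  exact ⟨π, hπ, fun x y _ hh hd => hT.gate_eq_of_disjoint hF hgM (hπ x) (hπ y) hh hd⟩

namespace IsGateMap

variable {F : Type*} [MetricSpace F] {M : Set F} {π : F → F}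

theorem eq_self (h : IsGateMap M π) {x : F} (hx : x ∈ M) : π x = x :=
  (h.isGate x).unique (IsGate.self hx)

theorem lipschitzWith (h : IsGateMap M π) (hF : IsGeodesicSubset (Set.univ : Set F)) :
    LipschitzWith 1 π := by
  refine LipschitzWith.of_dist_le_mul fun x y => ?_
  rw [NNReal.coe_one, one_mul]
  obtain ⟨s, hs, -⟩ := hF x trivial y trivial
  by_cases hd : Disjoint s M
  · rw [h.const x y s hs hd, dist_self]
    exact dist_nonneg
  obtain ⟨m, hm, hmM⟩ := Set.not_disjoint_iff.1 hd
  calc dist (π x) (π y) ≤ dist (π x) m + dist (π y) m := dist_triangle_right _ _ _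
    _ ≤ dist x m + dist y m := by
        linarith [(h.isGate x).dist_eq m hmM, (h.isGate y).dist_eq m hmM,
          dist_nonneg (x := x) (y := π x), dist_nonneg (x := y) (y := π y)]
    _ = dist x y := by rw [dist_comm y m, hs.dist_add hm]

theorem isOpen_fiber_diff (h : IsGateMap M π) (hF : IsGeodesicSubset (Set.univ : Set F)) (p : F) :
    IsOpen (π ⁻¹' {p} \ M) := by
  refine Metric.isOpen_iff.2 ?_
  rintro x ⟨rfl, hx⟩
  refine ⟨dist x (π x), dist_pos.2 fun e => hx (e ▸ (h.isGate x).mem), fun y hy => ?_⟩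
  obtain ⟨s, hs, -⟩ := hF x trivial y trivial
  have hdisj : Disjoint s M := Set.disjoint_left.2 fun m hm hmM => by
    linarith [hs.dist_add hm, (h.isGate x).dist_le hmM, Metric.mem_ball'.1 hy,
      dist_nonneg (x := m) (y := y)]
  exact ⟨(h.const x y s hs hdisj).symm, Set.disjoint_left.1 hdisj hs.right_mem⟩

theorem eq_of_isPreconnected (h : IsGateMap M π) (hF : IsGeodesicSubset (Set.univ : Set F))
    {C : Set F} (hC : IsPreconnected C) {w w' : F} (hw : w ∈ C) (hw' : w' ∈ C) (hp : π w ∉ C) :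
    π w' = π w := by
  by_contra hne
  have notMem : ∀ x ∈ C, π x = π w → x ∉ M := fun x hx hx' hM =>
    hp (by rwa [← hx', h.eq_self hM])
  have hcover : C ⊆ (π ⁻¹' {π w} \ M) ∪ π ⁻¹' {π w}ᶜ := fun x hx => by
    by_cases hx' : π x = π w
    · exact Or.inl ⟨hx', notMem x hx hx'⟩
    · exact Or.inr hx'
  obtain ⟨v, -, hv, hv'⟩ := hC _ _ (h.isOpen_fiber_diff hF (π w))
    (isOpen_compl_singleton.preimage (h.lipschitzWith hF).continuous) hcover
    ⟨w, hw, rfl, notMem w hw rfl⟩ ⟨w', hw', hne⟩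
  exact hv' hv.1

theorem eq_of_disjoint (h : IsGateMap M π) (hF : IsGeodesicSubset (Set.univ : Set F))
    {C : Set F} (hC : IsPreconnected C) (hd : Disjoint C M) {w w' : F} (hw : w ∈ C)
    (hw' : w' ∈ C) : π w = π w' :=
  h.eq_of_isPreconnected hF hC hw' hw fun hp => Set.disjoint_left.1 hd hp (h.isGate w').mem

theorem apply_mem_of_isPreconnected (h : IsGateMap M π)
    (hF : IsGeodesicSubset (Set.univ : Set F)) {C : Set F} (hC : IsPreconnected C)
    (hCM : (C ∩ M).Nonempty) {w : F} (hw : w ∈ C) : π w ∈ C := by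
  obtain ⟨m, hm, hmM⟩ := hCM
  by_contra hp
  exact hp (h.eq_of_isPreconnected hF hC hw hm hp ▸ (h.eq_self hmM).symm ▸ hm)

theorem mapsTo_arc (h : IsGateMap M π) (hF : IsGeodesicSubset (Set.univ : Set F)) {α : ℝ → F}
    {a b : ℝ} (hα : ContinuousOn α (Set.Icc a b)) (hinj : Set.InjOn α (Set.Icc a b))
    (ha : α a ∈ M) (hb : α b ∈ M) : Set.MapsTo α (Set.Icc a b) M := by
  intro t ht
  have hat : Set.Icc a t ⊆ Set.Icc a b := Set.Icc_subset_Icc_right ht.2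
  have htb : Set.Icc t b ⊆ Set.Icc a b := Set.Icc_subset_Icc_left ht.1
  obtain ⟨c, hc, hcπ⟩ := h.apply_mem_of_isPreconnected hF
    (isPreconnected_Icc.image α (hα.mono hat)) ⟨_, ⟨a, ⟨le_rfl, ht.1⟩, rfl⟩, ha⟩
    ⟨t, ⟨ht.1, le_rfl⟩, rfl⟩
  obtain ⟨c', hc', hcπ'⟩ := h.apply_mem_of_isPreconnected hF
    (isPreconnected_Icc.image α (hα.mono htb)) ⟨_, ⟨b, ⟨ht.2, le_rfl⟩, rfl⟩, hb⟩
    ⟨t, ⟨le_rfl, ht.2⟩, rfl⟩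
  obtain rfl := hinj (hat hc) (htb hc') (hcπ.trans hcπ'.symm)
  obtain rfl : c = t := le_antisymm hc.2 hc'.1
  exact hcπ ▸ (h.isGate _).mem

theorem apply_ne_of_nontrivial_inter (h : IsGateMap M π) {g : Set F} {a b : F}
    (hg : IsGeodesicSegment g a b) (hgM : (g ∩ M).Nontrivial) : π a ≠ π b := by
  intro hab
  refine hgM.not_subsingleton (Set.subsingleton_of_forall_eq (π a) ?_)
  rintro w ⟨hw, hwM⟩
  have ha := (h.isGate a).dist_eq w hwM
  have hb := (h.isGate b).dist_eq w hwM
  rw [← hab] at hb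
  have hab' := dist_triangle_right a b (π a)
  have hgw := hg.dist_add hw
  rw [dist_comm w b] at hgw
  exact (dist_le_zero.1 (by linarith)).symm

theorem subset_of_no_cutPoint (h : IsGateMap M π) (hF : IsGeodesicSubset (Set.univ : Set F))
    {Y : Set F} (hY : ∀ p, IsPreconnected (Y \ {p})) (hYM : (Y ∩ M).Nontrivial) : Y ⊆ M := by
  intro x hx
  by_contra hxM
  obtain ⟨z, ⟨hzY, hzM⟩, hz⟩ := hYM.exists_ne (π x)
  have hxπ : x ≠ π x := fun e => hxM (e ▸ (h.isGate x).mem)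
  exact (h.apply_mem_of_isPreconnected hF (hY (π x)) ⟨z, ⟨hzY, hz⟩, hzM⟩ ⟨hx, hxπ⟩).2 rfl

theorem not_isPreconnected_diff {g : Set F} (h : IsGateMap g π)
    (hF : IsGeodesicSubset (Set.univ : Set F)) {a b m : F} (hg : IsGeodesicSegment g a b)
    {Y : Set F} (ha : a ∈ Y) (hb : b ∈ Y) (hm : m ∈ g) (hma : m ≠ a) (hmb : m ≠ b) :
    ¬ IsPreconnected (Y \ {m}) := by
  intro hY
  have hc : Continuous fun x => dist a (π x) :=
    continuous_const.dist (h.lipschitzWith hF).continuous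
  have hmb' : dist a m < dist a b := by linarith [hg.dist_add hm, dist_pos.2 hmb]
  have hcover : Y \ {m} ⊆ ((π ⁻¹' {m} \ g) ∪ {x | dist a (π x) < dist a m}) ∪
      {x | dist a m < dist a (π x)} := by
    rintro x ⟨-, hxm⟩
    rcases lt_trichotomy (dist a (π x)) (dist a m) with hlt | heq | hgt
    · exact Or.inl (Or.inr hlt)
    · have hπx : π x = m := hg.eq_of_dist_eq (h.isGate x).mem hm heq
      exact Or.inl (Or.inl ⟨hπx, fun hxg => hxm (h.eq_self hxg ▸ hπx)⟩)
    · exact Or.inr hgt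
  obtain ⟨v, -, hv, hv'⟩ := hY _ _
    ((h.isOpen_fiber_diff hF m).union (isOpen_lt hc continuous_const))
    (isOpen_lt continuous_const hc) hcover
    ⟨a, ⟨ha, hma.symm⟩, Or.inr (by
      simpa [h.eq_self hg.left_mem, dist_comm] using dist_pos.2 hma)⟩
    ⟨b, ⟨hb, hmb.symm⟩, by simpa [h.eq_self hg.right_mem] using hmb'⟩
  rcases hv with ⟨hvm, -⟩ | hv
  · exact hv'.ne (congrArg (dist a) hvm).symm
  · exact lt_irrefl _ (hv.out.trans hv'.out)

end IsGateMap

/-! ### Tree-graded spaces -/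

namespace IsTreeGraded

variable {F : Type*} [MetricSpace F] {P : Set (Set F)}

theorem exists_piece_of_isSimpleTriangle (h : IsTreeGraded F P) {s t u : Set F} {x y z : F}
    (hT : IsSimpleTriangle s t u x y z) : ∃ M ∈ P, s ∪ t ∪ u ⊆ M :=
  h.triangle x y z s t u hT.fst hT.snd hT.trd hT.inter_fst_snd hT.inter_snd_trd hT.inter_trd_fst

theorem exists_mem_piece (h : IsTreeGraded F P) (x : F) : ∃ M ∈ P, x ∈ M := by
  have hx := IsGeodesicSegment.singleton x
  have hT : IsSimpleTriangle {x} {x} {x} x x x :=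
    ⟨hx, hx, hx, Set.inter_self _, Set.inter_self _, Set.inter_self _⟩
  obtain ⟨M, hM, hsub⟩ := h.exists_piece_of_isSimpleTriangle hT
  exact ⟨M, hM, hsub (Or.inr rfl)⟩

theorem absorbsTriangles (h : IsTreeGraded F P) {M : Set F} (hM : M ∈ P) :
    AbsorbsTriangles M := by
  intro x y z s t u hT hnt
  obtain ⟨N, hN, hsub⟩ := h.exists_piece_of_isSimpleTriangle hT
  obtain rfl : N = M := by
    by_contra hne
    exact (hnt.mono (Set.inter_subset_inter_left M hsub)).not_subsingleton
      (h.inter_subsingleton N hN M hM hne)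
  exact hsub

theorem exists_isGateMap (h : IsTreeGraded F P) {M : Set F} (hM : M ∈ P) (hne : M.Nonempty) :
    ∃ π : F → F, IsGateMap M π :=
  (h.absorbsTriangles hM).exists_isGateMap h.geodesic (h.piece_closed M hM)
    (h.piece_geodesic M hM) hne

theorem exists_isGateMap_segment (h : IsTreeGraded F P) {g : Set F} {a b : F}
    (hg : IsGeodesicSegment g a b) (hgP : ∀ M ∈ P, (g ∩ M).Subsingleton) :
    ∃ π : F → F, IsGateMap g π := by
  have hT : AbsorbsTriangles g := by
    intro x y z s t u hT hnt
    obtain ⟨M, hM, hsub⟩ := h.exists_piece_of_isSimpleTriangle hT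
    rw [Set.inter_comm] at hnt
    exact absurd (hgP M hM) (hnt.mono (Set.inter_subset_inter_right g hsub)).not_subsingleton
  exact hT.exists_isGateMap h.geodesic hg.isClosed hg.isGeodesicSubset ⟨a, hg.left_mem⟩

theorem exists_piece_of_no_cutPoint (h : IsTreeGraded F P) {Y : Set F} (hYc : IsPreconnected Y)
    (hY : ∀ p, IsPreconnected (Y \ {p})) (hYn : Y.Nontrivial) : ∃ M ∈ P, Y ⊆ M := by
  obtain ⟨a, ha, b, hb, hab⟩ := hYn
  obtain ⟨g, hg, -⟩ := h.geodesic a trivial b trivial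
  by_cases hgP : ∀ M ∈ P, (g ∩ M).Subsingleton
  · obtain ⟨m, hm, hma, hmb⟩ := hg.exists_mid hab
    obtain ⟨π, hπ⟩ := h.exists_isGateMap_segment hg hgP
    exact absurd (hY m) (hπ.not_isPreconnected_diff h.geodesic hg ha hb hm hma hmb)
  push Not at hgP
  obtain ⟨M, hM, hgM⟩ := hgP
  obtain ⟨π, hπ⟩ := h.exists_isGateMap hM (hgM.nonempty.mono Set.inter_subset_right)
  have hπab := hπ.apply_ne_of_nontrivial_inter hg hgM
  have hπa : π a ∈ Y := by
    by_contra hn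
    exact hπab (hπ.eq_of_isPreconnected h.geodesic hYc ha hb hn).symm
  have hπb : π b ∈ Y := by
    by_contra hn
    exact hπab (hπ.eq_of_isPreconnected h.geodesic hYc hb ha hn)
  exact ⟨M, hM, hπ.subset_of_no_cutPoint h.geodesic hY
    ⟨π a, ⟨hπa, (hπ.isGate a).mem⟩, π b, ⟨hπb, (hπ.isGate b).mem⟩, hπab⟩⟩

variable {F' : Type*} [MetricSpace F'] {Φ : F' → F}

theorem isGeodesicSubset_preimage (h : IsTreeGraded F P)
    (hF' : IsGeodesicSubset (Set.univ : Set F')) (hΦ : Continuous Φ) (hinj : Function.Injective Φ)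
    {M : Set F} (hM : M ∈ P) : IsGeodesicSubset (Φ ⁻¹' M) := by
  intro x hx y hy
  obtain ⟨s, hs, -⟩ := hF' x trivial y trivial
  refine ⟨s, hs, ?_⟩
  obtain ⟨π, hπ⟩ := h.exists_isGateMap hM ⟨_, hx⟩
  obtain ⟨γ, h0, h1, hγ, rfl⟩ := hs.exists_isGeodesicOn
  have harc := hπ.mapsTo_arc h.geodesic (hΦ.comp_continuousOn hγ.continuousOn)
    (hinj.comp_injOn hγ.injOn) (by simpa [h0] using hx) (by simpa [h1] using hy)
  exact Set.image_subset_iff.2 harc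

theorem exists_piece_image_of_isSimpleTriangle (h : IsTreeGraded F P) (hΦ : Continuous Φ)
    (hinj : Function.Injective Φ) (hsurj : Function.Surjective Φ) {s t u : Set F'} {x y z : F'}
    (hT : IsSimpleTriangle s t u x y z) : ∃ M ∈ P, Φ '' (s ∪ t ∪ u) ⊆ M := by
  by_cases hxy : x = y
  · subst hxy
    obtain ⟨M, hM, hx⟩ := h.exists_mem_piece (Φ x)
    exact ⟨M, hM, by simpa [hT.eq_singleton] using hx⟩
  refine h.exists_piece_of_no_cutPoint (hT.isPreconnected.image _ hΦ.continuousOn) ?_ ?_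
  · intro q
    obtain ⟨p, rfl⟩ := hsurj q
    rw [← Set.image_singleton, ← Set.image_sdiff hinj]
    exact (hT.isPreconnected_diff hxy p).image _ hΦ.continuousOn
  · exact Set.Nontrivial.image ⟨x, Or.inl (Or.inl hT.fst.left_mem), y,
      Or.inl (Or.inl hT.fst.right_mem), hxy⟩ hinj

theorem of_isUniformEmbedding {P' : Set (Set F')} (hF' : IsGeodesicSubset (Set.univ : Set F'))
    (hΦ : IsUniformEmbedding Φ) (hsurj : Function.Surjective Φ)
    (h : IsTreeGraded F ((Φ '' ·) '' P')) : IsTreeGraded F' P' := by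
  have hinj := hΦ.injective
  have hcont := hΦ.uniformContinuous.continuous
  have hpre : ∀ M : Set F', Φ ⁻¹' (Φ '' M) = M := fun M => Set.preimage_image_eq M hinj
  have hP : ∀ M ∈ P', Φ '' M ∈ (Φ '' ·) '' P' := fun M hM => Set.mem_image_of_mem _ hM
  refine ⟨?_, hF', fun M hM => ?_, fun M hM => ?_, fun M hM N hN hne => ?_, ?_⟩
  · rw [completeSpace_iff_isComplete_range hΦ.isUniformInducing, hsurj.range_eq]
    exact completeSpace_iff_isComplete_univ.1 h.complete
  · exact hpre M ▸ (h.piece_closed _ (hP M hM)).preimage hcont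
  · exact hpre M ▸ h.isGeodesicSubset_preimage hF' hcont hinj (hP M hM)
  · have hsub := h.inter_subsingleton _ (hP M hM) _ (hP N hN) (hinj.image_injective.ne hne)
    rw [← Set.image_inter hinj] at hsub
    exact Set.subsingleton_of_image hinj _ hsub
  · intro x y z s t u hs ht hu hst htu hus
    obtain ⟨_, ⟨M, hM, rfl⟩, hsub⟩ := h.exists_piece_image_of_isSimpleTriangle hcont hinj hsurj
      ⟨hs, ht, hu, hst, htu, hus⟩
    exact ⟨M, hM, (Set.image_subset_image_iff hinj).1 hsub⟩

end IsTreeGraded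

/-! ### Quasi-isometric embeddings -/

/-- `f` is a quasi-isometric embedding with multiplicative constant `L` and additive
constant `C`. -/
structure IsQIEmbeddingWith {X Y : Type*} [MetricSpace X] [MetricSpace Y] (L C : ℝ)
    (f : X → Y) : Prop where
  one_le : 1 ≤ L
  nonneg : 0 ≤ C
  inv_mul_dist_sub_le : ∀ x x', L⁻¹ * dist x x' - C ≤ dist (f x) (f x')
  dist_map_le : ∀ x x', dist (f x) (f x') ≤ L * dist x x' + C

namespace IsQIEmbeddingWith

variable {X Y Z : Type*} [MetricSpace X] [MetricSpace Y] [MetricSpace Z] {L C L' C' : ℝ}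
  {f : X → Y} {g : Y → Z}

theorem pos (h : IsQIEmbeddingWith L C f) : 0 < L :=
  zero_lt_one.trans_le h.one_le

theorem isQuasiIsometricEmbedding (h : IsQIEmbeddingWith L C f) : IsQuasiIsometricEmbedding f :=
  ⟨L, C, h.one_le, h.nonneg, fun x x' => ⟨h.inv_mul_dist_sub_le x x', h.dist_map_le x x'⟩⟩

theorem of_dist_le_mul (hL : 1 ≤ L) (hC : 0 ≤ C)
    (hup : ∀ x x', dist (f x) (f x') ≤ L * dist x x' + C)
    (hlow : ∀ x x', dist x x' ≤ L * (dist (f x) (f x') + C)) : IsQIEmbeddingWith L C f := by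
  refine ⟨hL, hC, fun x x' => ?_, hup⟩
  rw [sub_le_iff_le_add, inv_mul_le_iff₀ (zero_lt_one.trans_le hL)]
  exact hlow x x'

theorem dist_le_mul (h : IsQIEmbeddingWith L C f) (x x' : X) :
    dist x x' ≤ L * (dist (f x) (f x') + C) := by
  rw [← inv_mul_le_iff₀ h.pos]
  linarith [h.inv_mul_dist_sub_le x x']

theorem dist_map_le_of_le (h : IsQIEmbeddingWith L C f) {x x' : X} {r : ℝ} (hr : dist x x' ≤ r) :
    dist (f x) (f x') ≤ L * r + C :=
  (h.dist_map_le x x').trans (by have := h.pos; gcongr)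

theorem dist_le_of_dist_map_le (h : IsQIEmbeddingWith L C f) {x x' : X} {r : ℝ}
    (hr : dist (f x) (f x') ≤ r) : dist x x' ≤ L * (r + C) :=
  (h.dist_le_mul x x').trans (by have := h.pos; gcongr)

theorem mono (h : IsQIEmbeddingWith L C f) (hL : L ≤ L') (hC : C ≤ C') :
    IsQIEmbeddingWith L' C' f := by
  have hpos := h.pos
  refine of_dist_le_mul (h.one_le.trans hL) (h.nonneg.trans hC) (fun x x' => ?_) fun x x' => ?_
  · exact (h.dist_map_le x x').trans (by gcongr)
  · exact (h.dist_le_mul x x').trans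
      (mul_le_mul hL (by gcongr) (add_nonneg dist_nonneg h.nonneg) (hpos.le.trans hL))

theorem comp (hg : IsQIEmbeddingWith L' C' g) (hf : IsQIEmbeddingWith L C f) :
    IsQIEmbeddingWith (L' * L) (L' * C + C') (fun x => g (f x)) := by
  have hL := hf.pos
  have hL' := hg.pos
  have hC := hf.nonneg
  have hC' := hg.nonneg
  refine of_dist_le_mul (one_le_mul_of_one_le_of_one_le hg.one_le hf.one_le) (by positivity)
    (fun x x' => ?_) fun x x' => ?_
  · linarith [hg.dist_map_le_of_le (hf.dist_map_le x x')]
  · have hCL : L * C ≤ L' * L * (L' * C) := by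
      calc L * C = 1 * L * (1 * C) := by ring
        _ ≤ L' * L * (L' * C) := by gcongr <;> exact hg.one_le
    linarith [hf.dist_le_of_dist_map_le (hg.dist_le_mul (f x) (f x'))]

theorem of_rightInverse (h : IsQIEmbeddingWith L C f) {g : Y → X} {K : ℝ} (hK : 0 ≤ K)
    (hg : ∀ y, dist (f (g y)) y ≤ K) : IsQIEmbeddingWith L (L * (2 * K + C)) g := by
  have hL := h.pos
  have hC := h.nonneg
  refine of_dist_le_mul h.one_le (by positivity) (fun y y' => ?_) fun y y' => ?_
  · have hd := dist_triangle4 (f (g y)) y y' (f (g y'))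
    rw [dist_comm y'] at hd
    have := h.dist_le_of_dist_map_le (r := dist y y' + 2 * K) (by linarith [hg y, hg y'])
    linarith
  · have hd := dist_triangle4 y (f (g y)) (f (g y')) y'
    rw [dist_comm y (f (g y))] at hd
    have hLL : 2 * K + C ≤ L * (L * (2 * K + C)) := by
      rw [← mul_assoc]
      exact le_mul_of_one_le_left (by positivity) (one_le_mul_of_one_le_of_one_le h.one_le h.one_le)
    linarith [h.dist_map_le (g y) (g y'), hg y, hg y']

theorem quasiIsometric (h : IsQIEmbeddingWith L C f) {K : ℝ} (hK : ∀ y, ∃ x, dist (f x) y ≤ K) :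
    QuasiIsometric X Y := by
  choose g hg using hK
  exact ⟨f, g, h.isQuasiIsometricEmbedding,
    (h.of_rightInverse (abs_nonneg K) fun y => (hg y).trans (le_abs_self K))
      |>.isQuasiIsometricEmbedding,
    ⟨_, fun x => h.dist_le_of_dist_map_le (hg (f x))⟩, K, hg⟩

end IsQIEmbeddingWith

theorem IsQuasiIsometricEmbedding.exists_isQIEmbeddingWith {X Y : Type*} [MetricSpace X]
    [MetricSpace Y] {f : X → Y} (h : IsQuasiIsometricEmbedding f) :
    ∃ L C : ℝ, IsQIEmbeddingWith L C f := by
  obtain ⟨L, C, hL, hC, hf⟩ := h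
  exact ⟨L, C, hL, hC, fun x x' => (hf x x').1, fun x x' => (hf x x').2⟩

/-- The image `f(B)` and the set `A` are at Hausdorff distance at most `K`. -/
structure IsCoarseImage {X Y : Type*} [MetricSpace X] (f : Y → X) (K : ℝ) (B : Set Y)
    (A : Set X) : Prop where
  exists_near_map : ∀ b ∈ B, ∃ a ∈ A, dist (f b) a ≤ K
  exists_map_near : ∀ a ∈ A, ∃ b ∈ B, dist (f b) a ≤ K

theorem IsCoarseImage.mono {X Y : Type*} [MetricSpace X] {f : Y → X} {K K' : ℝ} {B : Set Y}
    {A : Set X} (h : IsCoarseImage f K B A) (hK : K ≤ K') : IsCoarseImage f K' B A where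
  exists_near_map b hb := (h.exists_near_map b hb).imp fun _ ha => ⟨ha.1, ha.2.trans hK⟩
  exists_map_near a ha := (h.exists_map_near a ha).imp fun _ hb => ⟨hb.1, hb.2.trans hK⟩

/-! ### Points of ultralimits -/

namespace ScalingSeq

variable {ω : Ultrafilter ℕ} (d : ScalingSeq ω)

theorem eventually_ge (r : ℝ) : ∀ᶠ n in (ω : Filter ℕ), r ≤ d.val n :=
  d.tendsto_val.eventually_ge_atTop r

theorem eventually_pos : ∀ᶠ n in (ω : Filter ℕ), 0 < d.val n :=
  d.tendsto_val.eventually_gt_atTop 0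

theorem tendsto_div (K : ℝ) : Tendsto (fun n => K / d.val n) (ω : Filter ℕ) (𝓝 0) :=
  d.tendsto_val.const_div_atTop K

end ScalingSeq

namespace UltraPts

variable {X : ℕ → Type*} [∀ n, MetricSpace (X n)] {ω : Ultrafilter ℕ} {d : ScalingSeq ω}
  {e : ∀ n, X n}

/-- The point of the ultraproduct given by a sequence at linearly bounded distance from the base
points; the additive constant `K` is harmless since the scaling constants tend to infinity. -/
def ofBound (x : ∀ n, X n) (r K : ℝ)
    (h : ∀ᶠ n in (ω : Filter ℕ), dist (x n) (e n) ≤ r * d.val n + K) : UltraPts X d e :=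
  ⟨x, r + |K|, by
    filter_upwards [h, d.eventually_ge 1] with n hn h1
    rw [div_le_iff₀ (by linarith), add_mul]
    linarith [le_abs_self K, le_mul_of_one_le_right (abs_nonneg K) h1]⟩

theorem exists_bound (x : UltraPts X d e) :
    ∃ r : ℝ, ∀ᶠ n in (ω : Filter ℕ), dist (x.1 n) (e n) ≤ r * d.val n := by
  obtain ⟨r, hr⟩ := x.2
  refine ⟨r, ?_⟩
  filter_upwards [hr, d.eventually_pos] with n hn hpos
  rwa [div_le_iff₀ hpos] at hn

theorem tendsto_dist_mk (x y : UltraPts X d e) :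
    Tendsto (fun n => dist (x.1 n) (y.1 n) / d.val n) (ω : Filter ℕ)
      (𝓝 (dist (SeparationQuotient.mk x) (SeparationQuotient.mk y))) :=
  tendsto_limDist x y

theorem dist_mk_le {x y : UltraPts X d e} {r K : ℝ}
    (h : ∀ᶠ n in (ω : Filter ℕ), dist (x.1 n) (y.1 n) ≤ r * d.val n + K) :
    dist (SeparationQuotient.mk x) (SeparationQuotient.mk y) ≤ r := by
  have hlim : Tendsto (fun n => r + K / d.val n) (ω : Filter ℕ) (𝓝 r) := by
    simpa using tendsto_const_nhds.add (d.tendsto_div K)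
  refine le_of_tendsto_of_tendsto (tendsto_dist_mk x y) hlim ?_
  filter_upwards [h, d.eventually_pos] with n hn hpos
  rwa [div_le_iff₀ hpos, add_mul, div_mul_cancel₀ _ hpos.ne']

theorem le_dist_mk {x y : UltraPts X d e} {r K : ℝ}
    (h : ∀ᶠ n in (ω : Filter ℕ), r * d.val n - K ≤ dist (x.1 n) (y.1 n)) :
    r ≤ dist (SeparationQuotient.mk x) (SeparationQuotient.mk y) := by
  have hlim : Tendsto (fun n => r - K / d.val n) (ω : Filter ℕ) (𝓝 r) := by
    simpa using tendsto_const_nhds.sub (d.tendsto_div K)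
  refine le_of_tendsto_of_tendsto hlim (tendsto_dist_mk x y) ?_
  filter_upwards [h, d.eventually_pos] with n hn hpos
  rwa [le_div_iff₀ hpos, sub_mul, div_mul_cancel₀ _ hpos.ne']

theorem mk_eq_mk {x y : UltraPts X d e} {K : ℝ}
    (h : ∀ᶠ n in (ω : Filter ℕ), dist (x.1 n) (y.1 n) ≤ K) :
    SeparationQuotient.mk x = SeparationQuotient.mk y :=
  dist_le_zero.1 (dist_mk_le (K := K) (by simpa using h))

theorem eventually_dist_lt {x y : UltraPts X d e} {r : ℝ}
    (h : dist (SeparationQuotient.mk x) (SeparationQuotient.mk y) < r) :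
    ∀ᶠ n in (ω : Filter ℕ), dist (x.1 n) (y.1 n) < r * d.val n := by
  filter_upwards [(tendsto_dist_mk x y).eventually_lt_const h, d.eventually_pos] with n hn hpos
  rwa [div_lt_iff₀ hpos] at hn

end UltraPts

theorem exists_seq_of_eventually_exists {X : ℕ → Type*} {ω : Filter ℕ} {p : ∀ n, X n → Prop}
    (e : ∀ n, X n) (h : ∀ᶠ n in ω, ∃ x, p n x) : ∃ x : ∀ n, X n, ∀ᶠ n in ω, p n (x n) := by
  have hx : ∀ n, ∃ x, (∃ y, p n y) → p n x := fun n => by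
    by_cases hn : ∃ y, p n y
    · exact ⟨hn.choose, fun _ => hn.choose_spec⟩
    · exact ⟨e n, fun hn' => absurd hn' hn⟩
  choose x hx using hx
  exact ⟨x, h.mono hx⟩

/-! ### Limit sets -/

section limSet

variable {X : Type*} [MetricSpace X] {ω : Ultrafilter ℕ} {d : ScalingSeq ω} {e : ℕ → X}
  {A : ℕ → Set X} {x : UltraPts (fun _ => X) d e}

theorem exists_mem_limSet_dist_le {r K : ℝ}
    (h : ∀ᶠ n in (ω : Filter ℕ), ∃ a ∈ A n, dist (x.1 n) a ≤ r * d.val n + K) :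
    ∃ p ∈ limSet d e A, dist (SeparationQuotient.mk x) p ≤ r := by
  obtain ⟨r', hr'⟩ := x.exists_bound
  obtain ⟨a, ha⟩ := exists_seq_of_eventually_exists e h
  have hbound : ∀ᶠ n in (ω : Filter ℕ), dist (a n) (e n) ≤ (r' + r) * d.val n + K := by
    filter_upwards [ha, hr'] with n han hxn
    linarith [han.2, dist_triangle_left (a n) (e n) (x.1 n)]
  exact ⟨_, ⟨UltraPts.ofBound a _ _ hbound, rfl, ha.mono fun n h => h.1⟩,
    UltraPts.dist_mk_le (ha.mono fun n h => h.2)⟩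

theorem mk_mem_limSet {K : ℝ} (h : ∀ᶠ n in (ω : Filter ℕ), ∃ a ∈ A n, dist (x.1 n) a ≤ K) :
    SeparationQuotient.mk x ∈ limSet d e A := by
  obtain ⟨p, hp, hd⟩ := exists_mem_limSet_dist_le (A := A) (x := x) (r := 0) (K := K)
    (by simpa using h)
  rwa [dist_le_zero.1 hd]

theorem eventually_near_of_mem_limSet (h : SeparationQuotient.mk x ∈ limSet d e A) {ε : ℝ}
    (hε : 0 < ε) : ∀ᶠ n in (ω : Filter ℕ), ∃ a ∈ A n, dist (x.1 n) a < ε * d.val n := by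
  obtain ⟨y, hy, hA⟩ := h
  have hlt : dist (SeparationQuotient.mk x) (SeparationQuotient.mk y) < ε := by
    rwa [hy, dist_self]
  filter_upwards [UltraPts.eventually_dist_lt hlt, hA] with n hd hn
  exact ⟨_, hn, hd⟩

theorem limSet_mem_limPieces {𝒜 : Set (Set X)} (hA : ∀ n, A n ∈ 𝒜)
    (hne : (limSet d e A).Nonempty) : limSet d e A ∈ limPieces 𝒜 d e := by
  obtain ⟨_, x, -, hx⟩ := hne
  obtain ⟨C, hC⟩ := x.2
  refine ⟨A, hA, ⟨C, ?_⟩, rfl⟩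
  filter_upwards [hC, hx] with n hxe hxA
  exact ⟨_, hxA, by rwa [dist_comm]⟩

theorem nonempty_of_mem_limPieces {𝒜 : Set (Set X)} {M : Set (AsymptoticCone X d e)}
    (hM : M ∈ limPieces 𝒜 d e) : M.Nonempty := by
  obtain ⟨A, -, ⟨C, hC⟩, rfl⟩ := hM
  obtain ⟨p, hp, -⟩ := exists_mem_limSet_dist_le (A := A) (d := d) (e := e) (r := C) (K := 0)
    (x := UltraPts.ofBound e 0 0 (by simp)) (by
      filter_upwards [hC, d.eventually_pos] with n ⟨a, ha, had⟩ hpos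
      refine ⟨a, ha, ?_⟩
      rw [div_le_iff₀ hpos] at had
      simpa [UltraPts.ofBound] using had)
  exact ⟨p, hp⟩

theorem mem_limPieces_iff {𝒜 : Set (Set X)} {M : Set (AsymptoticCone X d e)} :
    M ∈ limPieces 𝒜 d e ↔ M.Nonempty ∧ ∃ A : ℕ → Set X, (∀ n, A n ∈ 𝒜) ∧ M = limSet d e A := by
  refine ⟨fun hM => ⟨nonempty_of_mem_limPieces hM, ?_⟩, ?_⟩
  · obtain ⟨A, hA, -, hM⟩ := hM
    exact ⟨A, hA, hM⟩
  · rintro ⟨hne, A, hA, rfl⟩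
    exact limSet_mem_limPieces hA hne

end limSet

/-! ### The map of cones induced by a quasi-isometric embedding -/

section coneMap

variable {X Y : Type*} [MetricSpace X] [MetricSpace Y] {ω : Ultrafilter ℕ} {d : ScalingSeq ω}
  {e : ℕ → Y} {L C K : ℝ} {f : Y → X}

/-- The map induced on sequences by a quasi-isometric embedding. -/
def UltraPts.map (hf : IsQIEmbeddingWith L C f) (y : UltraPts (fun _ => Y) d e) :
    UltraPts (fun _ => X) d (fun n => f (e n)) :=
  ⟨fun n => f (y.1 n), by
    obtain ⟨r, hr⟩ := y.exists_bound
    refine (ofBound (d := d) (e := fun n => f (e n)) (fun n => f (y.1 n)) (L * r) C ?_).2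
    filter_upwards [hr] with n hn
    linarith [hf.dist_map_le_of_le hn]⟩

theorem UltraPts.dist_mk_map_le (hf : IsQIEmbeddingWith L C f) (y z : UltraPts (fun _ => Y) d e) :
    dist (SeparationQuotient.mk (y.map hf)) (SeparationQuotient.mk (z.map hf)) ≤
      L * dist (SeparationQuotient.mk y) (SeparationQuotient.mk z) := by
  refine le_of_tendsto_of_tendsto (tendsto_dist_mk _ _)
    (((tendsto_dist_mk y z).const_mul L).add (d.tendsto_div C) |>.trans (by simp)) ?_
  filter_upwards [d.eventually_pos] with n hpos
  rw [← mul_div_assoc, ← add_div]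
  gcongr
  exact hf.dist_map_le _ _

theorem UltraPts.dist_mk_le_mul_map (hf : IsQIEmbeddingWith L C f)
    (y z : UltraPts (fun _ => Y) d e) :
    dist (SeparationQuotient.mk y) (SeparationQuotient.mk z) ≤
      L * dist (SeparationQuotient.mk (y.map hf)) (SeparationQuotient.mk (z.map hf)) := by
  refine le_of_tendsto_of_tendsto (tendsto_dist_mk y z)
    (((tendsto_dist_mk (y.map hf) (z.map hf)).const_mul L).add
      (d.tendsto_div (L * C)) |>.trans (by simp)) ?_
  filter_upwards [d.eventually_pos] with n hpos
  rw [← mul_div_assoc, ← add_div, ← mul_add]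
  gcongr
  exact hf.dist_le_mul _ _

/-- The map of asymptotic cones induced by a quasi-isometric embedding. -/
noncomputable def coneMap (hf : IsQIEmbeddingWith L C f) (d : ScalingSeq ω) (e : ℕ → Y) :
    AsymptoticCone Y d e → AsymptoticCone X d (fun n => f (e n)) :=
  SeparationQuotient.lift (fun y => SeparationQuotient.mk (y.map hf)) fun y z hyz => by
    have hle := UltraPts.dist_mk_map_le hf y z
    rw [SeparationQuotient.mk_eq_mk.2 hyz, dist_self, mul_zero] at hle
    exact dist_le_zero.1 hle

theorem isUniformEmbedding_coneMap (hf : IsQIEmbeddingWith L C f) (d : ScalingSeq ω)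
    (e : ℕ → Y) : IsUniformEmbedding (coneMap hf d e) := by
  have hlip : LipschitzWith L.toNNReal (coneMap hf d e) := by
    refine LipschitzWith.of_dist_le_mul fun p q => ?_
    obtain ⟨y, rfl⟩ := SeparationQuotient.surjective_mk p
    obtain ⟨z, rfl⟩ := SeparationQuotient.surjective_mk q
    rw [Real.coe_toNNReal _ hf.pos.le]
    exact UltraPts.dist_mk_map_le hf y z
  have hanti : AntilipschitzWith L.toNNReal (coneMap hf d e) := by
    refine AntilipschitzWith.of_le_mul_dist fun p q => ?_
    obtain ⟨y, rfl⟩ := SeparationQuotient.surjective_mk p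
    obtain ⟨z, rfl⟩ := SeparationQuotient.surjective_mk q
    rw [Real.coe_toNNReal _ hf.pos.le]
    exact UltraPts.dist_mk_le_mul_map hf y z
  exact hanti.isUniformEmbedding hlip.uniformContinuous

theorem exists_mk_map_eq (hf : IsQIEmbeddingWith L C f)
    (x : UltraPts (fun _ => X) d (fun n => f (e n))) (y : ℕ → Y)
    (hy : ∀ᶠ n in (ω : Filter ℕ), dist (f (y n)) (x.1 n) ≤ K) :
    ∃ z : UltraPts (fun _ => Y) d e, z.1 = y ∧
      SeparationQuotient.mk (z.map hf) = SeparationQuotient.mk x := by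
  obtain ⟨r, hr⟩ := x.exists_bound
  refine ⟨UltraPts.ofBound y (L * r) (L * (K + C)) ?_, rfl, UltraPts.mk_eq_mk (K := K) hy⟩
  filter_upwards [hy, hr] with n hyn hrn
  have hd : dist (f (y n)) (f (e n)) ≤ K + r * d.val n :=
    (dist_triangle _ (x.1 n) _).trans (add_le_add hyn hrn)
  linarith [hf.dist_le_of_dist_map_le hd]

theorem surjective_coneMap (hf : IsQIEmbeddingWith L C f) (hK : ∀ x, ∃ y, dist (f y) x ≤ K)
    (d : ScalingSeq ω) (e : ℕ → Y) : Function.Surjective (coneMap hf d e) := by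
  intro p
  obtain ⟨x, rfl⟩ := SeparationQuotient.surjective_mk p
  choose g hg using hK
  obtain ⟨z, -, hz⟩ := exists_mk_map_eq hf x (fun n => g (x.1 n)) (.of_forall fun n => hg (x.1 n))
  exact ⟨SeparationQuotient.mk z, hz⟩

theorem image_coneMap_limSet (hf : IsQIEmbeddingWith L C f) {A : ℕ → Set X} {B : ℕ → Set Y}
    (h : ∀ᶠ n in (ω : Filter ℕ), IsCoarseImage f K (B n) (A n)) :
    coneMap hf d e '' limSet d e B = limSet d (fun n => f (e n)) A := by
  refine Set.Subset.antisymm ?_ ?_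
  · rintro _ ⟨_, ⟨y, rfl, hy⟩, rfl⟩
    refine mk_mem_limSet (K := K) ?_
    filter_upwards [h, hy] with n hn hyn
    exact hn.exists_near_map _ hyn
  · rintro _ ⟨x, rfl, hx⟩
    obtain ⟨b, hb⟩ := exists_seq_of_eventually_exists (p := fun n b => b ∈ B n ∧ _) e <|
      (h.and hx).mono fun n hn => hn.1.exists_map_near _ hn.2
    obtain ⟨z, rfl, hz⟩ := exists_mk_map_eq hf x b (hb.mono fun n h => h.2)
    exact ⟨SeparationQuotient.mk z, ⟨z, rfl, hb.mono fun n h => h.1⟩, hz⟩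

end coneMap

theorem IsAsymptoticallyTreeGraded.of_isQIEmbeddingWith {X Y : Type*} [MetricSpace X]
    [MetricSpace Y] {𝒜 : Set (Set X)} (h : IsAsymptoticallyTreeGraded 𝒜) {L C K : ℝ} {f : Y → X}
    (hf : IsQIEmbeddingWith L C f) (hK : ∀ x, ∃ y, dist (f y) x ≤ K)
    (hgeo : ∀ (ω : Ultrafilter ℕ) (d : ScalingSeq ω) (e : ℕ → Y),
      IsGeodesicSubset (Set.univ : Set (AsymptoticCone Y d e)))
    {β : Set X → Set Y} (hβ : ∀ A ∈ 𝒜, IsCoarseImage f K (β A) A) :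
    IsAsymptoticallyTreeGraded (β '' 𝒜) := by
  intro ω d e
  obtain ⟨htg, hdisj⟩ := h ω d (fun n => f (e n))
  have hΦ := isUniformEmbedding_coneMap hf d e
  have himg : ∀ A : ℕ → Set X, (∀ n, A n ∈ 𝒜) →
      coneMap hf d e '' limSet d e (fun n => β (A n)) = limSet d (fun n => f (e n)) A :=
    fun A hA => image_coneMap_limSet hf (.of_forall fun n => hβ _ (hA n))
  have hpieces : (coneMap hf d e '' ·) '' limPieces (β '' 𝒜) d e =
      limPieces 𝒜 d (fun n => f (e n)) := by
    ext M
    simp only [Set.mem_image, mem_limPieces_iff]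
    constructor
    · rintro ⟨_, ⟨hne, B, hB, rfl⟩, rfl⟩
      choose A hA hAB using hB
      obtain rfl : (fun n => β (A n)) = B := funext hAB
      exact ⟨hne.image _, A, hA, himg A hA⟩
    · rintro ⟨hne, A, hA, rfl⟩
      rw [← himg A hA] at hne ⊢
      exact ⟨_, ⟨hne.of_image, _, fun n => ⟨A n, hA n, rfl⟩, rfl⟩, rfl⟩
  refine ⟨IsTreeGraded.of_isUniformEmbedding (hgeo ω d e) hΦ (surjective_coneMap hf hK d e)
    (hpieces ▸ htg), fun B B' hB hB' hne => ?_⟩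
  choose A hA hAB using hB
  choose A' hA' hAB' using hB'
  obtain rfl : (fun n => β (A n)) = B := funext hAB
  obtain rfl : (fun n => β (A' n)) = B' := funext hAB'
  refine Set.subsingleton_of_image hΦ.injective _ ?_
  rw [Set.image_inter hΦ.injective, himg A hA, himg A' hA']
  exact hdisj A A' hA hA' (hne.mono fun n hn heq => hn (congrArg β heq))

/-! ### Word metrics -/

theorem dist_le_mul_of_dist_succ_le {Y : Type*} [MetricSpace Y] {γ : ℕ → Y} {N i j : ℕ} {K : ℝ}
    (hstep : ∀ k < N, dist (γ k) (γ (k + 1)) ≤ K) (hij : i ≤ j) (hj : j ≤ N) :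
    dist (γ i) (γ j) ≤ K * (j - i) := by
  have hsum := dist_le_Ico_sum_of_dist_le hij (d := fun _ => K)
    fun {k} _ hk => hstep k (hk.trans_le hj)
  rw [Finset.sum_const, Nat.card_Ico, nsmul_eq_mul, Nat.cast_sub hij] at hsum
  linarith

theorem dist_eq_abs_sub_of_dist_succ_le_one {Y : Type*} [MetricSpace Y] {γ : ℕ → Y} {N : ℕ}
    (hstep : ∀ k < N, dist (γ k) (γ (k + 1)) ≤ 1) (hN : N ≤ dist (γ 0) (γ N)) :
    ∀ i ≤ N, ∀ j ≤ N, dist (γ i) (γ j) = |(i : ℝ) - j| := by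
  have key : ∀ i j, i ≤ j → j ≤ N → dist (γ i) (γ j) = (j : ℝ) - i := by
    intro i j hij hj
    have h₀ := dist_le_mul_of_dist_succ_le hstep (Nat.zero_le i) (hij.trans hj)
    have h₁ := dist_le_mul_of_dist_succ_le hstep hij hj
    have h₂ := dist_le_mul_of_dist_succ_le hstep hj le_rfl
    push_cast at h₀
    linarith [dist_triangle4 (γ 0) (γ i) (γ j) (γ N)]
  intro i hi j hj
  rcases le_total i j with hij | hji
  · rw [key i j hij hj, abs_sub_comm, abs_of_nonneg (sub_nonneg.2 (Nat.cast_le.2 hij))]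
  · rw [dist_comm, key j i hji hi, abs_of_nonneg (sub_nonneg.2 (Nat.cast_le.2 hji))]

/-- The word metric of `S` as a function on the group itself rather than on the type synonym
`CayleyVertices S`. -/
noncomputable def wordDist {G : Type*} [Group G] (S : FinGenSet G) (a b : G) : ℝ :=
  dist (α := CayleyVertices S) a b

section wordDist

open scoped Pointwise

variable {G : Type*} [Group G] (S : FinGenSet G)

theorem wordDist_eq (a b : G) : wordDist S a b = ((CayleyVertices.graph S).dist a b : ℝ) := rfl

theorem wordDist_self (a : G) : wordDist S a a = 0 := dist_self (α := CayleyVertices S) a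

theorem wordDist_nonneg (a b : G) : 0 ≤ wordDist S a b := dist_nonneg (α := CayleyVertices S)

theorem wordDist_comm (a b : G) : wordDist S a b = wordDist S b a :=
  dist_comm (α := CayleyVertices S) a b

theorem wordDist_triangle (a b c : G) : wordDist S a c ≤ wordDist S a b + wordDist S b c :=
  dist_triangle (α := CayleyVertices S) a b c

theorem CayleyVertices.adj_mul_left_iff (g a b : G) :
    (graph S).Adj (g * a) (g * b) ↔ (graph S).Adj a b := by
  simp only [graph, SimpleGraph.mulCayley_adj', ne_eq, mul_right_inj, mul_assoc]

theorem wordDist_mul_left_le (g a b : G) : wordDist S (g * a) (g * b) ≤ wordDist S a b := by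
  obtain ⟨p, hp⟩ := (CayleyVertices.graph_connected S).exists_walk_length_eq_dist a b
  let φ : CayleyVertices.graph S →g CayleyVertices.graph S :=
    ⟨fun x => g * x, fun h => (CayleyVertices.adj_mul_left_iff S g _ _).2 h⟩
  rw [wordDist_eq, wordDist_eq, ← hp, ← SimpleGraph.Walk.length_map φ p]
  exact Nat.cast_le.2 (SimpleGraph.dist_le _)

theorem wordDist_mul_left (g a b : G) : wordDist S (g * a) (g * b) = wordDist S a b := by
  refine le_antisymm (wordDist_mul_left_le S g a b) ?_
  simpa using wordDist_mul_left_le S g⁻¹ (g * a) (g * b)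

theorem wordDist_inv_mul (a b : G) : wordDist S 1 (a⁻¹ * b) = wordDist S a b := by
  rw [← wordDist_mul_left S a, mul_one, mul_inv_cancel_left]

theorem wordDist_self_mul (a b : G) : wordDist S a (a * b) = wordDist S 1 b := by
  rw [← wordDist_inv_mul, inv_mul_cancel_left]

theorem wordDist_eq_one_of_adj {a b : G} (h : (CayleyVertices.graph S).Adj a b) :
    wordDist S a b = 1 := by
  rw [wordDist_eq, SimpleGraph.dist_eq_one_iff_adj.2 h, Nat.cast_one]

theorem wordDist_gen_le {s : G} (hs : s ∈ S.gens) : wordDist S 1 s ≤ 1 := by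
  by_cases h : (1 : G) = s
  · rw [← h, wordDist_self]
    exact zero_le_one
  · refine (wordDist_eq_one_of_adj S ?_).le
    rw [CayleyVertices.graph, SimpleGraph.mulCayley_adj']
    exact ⟨h, s, hs, Or.inl (one_mul s)⟩

theorem exists_word_geodesic (a b : G) : ∃ (N : ℕ) (γ : ℕ → G), (N : ℝ) = wordDist S a b ∧
    γ 0 = a ∧ γ N = b ∧ (∀ i < N, (CayleyVertices.graph S).Adj (γ i) (γ (i + 1))) ∧
    ∀ i ≤ N, ∀ j ≤ N, wordDist S (γ i) (γ j) = |(i : ℝ) - j| := by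
  obtain ⟨p, hp⟩ := (CayleyVertices.graph_connected S).exists_walk_length_eq_dist a b
  have hadj : ∀ i < p.length, (CayleyVertices.graph S).Adj (p.getVert i) (p.getVert (i + 1)) :=
    fun i hi => p.adj_getVert_succ hi
  have hlen : (p.length : ℝ) = wordDist S a b := by rw [wordDist_eq, hp]
  refine ⟨p.length, p.getVert, hlen, p.getVert_zero, p.getVert_length, hadj,
    dist_eq_abs_sub_of_dist_succ_le_one (Y := CayleyVertices S)
      (fun k hk => (wordDist_eq_one_of_adj S (hadj k hk)).le) ?_⟩
  rw [p.getVert_zero, p.getVert_length]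
  exact hlen.le

theorem dist_le_mul_wordDist {Y : Type*} [MetricSpace Y] (q : G → Y) {K : ℝ}
    (hq : ∀ a, ∀ s ∈ S.gens, dist (q a) (q (a * s)) ≤ K) (a b : G) :
    dist (q a) (q b) ≤ K * wordDist S a b := by
  obtain ⟨N, γ, hN, rfl, rfl, hadj, -⟩ := exists_word_geodesic S a b
  have hstep : ∀ k < N, dist (q (γ k)) (q (γ (k + 1))) ≤ K := fun k hk => by
    have hk' := hadj k hk
    rw [CayleyVertices.graph, SimpleGraph.mulCayley_adj'] at hk'
    obtain ⟨-, s, hs, h | h⟩ := hk'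
    · rw [← h]
      exact hq _ s hs
    · rw [h, dist_comm]
      exact hq _ s hs
  have hle := dist_le_mul_of_dist_succ_le (γ := fun k => q (γ k)) hstep (Nat.zero_le N) le_rfl
  rwa [Nat.cast_zero, sub_zero, hN] at hle

theorem CayleyVertices.inv_mul_mem_pow_length {a b : G} (p : (graph S).Walk a b) :
    a⁻¹ * b ∈ ((S.gens : Set G) ∪ (S.gens : Set G)⁻¹) ^ p.length := by
  induction p with
  | nil => simp
  | @cons a b c hab p ih =>
    have hgen : a⁻¹ * b ∈ (S.gens : Set G) ∪ (S.gens : Set G)⁻¹ := by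
      rw [graph, SimpleGraph.mulCayley_adj'] at hab
      obtain ⟨-, s, hs, rfl | rfl⟩ := hab
      · exact Or.inl (by simpa using hs)
      · exact Or.inr (by simpa using hs)
    rw [SimpleGraph.Walk.length_cons, pow_succ']
    simpa only [mul_assoc, mul_inv_cancel_left] using Set.mul_mem_mul hgen ih

theorem finite_wordDist_le (R : ℝ) : {g : G | wordDist S 1 g ≤ R}.Finite := by
  have hfin : ∀ n : ℕ, (((S.gens : Set G) ∪ (S.gens : Set G)⁻¹) ^ n).Finite := fun n => by
    induction n with
    | zero => simp
    | succ n ih =>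
      rw [pow_succ]
      exact ih.mul (S.gens.finite_toSet.union S.gens.finite_toSet.inv)
  refine ((Set.finite_le_nat ⌊R⌋₊).biUnion fun n _ => hfin n).subset fun g hg => ?_
  obtain ⟨p, hp⟩ := (CayleyVertices.graph_connected S).exists_walk_length_eq_dist 1 g
  have hmem := CayleyVertices.inv_mul_mem_pow_length S p
  rw [inv_one, one_mul] at hmem
  have hlen : (p.length : ℝ) ≤ R := by
    rw [hp]
    exact hg
  exact Set.mem_biUnion (x := p.length) (Nat.le_floor hlen) hmem

theorem exists_wordDist_le_mul (T : FinGenSet G) :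
    ∃ L : ℝ, 1 ≤ L ∧ ∀ a b : G, wordDist S a b ≤ L * wordDist T a b := by
  obtain ⟨L, hL⟩ := (T.gens.finite_toSet.image (wordDist S 1)).bddAbove
  refine ⟨max L 1, le_max_right _ _, fun a b => ?_⟩
  refine dist_le_mul_wordDist (Y := CayleyVertices S) T (fun a => a) (fun a s hs => ?_) a b
  have hs' : wordDist S a (a * s) = wordDist S 1 s := wordDist_self_mul S a s
  exact hs'.trans_le ((hL ⟨s, hs, rfl⟩).trans (le_max_left _ _))

end wordDist

/-! ### Limits of quasi-geodesics -/

theorem tendsto_floor_mul_div {ω : Ultrafilter ℕ} (d : ScalingSeq ω) (u : ℝ) :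
    Tendsto (fun n => (⌊u * d.val n⌋ : ℝ) / d.val n) (ω : Filter ℕ) (𝓝 u) := by
  have hlow : Tendsto (fun n => u - 1 / d.val n) (ω : Filter ℕ) (𝓝 u) := by
    simpa using tendsto_const_nhds.sub (d.tendsto_div 1)
  refine tendsto_of_tendsto_of_tendsto_of_le_of_le' hlow tendsto_const_nhds ?_ ?_
  · filter_upwards [d.eventually_pos] with n hpos
    rw [le_div_iff₀ hpos, sub_mul, div_mul_cancel₀ _ hpos.ne']
    exact (Int.sub_one_lt_floor _).le
  · filter_upwards [d.eventually_pos] with n hpos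
    rw [div_le_iff₀ hpos]
    exact Int.floor_le _

theorem exists_tendsto_div_of_mem_Icc {ω : Ultrafilter ℕ} (d : ScalingSeq ω) {a b : ℕ → ℤ}
    {s t u : ℝ} (hab : ∀ n, a n ≤ b n)
    (ha : Tendsto (fun n => (a n : ℝ) / d.val n) (ω : Filter ℕ) (𝓝 s))
    (hb : Tendsto (fun n => (b n : ℝ) / d.val n) (ω : Filter ℕ) (𝓝 t)) (hu : u ∈ Set.Icc s t) :
    ∃ i : ℕ → ℤ, (∀ n, i n ∈ Set.Icc (a n) (b n)) ∧
      Tendsto (fun n => (i n : ℝ) / d.val n) (ω : Filter ℕ) (𝓝 u) := by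
  refine ⟨fun n => max (a n) (min ⌊u * d.val n⌋ (b n)), fun n =>
    ⟨le_max_left _ _, max_le (hab n) (min_le_right _ _)⟩, ?_⟩
  have hlim := ha.max ((tendsto_floor_mul_div d u).min hb)
  rw [min_eq_left hu.2, max_eq_right hu.1] at hlim
  refine hlim.congr' ?_
  filter_upwards [d.eventually_pos] with n hpos
  rw [Int.cast_max, Int.cast_min, min_div_div_right hpos.le, max_div_div_right hpos.le]

/-- `γ` is an `(L, C)`-quasi-geodesic on the integer interval `[a, b]`. -/
def IsQuasiGeodesicOn {X : Type*} [MetricSpace X] (L C : ℝ) (γ : ℤ → X) (a b : ℤ) : Prop :=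
  ∀ i ∈ Set.Icc a b, ∀ j ∈ Set.Icc a b, L⁻¹ * |(i : ℝ) - j| - C ≤ dist (γ i) (γ j) ∧
    dist (γ i) (γ j) ≤ L * |(i : ℝ) - j| + C

theorem isQuasiGeodesicOn_one_zero {X : Type*} [MetricSpace X] {γ : ℤ → X} {a b : ℤ} :
    IsQuasiGeodesicOn 1 0 γ a b ↔ ∀ i ∈ Set.Icc a b, ∀ j ∈ Set.Icc a b,
      dist (γ i) (γ j) = |(i : ℝ) - j| := by
  simp only [IsQuasiGeodesicOn, inv_one, one_mul, sub_zero, add_zero, le_antisymm_iff,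
    and_comm (a := _ ≤ |_|)]

theorem IsQuasiGeodesicOn.mono {X : Type*} [MetricSpace X] {L C : ℝ} {γ : ℤ → X} {a b a' b' : ℤ}
    (h : IsQuasiGeodesicOn L C γ a b) (ha : a ≤ a') (hb : b' ≤ b) :
    IsQuasiGeodesicOn L C γ a' b' := fun i hi j hj =>
  h i (Set.Icc_subset_Icc ha hb hi) j (Set.Icc_subset_Icc ha hb hj)

theorem IsQuasiGeodesicOn.comp_add {X : Type*} [MetricSpace X] {L C : ℝ} {γ : ℤ → X} {a b : ℤ}
    (h : IsQuasiGeodesicOn L C γ a b) (k : ℤ) :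
    IsQuasiGeodesicOn L C (fun i => γ (k + i)) (a - k) (b - k) := by
  rintro i ⟨hai, hib⟩ j ⟨haj, hjb⟩
  have hij := h (k + i) ⟨by omega, by omega⟩ (k + j) ⟨by omega, by omega⟩
  rwa [Int.cast_add, Int.cast_add, add_sub_add_left_eq_sub] at hij

theorem isQuasiGeodesicOn_toNat {X : Type*} [MetricSpace X] {γ : ℕ → X} {N : ℕ}
    (h : ∀ i ≤ N, ∀ j ≤ N, dist (γ i) (γ j) = |(i : ℝ) - j|) :
    IsQuasiGeodesicOn 1 0 (fun i => γ i.toNat) 0 N := by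
  refine isQuasiGeodesicOn_one_zero.2 fun i hi j hj => ?_
  refine (h _ (Int.toNat_le.2 hi.2) _ (Int.toNat_le.2 hj.2)).trans ?_
  rw [← Int.cast_natCast i.toNat, ← Int.cast_natCast j.toNat, Int.toNat_of_nonneg hi.1,
    Int.toNat_of_nonneg hj.1]

theorem CayleyVertices.exists_isQuasiGeodesicOn {G : Type*} [Group G] (S : FinGenSet G)
    (a b : G) : ∃ (N : ℕ) (γ : ℤ → G),
      γ 0 = a ∧ γ N = b ∧ IsQuasiGeodesicOn (X := CayleyVertices S) 1 0 γ 0 N := by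
  obtain ⟨N, γ, -, h0, hN, -, hd⟩ := exists_word_geodesic S a b
  exact ⟨N, fun i => γ i.toNat, h0, hN, isQuasiGeodesicOn_toNat (X := CayleyVertices S) hd⟩

/-- `p` is the point at time `u` of the limit of the paths `γ n : [a n, b n] → X`: it is the class
of a sequence `γ n (i n)` with `i n / d n` tending to `u`. -/
def IsLimitAt {X : Type*} [MetricSpace X] {ω : Ultrafilter ℕ} (d : ScalingSeq ω) (e : ℕ → X)
    (γ : ℕ → ℤ → X) (a b : ℕ → ℤ) (u : ℝ) (p : AsymptoticCone X d e) : Prop :=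
  ∃ (x : UltraPts (fun _ => X) d e) (i : ℕ → ℤ), SeparationQuotient.mk x = p ∧
    (∀ n, i n ∈ Set.Icc (a n) (b n)) ∧
    Tendsto (fun n => (i n : ℝ) / d.val n) (ω : Filter ℕ) (𝓝 u) ∧ ∀ n, x.1 n = γ n (i n)

section IsLimitAt

variable {X : Type*} [MetricSpace X] {ω : Ultrafilter ℕ} {d : ScalingSeq ω} {e : ℕ → X}
  {L C : ℝ} {γ : ℕ → ℤ → X} {a b : ℕ → ℤ} {s t u v : ℝ} {p q : AsymptoticCone X d e}

theorem IsLimitAt.dist_mem_Icc (hγ : ∀ n, IsQuasiGeodesicOn L C (γ n) (a n) (b n))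
    (hp : IsLimitAt d e γ a b u p) (hq : IsLimitAt d e γ a b v q) :
    dist p q ∈ Set.Icc (L⁻¹ * |u - v|) (L * |u - v|) := by
  obtain ⟨x, i, rfl, hi, hiu, hx⟩ := hp
  obtain ⟨y, j, rfl, hj, hjv, hy⟩ := hq
  have hxy : ∀ᶠ n in (ω : Filter ℕ), |(i n : ℝ) / d.val n - j n / d.val n| =
      |(i n : ℝ) - j n| / d.val n := by
    filter_upwards [d.eventually_pos] with n hpos
    rw [← sub_div, abs_div, abs_of_pos hpos]
  have hlim := (hiu.sub hjv).abs.congr' hxy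
  have hlow : Tendsto (fun n => L⁻¹ * (|(i n : ℝ) - j n| / d.val n) - C / d.val n)
      (ω : Filter ℕ) (𝓝 (L⁻¹ * |u - v|)) := by
    simpa using (hlim.const_mul L⁻¹).sub (d.tendsto_div C)
  have hup : Tendsto (fun n => L * (|(i n : ℝ) - j n| / d.val n) + C / d.val n)
      (ω : Filter ℕ) (𝓝 (L * |u - v|)) := by
    simpa using (hlim.const_mul L).add (d.tendsto_div C)
  constructor
  · refine le_of_tendsto_of_tendsto hlow (UltraPts.tendsto_dist_mk x y) ?_
    filter_upwards [d.eventually_pos] with n hpos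
    rw [← mul_div_assoc, ← sub_div, hx, hy]
    gcongr
    exact (hγ n _ (hi n) _ (hj n)).1
  · refine le_of_tendsto_of_tendsto (UltraPts.tendsto_dist_mk x y) hup ?_
    filter_upwards [d.eventually_pos] with n hpos
    rw [← mul_div_assoc, ← add_div, hx, hy]
    gcongr
    exact (hγ n _ (hi n) _ (hj n)).2

theorem IsLimitAt.eq (hγ : ∀ n, IsQuasiGeodesicOn L C (γ n) (a n) (b n))
    (hp : IsLimitAt d e γ a b u p) (hq : IsLimitAt d e γ a b u q) : p = q := by
  refine dist_le_zero.1 ?_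
  simpa using (hp.dist_mem_Icc hγ hq).2

theorem exists_isLimitAt_mk (hL : 0 ≤ L) (hγ : ∀ n, IsQuasiGeodesicOn L C (γ n) (a n) (b n))
    (hp : IsLimitAt d e γ a b u p) {i : ℕ → ℤ} (hi : ∀ n, i n ∈ Set.Icc (a n) (b n))
    (hiv : Tendsto (fun n => (i n : ℝ) / d.val n) (ω : Filter ℕ) (𝓝 v)) :
    ∃ x : UltraPts (fun _ => X) d e, (∀ n, x.1 n = γ n (i n)) ∧
      IsLimitAt d e γ a b v (SeparationQuotient.mk x) := by
  obtain ⟨y, j, -, hj, hju, hy⟩ := hp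
  obtain ⟨r, hr⟩ := y.exists_bound
  suffices hbound : ∀ᶠ n in (ω : Filter ℕ),
      dist (γ n (i n)) (e n) ≤ (L * (|v - u| + 1) + r) * d.val n + C from
    ⟨UltraPts.ofBound _ _ _ hbound, fun _ => rfl, _, i, rfl, hi, hiv, fun _ => rfl⟩
  filter_upwards [hr, (hiv.sub hju).abs.eventually_le_const (lt_add_one |v - u|),
    d.eventually_pos] with n hyn hij hpos
  rw [← sub_div, abs_div, abs_of_pos hpos, div_le_iff₀ hpos] at hij
  rw [hy] at hyn
  have hd := (hγ n _ (hi n) _ (hj n)).2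
  linarith [dist_triangle (γ n (i n)) (γ n (j n)) (e n), mul_le_mul_of_nonneg_left hij hL]

theorem exists_limit_path (hL : 0 ≤ L) (hγ : ∀ n, IsQuasiGeodesicOn L C (γ n) (a n) (b n))
    (ha : Tendsto (fun n => (a n : ℝ) / d.val n) (ω : Filter ℕ) (𝓝 s))
    (hb : Tendsto (fun n => (b n : ℝ) / d.val n) (ω : Filter ℕ) (𝓝 t))
    (hp : IsLimitAt d e γ a b v p) :
    ∃ α : ℝ → AsymptoticCone X d e, ∀ u ∈ Set.Icc s t, IsLimitAt d e γ a b u (α u) := by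
  have hab : ∀ n, a n ≤ b n := by
    obtain ⟨-, i, -, hi, -⟩ := hp
    exact fun n => (hi n).1.trans (hi n).2
  have hex : ∀ u, ∃ q, u ∈ Set.Icc s t → IsLimitAt d e γ a b u q := fun u => by
    by_cases hu : u ∈ Set.Icc s t
    · obtain ⟨i, hi, hiu⟩ := exists_tendsto_div_of_mem_Icc d hab ha hb hu
      obtain ⟨x, -, hx⟩ := exists_isLimitAt_mk hL hγ hp hi hiu
      exact ⟨_, fun _ => hx⟩
    · exact ⟨p, fun h => absurd h hu⟩
  exact ⟨fun u => (hex u).choose, fun u => (hex u).choose_spec⟩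

end IsLimitAt

theorem isGeodesicSubset_cone {Y : Type*} [MetricSpace Y]
    (hY : ∀ a b : Y, ∃ (N : ℕ) (γ : ℤ → Y), γ 0 = a ∧ γ N = b ∧ IsQuasiGeodesicOn 1 0 γ 0 N)
    {ω : Ultrafilter ℕ} (d : ScalingSeq ω) (e : ℕ → Y) :
    IsGeodesicSubset (Set.univ : Set (AsymptoticCone Y d e)) := by
  intro p _ q _
  obtain ⟨x, rfl⟩ := SeparationQuotient.surjective_mk p
  obtain ⟨y, rfl⟩ := SeparationQuotient.surjective_mk q
  choose N γ h0 hN hγ using fun n => hY (x.1 n) (y.1 n)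
  have hdist : ∀ n, dist (x.1 n) (y.1 n) = N n := fun n => by
    have hd := hγ n 0 ⟨le_rfl, Int.natCast_nonneg _⟩ (N n) ⟨Int.natCast_nonneg _, le_rfl⟩
    rw [h0, hN] at hd
    simp only [inv_one, one_mul, Int.cast_zero, Int.cast_natCast, zero_sub, abs_neg, Nat.abs_cast,
      sub_zero, add_zero] at hd
    exact le_antisymm hd.2 hd.1
  have hlim := UltraPts.tendsto_dist_mk x y
  simp only [hdist] at hlim
  set D := dist (SeparationQuotient.mk x) (SeparationQuotient.mk y)
  have hx : IsLimitAt d e γ (fun _ => 0) (fun n => N n) 0 (SeparationQuotient.mk x) :=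
    ⟨x, fun _ => 0, rfl, fun n => ⟨le_rfl, Int.natCast_nonneg _⟩, by simp, fun n => (h0 n).symm⟩
  have hy : IsLimitAt d e γ (fun _ => 0) (fun n => N n) D (SeparationQuotient.mk y) :=
    ⟨y, fun n => N n, rfl, fun n => ⟨Int.natCast_nonneg _, le_rfl⟩, by simpa using hlim,
      fun n => (hN n).symm⟩
  obtain ⟨α, hα⟩ := exists_limit_path zero_le_one hγ (s := 0) (t := D) (by simp)
    (by simpa using hlim) hx
  have hD : 0 ≤ D := dist_nonneg
  refine ⟨_, ⟨α, (hα 0 ⟨le_rfl, hD⟩).eq hγ hx, (hα D ⟨hD, le_rfl⟩).eq hγ hy,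
    fun u hu v hv => ?_, rfl⟩, Set.subset_univ _⟩
  simpa [eq_comm] using (hα u hu).dist_mem_Icc hγ (hα v hv)

theorem CayleyVertices.isGeodesicSubset_cone {G : Type*} [Group G] (S : FinGenSet G)
    {ω : Ultrafilter ℕ} (d : ScalingSeq ω) (e : ℕ → CayleyVertices S) :
    IsGeodesicSubset (Set.univ : Set (AsymptoticCone (CayleyVertices S) d e)) :=
  _root_.isGeodesicSubset_cone (Y := CayleyVertices S) (exists_isQuasiGeodesicOn S) d e

/-! ### Quasi-geodesics near a piece -/

namespace IsGateMap

variable {F : Type*} [MetricSpace F] {M : Set F} {π : F → F}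

theorem exists_mem_of_uIcc (h : IsGateMap M π) (hF : IsGeodesicSubset (Set.univ : Set F))
    {α : ℝ → F} {v c r : ℝ} (hα : ContinuousOn α (Set.uIcc v c))
    (hr : ∀ u ∈ Set.uIcc v c, dist (α u) (π (α u)) ≤ r)
    (hv : α v ∈ M ∨ 2 * r < dist (α v) (α c)) : ∃ u ∈ Set.uIcc v c, α u ∈ M := by
  rcases hv with hv | hv
  · exact ⟨v, Set.left_mem_uIcc, hv⟩
  by_contra! hout
  have hπ : π (α v) = π (α c) := h.eq_of_disjoint hF (isPreconnected_uIcc.image α hα)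
    (Set.disjoint_left.2 (Set.forall_mem_image.2 hout)) ⟨v, Set.left_mem_uIcc, rfl⟩
    ⟨c, Set.right_mem_uIcc, rfl⟩
  have hrv := hr v Set.left_mem_uIcc
  rw [hπ] at hrv
  linarith [hr c Set.right_mem_uIcc, dist_triangle_right (α v) (α c) (π (α c))]

theorem arc_mem_of_dist_le (h : IsGateMap M π) (hF : IsGeodesicSubset (Set.univ : Set F))
    {α : ℝ → F} {s t c r : ℝ} (hα : ContinuousOn α (Set.Icc s t))
    (hinj : Set.InjOn α (Set.Icc s t)) (hc : c ∈ Set.Icc s t)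
    (hr : ∀ u ∈ Set.Icc s t, dist (α u) (π (α u)) ≤ r)
    (hs : α s ∈ M ∨ 2 * r < dist (α s) (α c)) (ht : α t ∈ M ∨ 2 * r < dist (α t) (α c)) :
    α c ∈ M := by
  have hst : s ≤ t := hc.1.trans hc.2
  have hsub : ∀ v ∈ Set.Icc s t, Set.uIcc v c ⊆ Set.Icc s t := fun v hv =>
    Set.uIcc_subset_Icc hv hc
  have hside : ∀ v ∈ Set.Icc s t, (α v ∈ M ∨ 2 * r < dist (α v) (α c)) →
      ∃ u ∈ Set.uIcc v c, α u ∈ M := fun v hv =>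
    h.exists_mem_of_uIcc hF (hα.mono (hsub v hv)) fun u hu => hr u (hsub v hv hu)
  obtain ⟨u, hu, huM⟩ := hside s (Set.left_mem_Icc.2 hst) hs
  obtain ⟨v, hv, hvM⟩ := hside t (Set.right_mem_Icc.2 hst) ht
  rw [Set.uIcc_of_le hc.1] at hu
  rw [Set.uIcc_of_ge hc.2] at hv
  have huv : Set.Icc u v ⊆ Set.Icc s t := Set.Icc_subset_Icc hu.1 hv.2
  exact h.mapsTo_arc hF (hα.mono huv) (hinj.mono huv) huM hvM ⟨hu.2, hv.1⟩

end IsGateMap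

section IsLimitAt

variable {X : Type*} [MetricSpace X] {ω : Ultrafilter ℕ} {d : ScalingSeq ω} {e : ℕ → X}
  {L C : ℝ} {γ : ℕ → ℤ → X} {a b : ℕ → ℤ} {s t u : ℝ}

theorem IsLimitAt.mem_limSet_or_le_dist {p q : AsymptoticCone X d e} (hL : 0 ≤ L)
    (hγ : ∀ n, IsQuasiGeodesicOn L C (γ n) (a n) (b n)) (hp : IsLimitAt d e γ a b u p)
    (hq : IsLimitAt d e γ a b 0 q) {i : ℕ → ℤ} (hi : ∀ n, i n ∈ Set.Icc (a n) (b n))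
    (hiu : Tendsto (fun n => (i n : ℝ) / d.val n) (ω : Filter ℕ) (𝓝 u)) {A : ℕ → Set X} {R : ℝ}
    (h : ∀ n, γ n (i n) ∈ A n ∨ R * d.val n ≤ |(i n : ℝ)|) :
    p ∈ limSet d e A ∨ L⁻¹ * R ≤ dist p q := by
  rcases Ultrafilter.eventually_or.1 (Eventually.of_forall h : ∀ᶠ n in (ω : Filter ℕ), _)
    with hA | hR
  · left
    obtain ⟨x, hx, hxu⟩ := exists_isLimitAt_mk hL hγ hp hi hiu
    exact ⟨x, hxu.eq hγ hp, hA.mono fun n hn => by rwa [hx]⟩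
  · right
    have hRu : R ≤ |u| := by
      refine ge_of_tendsto hiu.abs ?_
      filter_upwards [hR, d.eventually_pos] with n hn hpos
      rwa [abs_div, abs_of_pos hpos, le_div_iff₀ hpos]
    have hpq := (hp.dist_mem_Icc hγ hq).1
    rw [sub_zero] at hpq
    exact (mul_le_mul_of_nonneg_left hRu (inv_nonneg.2 hL)).trans hpq

theorem IsLimitAt.exists_mem_limSet_dist_le {p : AsymptoticCone X d e}
    (hp : IsLimitAt d e γ a b u p) {A : ℕ → Set X} {r : ℝ}
    (h : ∀ n, ∀ i ∈ Set.Icc (a n) (b n), ∃ x ∈ A n, dist (γ n i) x ≤ r * d.val n) :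
    ∃ q ∈ limSet d e A, dist p q ≤ r := by
  obtain ⟨x, i, rfl, hi, -, hx⟩ := hp
  refine _root_.exists_mem_limSet_dist_le (K := 0) (Eventually.of_forall fun n => ?_)
  rw [hx, add_zero]
  exact h n _ (hi n)

theorem mem_limSet_of_isQuasiGeodesicOn {𝒜 : Set (Set X)}
    (hT : IsTreeGraded (AsymptoticCone X d e) (limPieces 𝒜 d e)) {A : ℕ → Set X}
    (hA : ∀ n, A n ∈ 𝒜) (hL : 0 < L) (hγ : ∀ n, IsQuasiGeodesicOn L C (γ n) (a n) (b n))
    (ha : Tendsto (fun n => (a n : ℝ) / d.val n) (ω : Filter ℕ) (𝓝 s))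
    (hb : Tendsto (fun n => (b n : ℝ) / d.val n) (ω : Filter ℕ) (𝓝 t))
    (h0 : ∀ n, (0 : ℤ) ∈ Set.Icc (a n) (b n)) {p : AsymptoticCone X d e}
    (hp : IsLimitAt d e γ a b 0 p) {r R : ℝ} (hrR : 2 * r < L⁻¹ * R)
    (hnear : ∀ n, ∀ i ∈ Set.Icc (a n) (b n), ∃ x ∈ A n, dist (γ n i) x ≤ r * d.val n)
    (hleft : ∀ n, γ n (a n) ∈ A n ∨ R * d.val n ≤ |(a n : ℝ)|)
    (hright : ∀ n, γ n (b n) ∈ A n ∨ R * d.val n ≤ |(b n : ℝ)|) : p ∈ limSet d e A := by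
  have hab : ∀ n, a n ≤ b n := fun n => (h0 n).1.trans (h0 n).2
  have h0st : (0 : ℝ) ∈ Set.Icc s t := by
    constructor
    · refine le_of_tendsto ha (d.eventually_pos.mono fun n hn => ?_)
      exact div_nonpos_of_nonpos_of_nonneg (Int.cast_nonpos.2 (h0 n).1) hn.le
    · refine ge_of_tendsto hb (d.eventually_pos.mono fun n hn => ?_)
      exact div_nonneg (Int.cast_nonneg (h0 n).2) hn.le
  have hst : s ≤ t := h0st.1.trans h0st.2
  obtain ⟨α, hα⟩ := exists_limit_path hL.le hγ ha hb hp
  have hαp : α 0 = p := (hα 0 h0st).eq hγ hp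
  have hcont : ContinuousOn α (Set.Icc s t) := by
    refine (LipschitzOnWith.of_dist_le_mul (K := L.toNNReal) fun u hu v hv => ?_).continuousOn
    rw [Real.coe_toNNReal _ hL.le]
    exact ((hα u hu).dist_mem_Icc hγ (hα v hv)).2
  have hinj : Set.InjOn α (Set.Icc s t) := fun u hu v hv huv => by
    have hle := ((hα u hu).dist_mem_Icc hγ (hα v hv)).1
    rw [huv, dist_self] at hle
    exact sub_eq_zero.1 (abs_nonpos_iff.1 (nonpos_of_mul_nonpos_right hle (inv_pos.2 hL)))
  have hαA : ∀ u ∈ Set.Icc s t, ∃ q ∈ limSet d e A, dist (α u) q ≤ r := fun u hu =>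
    (hα u hu).exists_mem_limSet_dist_le hnear
  have hne : (limSet d e A).Nonempty := (hαA 0 h0st).imp fun q hq => hq.1
  obtain ⟨π, hπ⟩ := hT.exists_isGateMap (limSet_mem_limPieces hA hne) hne
  rw [← hαp] at hp ⊢
  refine hπ.arc_mem_of_dist_le (r := r) hT.geodesic hcont hinj h0st (fun u hu => ?_) ?_ ?_
  · obtain ⟨q, hq, hd⟩ := hαA u hu
    exact ((hπ.isGate _).dist_le hq).trans hd
  · exact ((hα s (Set.left_mem_Icc.2 hst)).mem_limSet_or_le_dist hL.le hγ hp
      (fun n => Set.left_mem_Icc.2 (hab n)) ha hleft).imp_right hrR.trans_le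
  · exact ((hα t (Set.right_mem_Icc.2 hst)).mem_limSet_or_le_dist hL.le hγ hp
      (fun n => Set.right_mem_Icc.2 (hab n)) hb hright).imp_right hrR.trans_le

end IsLimitAt

/-- The scaling sequence given by reals `v n ≥ n`, for the standard non-principal ultrafilter. -/
def ScalingSeq.ofGe (v : ℕ → ℝ) (h : ∀ n : ℕ, (n : ℝ) ≤ v n) : ScalingSeq (hyperfilter ℕ) :=
  ⟨v, (tendsto_atTop_mono h tendsto_natCast_atTop_atTop).mono_left Nat.hyperfilter_le_atTop⟩

theorem exists_tendsto_of_mem_Icc (ω : Ultrafilter ℕ) {f : ℕ → ℝ} {a b : ℝ}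
    (h : ∀ n, f n ∈ Set.Icc a b) : ∃ s, Tendsto f (ω : Filter ℕ) (𝓝 s) := by
  obtain ⟨s, -, hs⟩ := isCompact_Icc.ultrafilter_le_nhds' (ω.map f)
    (show f ⁻¹' Set.Icc a b ∈ (ω : Filter ℕ) from Filter.univ_mem' h)
  exact ⟨s, hs⟩

theorem exists_le_abs_le_add_one {R : ℝ} (hR : 0 ≤ R) {b : ℤ} (hb : 0 ≤ b) :
    ∃ b' ∈ Set.Icc 0 b, |(b' : ℝ)| ≤ R + 1 ∧ (b' = b ∨ R ≤ |(b' : ℝ)|) := by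
  rcases le_or_gt ⌈R⌉ b with hle | hlt
  · have hpos : (0 : ℝ) ≤ ⌈R⌉ := hR.trans (Int.le_ceil R)
    refine ⟨⌈R⌉, ⟨Int.ceil_nonneg hR, hle⟩, ?_, Or.inr ?_⟩ <;> rw [abs_of_nonneg hpos]
    · exact (Int.ceil_lt_add_one R).le
    · exact Int.le_ceil R
  · refine ⟨b, ⟨hb, le_rfl⟩, ?_, Or.inl rfl⟩
    rw [abs_of_nonneg (Int.cast_nonneg hb)]
    linarith [Int.lt_ceil.1 hlt]

namespace IsAsymptoticallyTreeGraded

variable {X : Type*} [MetricSpace X] {𝒜 : Set (Set X)} {L : ℝ}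

theorem exists_infDist_le_half_of_abs_le (h : IsAsymptoticallyTreeGraded 𝒜) (hL : 0 < L) (C : ℝ) :
    ∃ D₀ : ℝ, ∀ D ≥ D₀, ∀ A ∈ 𝒜, A.Nonempty → ∀ (a b : ℤ) (γ : ℤ → X),
      (0 : ℤ) ∈ Set.Icc a b → IsQuasiGeodesicOn L C γ a b →
      (∀ i ∈ Set.Icc a b, Metric.infDist (γ i) A ≤ D) →
      |(a : ℝ)| ≤ (3 * L + 1) * D → (γ a ∈ A ∨ 3 * L * D ≤ |(a : ℝ)|) →
      |(b : ℝ)| ≤ (3 * L + 1) * D → (γ b ∈ A ∨ 3 * L * D ≤ |(b : ℝ)|) →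
      Metric.infDist (γ 0) A ≤ D / 2 := by
  by_contra! hcon
  choose D hD A hA hne a b γ h0 hγ hnear ha hleft hb hright hfar using
    fun n : ℕ => hcon (n + 1)
  have hDpos : ∀ n, 0 < D n := fun n => n.cast_add_one_pos.trans_le (hD n)
  let d := ScalingSeq.ofGe D fun n => (le_add_of_nonneg_right zero_le_one).trans (hD n)
  have hlim : ∀ i : ℕ → ℤ, (∀ n, |(i n : ℝ)| ≤ (3 * L + 1) * D n) →
      ∃ s, Tendsto (fun n => (i n : ℝ) / d.val n) (hyperfilter ℕ : Filter ℕ) (𝓝 s) :=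
    fun i hi => exists_tendsto_of_mem_Icc _ fun n => abs_le.1 <| by
      change |(i n : ℝ) / D n| ≤ 3 * L + 1
      rw [abs_div, abs_of_pos (hDpos n), div_le_iff₀ (hDpos n)]
      exact hi n
  obtain ⟨s, hs⟩ := hlim a ha
  obtain ⟨t, ht⟩ := hlim b hb
  let e : ℕ → X := fun n => γ n 0
  let p : UltraPts (fun _ => X) d e := UltraPts.ofBound e 0 0 (by simp)
  have hp : IsLimitAt d e γ a b 0 (SeparationQuotient.mk p) :=
    ⟨p, fun _ => 0, rfl, h0, by simp, fun _ => rfl⟩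
  have hpA : SeparationQuotient.mk p ∈ limSet d e A := by
    refine mem_limSet_of_isQuasiGeodesicOn (r := 5 / 4) (R := 3 * L) (h _ d e).1 hA hL hγ hs ht
      h0 hp ?_ (fun n i hi => ?_) hleft hright
    · rw [mul_comm 3 L, inv_mul_cancel_left₀ hL.ne']
      norm_num
    · obtain ⟨x, hx, hlt⟩ := (Metric.infDist_lt_iff (hne n)).1
        ((hnear n i hi).trans_lt (show D n < 5 / 4 * D n by linarith [hDpos n]))
      exact ⟨x, hx, hlt.le⟩
  obtain ⟨n, x, hx, hlt⟩ := (eventually_near_of_mem_limSet hpA one_half_pos).exists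
  have hhalf : dist (γ n 0) x < 1 / 2 * D n := hlt
  linarith [Metric.infDist_le_dist_of_mem (x := γ n 0) hx, hfar n]

theorem exists_infDist_le_half (h : IsAsymptoticallyTreeGraded 𝒜) (hL : 0 < L) (C : ℝ) :
    ∃ D₀ : ℝ, 0 < D₀ ∧ ∀ D ≥ D₀, ∀ A ∈ 𝒜, A.Nonempty → ∀ (a b : ℤ) (γ : ℤ → X),
      (0 : ℤ) ∈ Set.Icc a b → IsQuasiGeodesicOn L C γ a b →
      (∀ i ∈ Set.Icc a b, Metric.infDist (γ i) A ≤ D) →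
      (γ a ∈ A ∨ 3 * L * D ≤ |(a : ℝ)|) → (γ b ∈ A ∨ 3 * L * D ≤ |(b : ℝ)|) →
      Metric.infDist (γ 0) A ≤ D / 2 := by
  obtain ⟨D₀, hD₀⟩ := h.exists_infDist_le_half_of_abs_le hL C
  refine ⟨max 1 D₀, by positivity, fun D hD A hA hne a b γ h0 hγ hnear hleft hright => ?_⟩
  have hD1 : 1 ≤ D := (le_max_left _ _).trans hD
  have hR : 0 ≤ 3 * L * D := by positivity
  obtain ⟨a', ⟨ha'0, ha'a⟩, ha'R, ha'⟩ := exists_le_abs_le_add_one hR (neg_nonneg.2 h0.1)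
  obtain ⟨b', ⟨hb'0, hb'b⟩, hb'R, hb'⟩ := exists_le_abs_le_add_one hR h0.2
  have haa' : a ≤ -a' := by omega
  refine hD₀ D ((le_max_right _ _).trans hD) A hA hne (-a') b' γ ⟨by omega, hb'0⟩
    (hγ.mono haa' hb'b) (fun i hi => hnear i (Set.Icc_subset_Icc haa' hb'b hi)) ?_ ?_ ?_ ?_
  · rw [Int.cast_neg, abs_neg]
    linarith
  · rcases ha' with rfl | ha'
    · rwa [neg_neg]
    · exact Or.inr (by rwa [Int.cast_neg, abs_neg])
  · linarith
  · rcases hb' with rfl | hb'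
    · exact hright
    · exact Or.inr hb'

end IsAsymptoticallyTreeGraded

/-! ### Unconstricted spaces near a piece -/

theorem IsAsymptoticallyTreeGraded.exists_dist_le_of_near {X : Type*} [MetricSpace X]
    {𝒜 : Set (Set X)} (h : IsAsymptoticallyTreeGraded 𝒜) (δ : ℝ) :
    ∃ R : ℝ, ∀ A ∈ 𝒜, ∀ B ∈ 𝒜, A ≠ B → ∀ x y : X, (∃ a ∈ A, dist x a ≤ δ) →
      (∃ b ∈ B, dist x b ≤ δ) → (∃ a ∈ A, dist y a ≤ δ) → (∃ b ∈ B, dist y b ≤ δ) →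
      dist x y ≤ R := by
  by_contra! hcon
  choose A hA B hB hAB x y hxA hxB hyA hyB hR using fun n : ℕ => hcon n
  let d := ScalingSeq.ofGe (fun n => dist (x n) (y n)) fun n => (hR n).le
  let p : UltraPts (fun _ => X) d x := UltraPts.ofBound x 0 0 (by simp)
  let q : UltraPts (fun _ => X) d x := UltraPts.ofBound y 1 0 (Eventually.of_forall fun n => by
    simp [d, ScalingSeq.ofGe, dist_comm])
  have hp : SeparationQuotient.mk p ∈ limSet d x A ∩ limSet d x B :=
    ⟨mk_mem_limSet (Eventually.of_forall hxA), mk_mem_limSet (Eventually.of_forall hxB)⟩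
  have hq : SeparationQuotient.mk q ∈ limSet d x A ∩ limSet d x B :=
    ⟨mk_mem_limSet (Eventually.of_forall hyA), mk_mem_limSet (Eventually.of_forall hyB)⟩
  have hpq := (h _ d x).2 A B hA hB (Eventually.of_forall hAB) hp hq
  have hone : (1 : ℝ) ≤ dist (SeparationQuotient.mk p) (SeparationQuotient.mk q) :=
    UltraPts.le_dist_mk (K := 0) (Eventually.of_forall fun n => by
      change 1 * dist (x n) (y n) - 0 ≤ dist (x n) (y n)
      linarith)
  rw [hpq, dist_self] at hone
  linarith

theorem HasNoCutPoint.isPreconnected_univ {F : Type*} [TopologicalSpace F] (h : HasNoCutPoint F)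
    {a b c : F} (hab : a ≠ b) (hca : c ≠ a) (hcb : c ≠ b) : IsPreconnected (Set.univ : Set F) := by
  have hunion : (Set.univ : Set F) = {a}ᶜ ∪ {b}ᶜ := by
    rw [← Set.compl_inter, Set.singleton_inter_eq_empty.2 (Set.mem_singleton_iff.not.2 hab),
      Set.compl_empty]
  rw [hunion]
  exact (h.2 a).union c hca hcb (h.2 b)

theorem IsGateMap.eq_of_subsingleton_inter {F : Type*} [MetricSpace F] {M C : Set F} {π : F → F}
    (h : IsGateMap M π) (hF : IsGeodesicSubset (Set.univ : Set F)) (hC : IsPreconnected C)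
    (hCM : (C ∩ M).Subsingleton) {w w' : F} (hw : w ∈ C) (hw' : w' ∈ C) : π w = π w' := by
  rcases (C ∩ M).eq_empty_or_nonempty with hempty | hne
  · exact h.eq_of_disjoint hF hC (Set.disjoint_iff_inter_eq_empty.2 hempty) hw hw'
  · exact hCM ⟨h.apply_mem_of_isPreconnected hF hC hne hw, (h.isGate w).mem⟩
      ⟨h.apply_mem_of_isPreconnected hF hC hne hw', (h.isGate w').mem⟩

namespace IsTreeGraded

variable {F : Type*} [MetricSpace F] {P : Set (Set F)}

theorem exists_range_subset_piece (h : IsTreeGraded F P) {F' : Type*} [TopologicalSpace F']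
    {Φ : F' → F} (hΦ : Continuous Φ) (hinj : Function.Injective Φ) (hcut : HasNoCutPoint F')
    (hpre : IsPreconnected (Set.univ : Set F')) : ∃ M ∈ P, Set.range Φ ⊆ M := by
  have : Nontrivial F' := hcut.1
  rw [← Set.image_univ]
  refine h.exists_piece_of_no_cutPoint (hpre.image _ hΦ.continuousOn) (fun p => ?_)
    (Set.nontrivial_univ.image hinj)
  by_cases hp : p ∈ Φ '' Set.univ
  · obtain ⟨x, -, rfl⟩ := hp
    rw [← Set.image_singleton, ← Set.image_sdiff hinj, ← Set.compl_eq_univ_sdiff]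
    exact (hcut.2 x).image _ hΦ.continuousOn
  · rw [Set.sdiff_singleton_eq_self hp]
    exact hpre.image _ hΦ.continuousOn

theorem dist_le_of_mem_of_near (h : IsTreeGraded F P) {M N : Set F} (hM : M ∈ P) (hN : N ∈ P)
    (hMN : (M ∩ N).Subsingleton) {x y p p' : F} {r : ℝ} (hx : x ∈ N) (hy : y ∈ N) (hp : p ∈ M)
    (hp' : p' ∈ M) (hxp : dist x p ≤ r) (hyp : dist y p' ≤ r) : dist x y ≤ 2 * r := by
  obtain ⟨π, hπ⟩ := h.exists_isGateMap hM ⟨p, hp⟩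
  obtain ⟨s, hs, hsN⟩ := h.piece_geodesic N hN x hx y hy
  have hgate : π x = π y := hπ.eq_of_subsingleton_inter h.geodesic hs.isPreconnected
    (hMN.anti fun z hz => ⟨hz.2, hsN hz.1⟩) hs.left_mem hs.right_mem
  have hxπ : dist x (π x) ≤ r := ((hπ.isGate x).dist_le hp).trans hxp
  have hyπ : dist y (π x) ≤ r := by
    rw [hgate]
    exact ((hπ.isGate y).dist_le hp').trans hyp
  linarith [dist_triangle_right x y (π x)]

end IsTreeGraded

section unconstricted

variable {X B : Type*} [MetricSpace X] [MetricSpace B] {𝒜 : Set (Set X)} {L C r₀ : ℝ} {q : B → X}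
  {ω : Ultrafilter ℕ} {d : ScalingSeq ω}

theorem exists_dist_mk_mem_Icc (hfar : ∀ r ≥ r₀, ∀ b : B, ∃ y, dist b y ∈ Set.Icc r (2 * r))
    {e : ℕ → B} (o : UltraPts (fun _ => B) d e) {r : ℝ} (hr : 0 < r) :
    ∃ y : UltraPts (fun _ => B) d e,
      dist (SeparationQuotient.mk o) (SeparationQuotient.mk y) ∈ Set.Icc r (2 * r) := by
  obtain ⟨r', hr'⟩ := o.exists_bound
  have hev : ∀ᶠ n in (ω : Filter ℕ), ∃ y, dist (o.1 n) y ∈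
      Set.Icc (r * d.val n) (2 * (r * d.val n)) := by
    filter_upwards [d.eventually_ge (r₀ / r)] with n hn
    exact hfar _ ((div_le_iff₀' hr).1 hn) _
  obtain ⟨y, hy⟩ := exists_seq_of_eventually_exists e hev
  have hbound : ∀ᶠ n in (ω : Filter ℕ), dist (y n) (e n) ≤ (2 * r + r') * d.val n + 0 := by
    filter_upwards [hy, hr'] with n hyn hon
    linarith [hyn.2, dist_triangle_left (y n) (e n) (o.1 n)]
  exact ⟨UltraPts.ofBound y _ _ hbound,
    UltraPts.le_dist_mk (K := 0) (hy.mono fun n h => by rw [sub_zero]; exact h.1),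
    UltraPts.dist_mk_le (K := 0) (hy.mono fun n h => by rw [add_zero, mul_assoc]; exact h.2)⟩

theorem isPreconnected_univ_cone (hfar : ∀ r ≥ r₀, ∀ b : B, ∃ y, dist b y ∈ Set.Icc r (2 * r))
    {e : ℕ → B} (hcut : HasNoCutPoint (AsymptoticCone B d e)) :
    IsPreconnected (Set.univ : Set (AsymptoticCone B d e)) := by
  let o : UltraPts (fun _ => B) d e := UltraPts.ofBound e 0 0 (by simp)
  obtain ⟨y, hy⟩ := exists_dist_mk_mem_Icc hfar o one_pos
  obtain ⟨z, hz⟩ := exists_dist_mk_mem_Icc hfar o three_pos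
  refine hcut.isPreconnected_univ (a := SeparationQuotient.mk o) (b := SeparationQuotient.mk y)
    (c := SeparationQuotient.mk z) ?_ ?_ ?_
  · exact dist_pos.1 (one_pos.trans_le hy.1)
  · exact (dist_pos.1 (three_pos.trans_le hz.1)).symm
  · intro hzy
    rw [hzy] at hz
    linarith [hz.1, hy.2]

theorem eventually_closedBall_subset_thickening (hq : IsQIEmbeddingWith L C q) {e : ℕ → B}
    {A : ℕ → Set X} (hA : ∀ y : UltraPts (fun _ => B) d e,
      SeparationQuotient.mk (y.map hq) ∈ limSet d (fun n => q (e n)) A) (c : ℝ) {ε : ℝ}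
    (hε : 0 < ε) : ∀ᶠ n in (ω : Filter ℕ), Metric.closedBall (e n) (c * d.val n) ⊆
      q ⁻¹' Metric.thickening (ε * d.val n) (A n) := by
  by_contra hcon
  rw [← Ultrafilter.eventually_not] at hcon
  obtain ⟨z, hz⟩ := exists_seq_of_eventually_exists e (hcon.mono fun n hn => Set.not_subset.1 hn)
  have hbound : ∀ᶠ n in (ω : Filter ℕ), dist (z n) (e n) ≤ c * d.val n + 0 :=
    hz.mono fun n hn => (Metric.mem_closedBall.1 hn.1).trans_eq (add_zero _).symm
  obtain ⟨n, hnear, hzn⟩ := ((eventually_near_of_mem_limSet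
    (hA (UltraPts.ofBound z c 0 hbound)) hε).and hz).exists
  exact hzn.2 (Metric.mem_thickening_iff.2 hnear)

namespace IsAsymptoticallyTreeGraded

theorem exists_limSet_of_hasNoCutPoint (h : IsAsymptoticallyTreeGraded 𝒜)
    (hq : IsQIEmbeddingWith L C q) (hfar : ∀ r ≥ r₀, ∀ b : B, ∃ y, dist b y ∈ Set.Icc r (2 * r))
    (e : ℕ → B) (hcut : HasNoCutPoint (AsymptoticCone B d e)) :
    ∃ A : ℕ → Set X, (∀ n, A n ∈ 𝒜) ∧ ∀ y : UltraPts (fun _ => B) d e,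
      SeparationQuotient.mk (y.map hq) ∈ limSet d (fun n => q (e n)) A := by
  have hΦ := isUniformEmbedding_coneMap hq d e
  obtain ⟨M, ⟨A, hA, -, rfl⟩, hM⟩ := (h ω d fun n => q (e n)).1.exists_range_subset_piece
    hΦ.uniformContinuous.continuous hΦ.injective hcut (isPreconnected_univ_cone hfar hcut)
  exact ⟨A, hA, fun y => hM ⟨SeparationQuotient.mk y, rfl⟩⟩

theorem dist_mk_le_of_ne (h : IsAsymptoticallyTreeGraded 𝒜) {e : ℕ → X} {A A' : ℕ → Set X}
    (hA : ∀ n, A n ∈ 𝒜) (hA' : ∀ n, A' n ∈ 𝒜) (hne : ∀ᶠ n in (ω : Filter ℕ), A n ≠ A' n)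
    {x y : UltraPts (fun _ => X) d e} (hx : SeparationQuotient.mk x ∈ limSet d e A')
    (hy : SeparationQuotient.mk y ∈ limSet d e A') {ε : ℝ}
    (hxA : ∀ᶠ n in (ω : Filter ℕ), x.1 n ∈ Metric.thickening (ε * d.val n) (A n))
    (hyA : ∀ᶠ n in (ω : Filter ℕ), y.1 n ∈ Metric.thickening (ε * d.val n) (A n)) :
    dist (SeparationQuotient.mk x) (SeparationQuotient.mk y) ≤ 2 * ε := by
  have hnear : ∀ z : UltraPts (fun _ => X) d e,
      (∀ᶠ n in (ω : Filter ℕ), z.1 n ∈ Metric.thickening (ε * d.val n) (A n)) →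
      ∃ p ∈ limSet d e A, dist (SeparationQuotient.mk z) p ≤ ε := fun z hz =>
    exists_mem_limSet_dist_le (K := 0) <| hz.mono fun n hn => by
      obtain ⟨a, ha, hlt⟩ := Metric.mem_thickening_iff.1 hn
      exact ⟨a, ha, hlt.le.trans_eq (add_zero _).symm⟩
  obtain ⟨p, hp, hxp⟩ := hnear x hxA
  obtain ⟨p', hp', hyp'⟩ := hnear y hyA
  obtain ⟨htg, hdisj⟩ := h ω d e
  exact htg.dist_le_of_mem_of_near (limSet_mem_limPieces hA ⟨p, hp⟩)
    (limSet_mem_limPieces hA' ⟨_, hx⟩) (hdisj A A' hA hA' hne) hx hy hp hp' hxp hyp'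

theorem eventually_closedBall_subset_of_mem (h : IsAsymptoticallyTreeGraded 𝒜)
    (hq : IsQIEmbeddingWith L C q) (hfar : ∀ r ≥ r₀, ∀ b : B, ∃ y, dist b y ∈ Set.Icc r (2 * r))
    (hcut : ∀ e, HasNoCutPoint (AsymptoticCone B d e)) {A : ℕ → Set X} (hA : ∀ n, A n ∈ 𝒜)
    (c : ℝ) {ε : ℝ} (hε : 0 < ε) (hεL : L * (2 * ε) < 1) :
    ∀ᶠ n in (ω : Filter ℕ), ∀ x ∈ q ⁻¹' Metric.thickening (ε * d.val n) (A n),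
      ∀ y ∈ q ⁻¹' Metric.thickening (ε * d.val n) (A n),
        dist x y ∈ Set.Icc (d.val n) (2 * d.val n) →
          Metric.closedBall x (c * d.val n) ⊆ q ⁻¹' Metric.thickening (ε * d.val n) (A n) := by
  by_contra hcon
  rw [← Ultrafilter.eventually_not] at hcon
  push Not at hcon
  have : Nonempty B := let ⟨_, x, _⟩ := hcon.exists; ⟨x⟩
  obtain ⟨x, hx⟩ := hcon.choice
  have hxN := hx.mono fun n hn => hn.1
  obtain ⟨y, hy⟩ := (hx.mono fun n hn => hn.2).choice
  obtain ⟨A', hA', hmem⟩ := h.exists_limSet_of_hasNoCutPoint hq hfar x (hcut x)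
  have hne : ∀ᶠ n in (ω : Filter ℕ), A n ≠ A' n := by
    refine (ω.em fun n => A n = A' n).resolve_left fun heq => ?_
    obtain ⟨n, hball, hAn, hn⟩ := ((eventually_closedBall_subset_thickening hq hmem c hε).and
      (heq.and hy)).exists
    rw [← hAn] at hball
    exact hn.2.2 hball
  let x' : UltraPts (fun _ => B) d x := UltraPts.ofBound x 0 0 (by simp)
  let y' : UltraPts (fun _ => B) d x := UltraPts.ofBound y 2 0 <| hy.mono fun n hn => by
    rw [dist_comm, add_zero]
    exact hn.2.1.2
  have hclose := h.dist_mk_le_of_ne hA hA' hne (hmem x') (hmem y') hxN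
    (hy.mono fun n hn => hn.1)
  have hone : 1 ≤ dist (SeparationQuotient.mk x') (SeparationQuotient.mk y') :=
    UltraPts.le_dist_mk (K := 0) <| hy.mono fun n hn => by
      rw [one_mul, sub_zero]
      exact hn.2.1.1
  have hmul := UltraPts.dist_mk_le_mul_map hq x' y'
  have := mul_le_mul_of_nonneg_left hclose hq.pos.le
  linarith

end IsAsymptoticallyTreeGraded

/-- Any two points of `B` are joined by a chain of steps of length at most `1`, the number of which
exceeds the distance of the two points by at most `1`. -/
def IsCoarselyGeodesic (B : Type*) [MetricSpace B] : Prop :=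
  ∀ b b' : B, ∃ (n : ℕ) (u : ℕ → B), u 0 = b ∧ u n = b' ∧
    (∀ i < n, dist (u i) (u (i + 1)) ≤ 1) ∧ (n : ℝ) ≤ dist b b' + 1

theorem IsCoarselyGeodesic.reflTransGen (h : IsCoarselyGeodesic B) (b b' : B) :
    Relation.ReflTransGen (fun x y : B => dist x y ≤ 1) b b' := by
  obtain ⟨n, u, rfl, rfl, hu, -⟩ := h b b'
  have hchain : ∀ i ≤ n, Relation.ReflTransGen (fun x y : B => dist x y ≤ 1) (u 0) (u i) := by
    intro i
    induction i with
    | zero => exact fun _ => .refl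
    | succ i ih => exact fun hi => (ih (by omega)).tail (hu i hi)
  exact hchain n le_rfl

theorem closedBall_subset_of_reflTransGen {N : Set B} {r : ℝ} (hr : 1 ≤ r) {b₀ b : B}
    (h₀ : Metric.closedBall b₀ (3 * r) ⊆ N)
    (hstep : ∀ x ∈ N, ∀ y ∈ N, dist x y ∈ Set.Icc r (2 * r) → Metric.closedBall x (3 * r) ⊆ N)
    (hfar : ∀ b : B, ∃ y, dist b y ∈ Set.Icc r (2 * r))
    (hb : Relation.ReflTransGen (fun x y : B => dist x y ≤ 1) b₀ b) :
    Metric.closedBall b (3 * r) ⊆ N := by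
  induction hb with
  | refl => exact h₀
  | @tail x x' _ hxx' ih =>
    obtain ⟨y, hy⟩ := hfar x'
    refine hstep x' (ih ?_) y (ih ?_) hy
    · rw [Metric.mem_closedBall, dist_comm]
      linarith
    · rw [Metric.mem_closedBall, dist_comm]
      linarith [hy.2, dist_triangle x x' y]

theorem IsAsymptoticallyTreeGraded.exists_near_of_isUnconstricted
    (h : IsAsymptoticallyTreeGraded 𝒜) (hq : IsQIEmbeddingWith L C q) (hB : IsUnconstricted B)
    [Nonempty B] (hgeo : IsCoarselyGeodesic B)
    (hfar : ∀ r ≥ r₀, ∀ b : B, ∃ y, dist b y ∈ Set.Icc r (2 * r)) :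
    ∃ A ∈ 𝒜, ∃ D : ℝ, ∀ b, ∃ a ∈ A, dist (q b) a ≤ D := by
  obtain ⟨ω, d, hcut⟩ := hB
  obtain ⟨b₀⟩ := ‹Nonempty B›
  have hL := hq.pos
  have hε : 0 < 1 / (3 * L) := by positivity
  have hεL : L * (2 * (1 / (3 * L))) < 1 := by
    field_simp
    norm_num
  obtain ⟨A, hA, hmem⟩ := h.exists_limSet_of_hasNoCutPoint hq hfar (fun _ => b₀)
    (hcut fun _ => b₀)
  obtain ⟨n, ⟨hstart, hstep⟩, hn1, hnr⟩ :=
    (((eventually_closedBall_subset_thickening hq hmem 3 hε).and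
      (h.eventually_closedBall_subset_of_mem hq hfar hcut hA 3 hε hεL)).and
        ((d.eventually_ge 1).and (d.eventually_ge r₀))).exists
  refine ⟨A n, hA n, 1 / (3 * L) * d.val n, fun b => ?_⟩
  have hb := closedBall_subset_of_reflTransGen hn1 hstart hstep (hfar _ hnr)
    (hgeo.reflTransGen b₀ b) (Metric.mem_closedBall_self (by linarith))
  obtain ⟨a, ha, hlt⟩ := Metric.mem_thickening_iff.1 hb
  exact ⟨a, ha, hlt.le⟩

end unconstricted

/-! ### Coarse models of the pieces -/

/-- `B` is a model of the subset `A` of `X`: an unconstricted, coarsely geodesic space with long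
geodesics near all its points, quasi-isometrically embedded in `X` with image close to `A`. It
stands for a member of `𝒜` itself or for the subgroup of which `A` is a coset. -/
structure IsCoarseModel {X B : Type*} [MetricSpace X] [MetricSpace B] (A : Set X) (f : B → X)
    (L C c : ℝ) : Prop where
  qie : IsQIEmbeddingWith L C f
  image : IsCoarseImage f c Set.univ A
  unconstricted : IsUnconstricted B
  geodesic : IsCoarselyGeodesic B
  line : ∀ (b : B) (r : ℕ), ∃ γ : ℤ → B, dist (γ 0) b ≤ c ∧ IsQuasiGeodesicOn 1 0 γ (-r) r

theorem IsCoarseModel.exists_dist_mem_Icc {X B : Type*} [MetricSpace X] [MetricSpace B]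
    {A : Set X} {f : B → X} {L C c : ℝ} (h : IsCoarseModel A f L C c) {r : ℝ}
    (hr : 2 * c + 1 ≤ r) (b : B) : ∃ y, dist b y ∈ Set.Icc r (2 * r) := by
  obtain ⟨γ, hγb, hγ⟩ := h.line b ⌈r + c⌉₊
  have hc : 0 ≤ c := dist_nonneg.trans hγb
  have hd := isQuasiGeodesicOn_one_zero.1 hγ 0 ⟨by omega, by omega⟩ ⌈r + c⌉₊ ⟨by omega, le_rfl⟩
  rw [Int.cast_zero, zero_sub, abs_neg, Int.cast_natCast, Nat.abs_cast] at hd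
  have hceil := Nat.le_ceil (r + c)
  have hceil' := Nat.ceil_lt_add_one (a := r + c) (by linarith)
  refine ⟨γ ⌈r + c⌉₊, ?_, ?_⟩
  · linarith [dist_triangle (γ 0) b (γ ⌈r + c⌉₊)]
  · linarith [dist_triangle_left b (γ ⌈r + c⌉₊) (γ 0)]

theorem IsQuasiGeodesicOn.map {X B : Type*} [MetricSpace X] [MetricSpace B] {q : B → X}
    {L C : ℝ} (hq : IsQIEmbeddingWith L C q) {γ : ℤ → B} {a b : ℤ}
    (h : IsQuasiGeodesicOn 1 0 γ a b) : IsQuasiGeodesicOn L C (fun i => q (γ i)) a b := by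
  intro i hi j hj
  rw [← isQuasiGeodesicOn_one_zero.1 h i hi j hj]
  exact ⟨hq.inv_mul_dist_sub_le _ _, hq.dist_map_le _ _⟩

theorem le_max_of_forall_le_half {ι : Type*} [Nonempty ι] {g : ι → ℝ} {D₀ K : ℝ}
    (hg : BddAbove (Set.range g))
    (h : ∀ E ≥ D₀, (∀ i, g i ≤ E) → ∀ i, g i ≤ E / 2 + K) (i : ι) : g i ≤ max D₀ (2 * K) := by
  refine (le_ciSup hg i).trans ?_
  by_contra! hlt
  have hhalf : ⨆ i, g i ≤ (⨆ i, g i) / 2 + K :=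
    ciSup_le (h _ ((le_max_left _ _).trans hlt.le) (le_ciSup hg))
  linarith [le_max_right D₀ (2 * K)]

theorem IsAsymptoticallyTreeGraded.exists_uniform_near {X : Type*} [MetricSpace X]
    {𝒜 : Set (Set X)} (h : IsAsymptoticallyTreeGraded 𝒜) (hne : ∀ A ∈ 𝒜, A.Nonempty)
    {L C L' C' c : ℝ} (hL : 0 < L) (hL' : 0 < L') :
    ∃ M : ℝ, ∀ (B : Type*) [MetricSpace B] [Nonempty B] (A : Set X) (f : B → X)
      (_ : IsCoarseModel A f L C c) (φ : X → X) (_ : IsQIEmbeddingWith L' C' φ),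
      ∃ A' ∈ 𝒜, ∀ b, ∃ a ∈ A', dist (φ (f b)) a ≤ M := by
  obtain ⟨D₀, -, hhalf⟩ := h.exists_infDist_le_half (mul_pos hL' hL) (L' * C + C')
  set K := L' * L * c + (L' * C + C')
  refine ⟨max D₀ (2 * K) + 1, fun B _ _ A f hf φ hφ => ?_⟩
  have hq := hφ.comp hf.qie
  obtain ⟨A', hA', D, hD⟩ := h.exists_near_of_isUnconstricted hq hf.unconstricted hf.geodesic
    fun r => hf.exists_dist_mem_Icc
  have hbdd : BddAbove (Set.range fun b => Metric.infDist (φ (f b)) A') := by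
    refine ⟨D, Set.forall_mem_range.2 fun b => ?_⟩
    obtain ⟨a, ha, hd⟩ := hD b
    exact (Metric.infDist_le_dist_of_mem ha).trans hd
  refine ⟨A', hA', fun b => ?_⟩
  have hb : Metric.infDist (φ (f b)) A' ≤ max D₀ (2 * K) := by
    refine le_max_of_forall_le_half hbdd (fun E hE hEb b => ?_) b
    obtain ⟨γ, hγb, hγ⟩ := hf.line b ⌈3 * (L' * L) * E⌉₊
    have hend : 3 * (L' * L) * E ≤ |((⌈3 * (L' * L) * E⌉₊ : ℤ) : ℝ)| := by
      rw [Int.cast_natCast, Nat.abs_cast]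
      exact Nat.le_ceil _
    have hmid := hhalf E hE A' hA' (hne A' hA') _ _ _ ⟨by omega, by omega⟩ (hγ.map hq)
      (fun i _ => hEb (γ i)) (Or.inr (by rwa [Int.cast_neg, abs_neg])) (Or.inr hend)
    have hnear : dist (φ (f b)) (φ (f (γ 0))) ≤ K :=
      hq.dist_map_le_of_le (by rwa [dist_comm])
    exact Metric.infDist_le_infDist_add_dist.trans (add_le_add hmid hnear)
  obtain ⟨a, ha, hlt⟩ := (Metric.infDist_lt_iff (hne A' hA')).1 (hb.trans_lt (lt_add_one _))
  exact ⟨a, ha, hlt.le⟩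

/-! ### Subgroups quasi-isometric to coarsely geodesic spaces -/

theorem IsCoarseImage.comp_subtype_val {X Y : Type*} [MetricSpace X] {ρ : Y → X} {K : ℝ}
    {D : Set Y} {A : Set X} (h : IsCoarseImage ρ K D A) :
    IsCoarseImage (fun y : D => ρ y) K Set.univ A :=
  ⟨fun y _ => h.exists_near_map y y.2, fun a ha =>
    have ⟨y, hy, hya⟩ := h.exists_map_near a ha
    ⟨⟨y, hy⟩, trivial, hya⟩⟩

section quasiLift

variable {X Y B : Type*} [MetricSpace X] [MetricSpace Y] [MetricSpace B] {ρ : Y → X} {m : B → X}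
  {L C L' C' : ℝ}

theorem IsQIEmbeddingWith.of_dist_eq (h : ∀ y y', dist (ρ y) (ρ y') = dist y y') :
    IsQIEmbeddingWith 1 0 ρ :=
  .of_dist_le_mul le_rfl le_rfl (fun y y' => by simp [h]) fun y y' => by simp [h]

theorem isQIEmbeddingWith_subtype_val (A : Set X) :
    IsQIEmbeddingWith 1 0 (Subtype.val : A → X) :=
  .of_dist_eq fun _ _ => rfl

theorem isCoarseImage_subtype_val (A : Set X) :
    IsCoarseImage (Subtype.val : A → X) 0 Set.univ A :=
  ⟨fun a _ => ⟨a, a.2, (dist_self _).le⟩, fun a ha => ⟨⟨a, ha⟩, trivial, (dist_self a).le⟩⟩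

theorem QuasiIsometric.symm (h : QuasiIsometric X Y) : QuasiIsometric Y X := by
  obtain ⟨f, g, hf, hg, hgf, hfg⟩ := h
  exact ⟨g, f, hg, hf, hfg, hgf⟩

theorem IsQIEmbeddingWith.quasiLift (hρ : IsQIEmbeddingWith L C ρ)
    (hm : IsQIEmbeddingWith L' C' m) {K : ℝ} (hK : 0 ≤ K) {τ : Y → B}
    (hτ : ∀ y, dist (m (τ y)) (ρ y) ≤ K) :
    IsQIEmbeddingWith (L * L') (L' * (C + 2 * K + C')) τ := by
  have hL := hρ.pos
  have hL' := hm.pos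
  have hC := hρ.nonneg
  have hC' := hm.nonneg
  refine .of_dist_le_mul (one_le_mul_of_one_le_of_one_le hρ.one_le hm.one_le) (by positivity)
    (fun y y' => ?_) fun y y' => ?_
  · have hd := dist_triangle4_right (m (τ y)) (m (τ y')) (ρ y) (ρ y')
    have := hm.dist_le_of_dist_map_le (r := L * dist y y' + C + 2 * K)
      (by linarith [hτ y, hτ y', hρ.dist_map_le y y'])
    linarith
  · have hd := dist_triangle4_left (m (τ y)) (m (τ y')) (ρ y) (ρ y')
    have hy := hρ.dist_le_of_dist_map_le (r := L' * dist (τ y) (τ y') + C' + 2 * K)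
      (by linarith [hτ y, hτ y', hm.dist_map_le (τ y) (τ y')])
    have hLL : C + 2 * K + C' ≤ L' * (L' * (C + 2 * K + C')) := by
      rw [← mul_assoc]
      exact le_mul_of_one_le_left (by positivity)
        (one_le_mul_of_one_le_of_one_le hm.one_le hm.one_le)
    calc dist y y' ≤ L * (L' * dist (τ y) (τ y') + (C + 2 * K + C')) := by linarith
      _ ≤ L * (L' * dist (τ y) (τ y') + L' * (L' * (C + 2 * K + C'))) := by gcongr
      _ = L * L' * (dist (τ y) (τ y') + L' * (C + 2 * K + C')) := by ring

theorem quasiIsometric_of_isCoarseImage (hρ : IsQIEmbeddingWith L C ρ)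
    (hm : IsQIEmbeddingWith L' C' m) {A : Set X} {K K' : ℝ} (hρA : IsCoarseImage ρ K Set.univ A)
    (hmA : IsCoarseImage m K' Set.univ A) : QuasiIsometric Y B := by
  have hlift : ∀ y, ∃ b, dist (m b) (ρ y) ≤ |K + K'| := fun y => by
    obtain ⟨a, ha, hya⟩ := hρA.exists_near_map y trivial
    obtain ⟨b, -, hba⟩ := hmA.exists_map_near a ha
    exact ⟨b, by linarith [dist_triangle_right (m b) (ρ y) a, le_abs_self (K + K')]⟩
  choose τ hτ using hlift
  refine (hρ.quasiLift hm (abs_nonneg _) hτ).quasiIsometric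
    (K := L' * (|K + K'| + (K + K') + C')) fun b => ?_
  obtain ⟨a, ha, hba⟩ := hmA.exists_near_map b trivial
  obtain ⟨y, -, hya⟩ := hρA.exists_map_near a ha
  refine ⟨y, hm.dist_le_of_dist_map_le ?_⟩
  have hd := dist_triangle4 (m (τ y)) (ρ y) a (m b)
  rw [dist_comm a] at hd
  linarith [hτ y]

end quasiLift

/-- The subgroup `P` with the restriction of the word metric of the ambient group. -/
def CayleyVertices.ofSubgroup {G : Type*} [Group G] (S : FinGenSet G) (P : Subgroup G) :
    Set (CayleyVertices S) :=
  {x : G | x ∈ P}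

section coarselyGeodesic

variable {P B : Type*} [Group P] [MetricSpace B] {σ : B → P}

theorem IsCoarselyGeodesic.inv_mul_mem_closure (hB : IsCoarselyGeodesic B) {F : Set P}
    (hσ : ∀ y y', dist y y' ≤ 1 → (σ y)⁻¹ * σ y' ∈ F) (y y' : B) :
    (σ y)⁻¹ * σ y' ∈ Subgroup.closure F := by
  induction hB.reflTransGen y y' with
  | refl => simp
  | @tail z z' _ hzz' ih =>
    rw [← mul_inv_cancel_left (σ z) (σ z'), ← mul_assoc]
    exact mul_mem ih (Subgroup.subset_closure (hσ z z' hzz'))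

theorem IsCoarselyGeodesic.wordDist_le (hB : IsCoarselyGeodesic B) {E : FinGenSet P}
    (hσ : ∀ y y', dist y y' ≤ 1 → (σ y)⁻¹ * σ y' ∈ E.gens) (y y' : B) :
    wordDist E (σ y) (σ y') ≤ dist y y' + 1 := by
  obtain ⟨n, u, rfl, rfl, hu, hn⟩ := hB y y'
  refine le_trans ?_ hn
  have hstep : ∀ i < n, wordDist E (σ (u i)) (σ (u (i + 1))) ≤ 1 := fun i hi => by
    rw [← wordDist_inv_mul]
    exact wordDist_gen_le E (hσ _ _ (hu i hi))
  have := dist_le_mul_of_dist_succ_le (Y := CayleyVertices E) (γ := fun i => σ (u i)) hstep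
    n.zero_le le_rfl
  rwa [Nat.cast_zero, sub_zero, one_mul] at this

theorem IsCoarselyGeodesic.quasiIsometric_cayleyVertices (hB : IsCoarselyGeodesic B)
    {E : FinGenSet P} {τ : P → B} {D K : ℝ}
    (hσ : ∀ y y', dist y y' ≤ 1 → (σ y)⁻¹ * σ y' ∈ E.gens)
    (hτ : ∀ p, ∀ s ∈ E.gens, dist (τ p) (τ (p * s)) ≤ D)
    (hστ : ∀ p, p⁻¹ * σ (τ p) ∈ E.gens) (hτσ : ∀ y, dist (τ (σ y)) y ≤ K) :
    QuasiIsometric (CayleyVertices E) B := by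
  have hqi : IsQIEmbeddingWith (max 1 D) (max 1 (2 * K)) (Y := CayleyVertices E) σ := by
    refine .of_dist_le_mul (le_max_left _ _) (zero_le_one.trans (le_max_left _ _))
      (fun y y' => ?_) fun y y' => ?_
    · calc wordDist E (σ y) (σ y') ≤ 1 * dist y y' + 1 := by
            rw [one_mul]
            exact hB.wordDist_le hσ y y'
        _ ≤ max 1 D * dist y y' + max 1 (2 * K) := by gcongr <;> exact le_max_left _ _
    · have hd := dist_triangle4 y (τ (σ y)) (τ (σ y')) y'
      rw [dist_comm y (τ (σ y))] at hd
      calc dist y y' ≤ D * wordDist E (σ y) (σ y') + 1 * (2 * K) := by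
            linarith [dist_le_mul_wordDist E τ hτ (σ y) (σ y'), hτσ y, hτσ y']
        _ ≤ max 1 D * wordDist E (σ y) (σ y') + max 1 D * max 1 (2 * K) := by
            have := wordDist_nonneg E (σ y) (σ y')
            have : 0 ≤ K := dist_nonneg.trans (hτσ y)
            gcongr
            exacts [le_max_right _ _, le_max_left _ _, le_max_right _ _]
        _ = _ := (mul_add _ _ _).symm
  have herror : ∀ p, wordDist E (σ (τ p)) p ≤ 1 := fun p => by
    rw [wordDist_comm, ← wordDist_inv_mul]
    exact wordDist_gen_le E (hστ p)
  exact (hqi.quasiIsometric fun p => ⟨τ p, herror p⟩).symm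

end coarselyGeodesic

-- A version of the Milnor–Schwarz lemma: the generators are the differences `(σ y)⁻¹ * σ y'` with
-- `dist y y' ≤ 1` and the errors `p⁻¹ * σ (τ p)`, which have bounded length in the ambient group.
theorem groupQuasiIsometricToSpace_of_ofSubgroup {G B : Type*} [Group G] [MetricSpace B]
    {S : FinGenSet G} {P : Subgroup G} (h : QuasiIsometric (CayleyVertices.ofSubgroup S P) B)
    (hB : IsCoarselyGeodesic B) : GroupQuasiIsometricToSpace P B := by
  obtain ⟨(τ : P → B), (σ : B → P), hτ, hσ, ⟨K, hK⟩, K', hK'⟩ := h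
  obtain ⟨L, C, hτ⟩ := hτ.exists_isQIEmbeddingWith
  obtain ⟨L', C', hσ⟩ := hσ.exists_isQIEmbeddingWith
  set R := max (L' * 1 + C') K
  have hσR : ∀ y y', dist y y' ≤ 1 → wordDist S (σ y : G) (σ y') ≤ R := fun y y' hyy' =>
    (hσ.dist_map_le_of_le hyy').trans (le_max_left _ _)
  have hστR : ∀ p : P, wordDist S (σ (τ p) : G) p ≤ R := fun p => (hK p).trans (le_max_right _ _)
  have hτR : ∀ p q : P, wordDist S (p : G) q ≤ R → dist (τ p) (τ q) ≤ L * R + C := fun p q hpq =>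
    hτ.dist_map_le_of_le hpq
  have hfin : {p : P | wordDist S 1 (p : G) ≤ R}.Finite :=
    (finite_wordDist_le S R).preimage Subtype.val_injective.injOn
  have hmem : ∀ p q : P, wordDist S (p : G) q ≤ R → p⁻¹ * q ∈ hfin.toFinset := fun p q hpq => by
    rwa [hfin.mem_toFinset, Set.mem_ofPred_eq, Subgroup.coe_mul, Subgroup.coe_inv,
      wordDist_inv_mul]
  have hstep : ∀ y y', dist y y' ≤ 1 → (σ y)⁻¹ * σ y' ∈ hfin.toFinset := fun y y' hyy' =>
    hmem _ _ (hσR y y' hyy')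
  have herror : ∀ p, p⁻¹ * σ (τ p) ∈ hfin.toFinset := fun p => hmem _ _ <| by
    rw [wordDist_comm]
    exact hστR p
  have hclosure : Subgroup.closure (hfin.toFinset : Set P) = ⊤ := by
    refine (Subgroup.eq_top_iff' _).2 fun p => ?_
    have h1 := Subgroup.subset_closure (herror 1)
    have hp := inv_mem (Subgroup.subset_closure (herror p))
    simpa using mul_mem (mul_mem h1 (hB.inv_mul_mem_closure hstep (τ 1) (τ p))) hp
  refine ⟨⟨hfin.toFinset, hclosure⟩,
    hB.quasiIsometric_cayleyVertices hstep (fun p s hs => hτR p (p * s) ?_) herror hK'⟩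
  rw [Subgroup.coe_mul, wordDist_self_mul]
  exact hfin.mem_toFinset.1 hs

/-! ### Coarse actions on families of subsets -/

/-- `f` and `f'` are quasi-isometric embeddings that are quasi-inverse to each other, all with the
same constants. -/
structure IsQuasiInversePair {X Y : Type*} [MetricSpace X] [MetricSpace Y] (f : Y → X)
    (f' : X → Y) (L C : ℝ) : Prop where
  qie : IsQIEmbeddingWith L C f
  qie' : IsQIEmbeddingWith L C f'
  dist_left : ∀ y, dist (f' (f y)) y ≤ C
  dist_right : ∀ x, dist (f (f' x)) x ≤ C

theorem QuasiIsometric.exists_isQuasiInversePair {X Y : Type*} [MetricSpace X] [MetricSpace Y]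
    (h : QuasiIsometric Y X) :
    ∃ (f : Y → X) (f' : X → Y) (L C : ℝ), IsQuasiInversePair f f' L C := by
  obtain ⟨f, f', hf, hf', ⟨K, hK⟩, K', hK'⟩ := h
  obtain ⟨L, C, hf⟩ := hf.exists_isQIEmbeddingWith
  obtain ⟨L', C', hf'⟩ := hf'.exists_isQIEmbeddingWith
  exact ⟨f, f', max L L', max (max C C') (max K K'),
    hf.mono (le_max_left _ _) ((le_max_left _ _).trans (le_max_left _ _)),
    hf'.mono (le_max_right _ _) ((le_max_right _ _).trans (le_max_left _ _)),
    fun y => (hK y).trans ((le_max_left _ _).trans (le_max_right _ _)),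
    fun x => (hK' x).trans ((le_max_right _ _).trans (le_max_right _ _))⟩

section leftMultiplication

variable {Γ X : Type*} [Group Γ] {S : FinGenSet Γ} [MetricSpace X] {f : Γ → X} {f' : X → Γ}
  {L C : ℝ}

theorem isQIEmbeddingWith_mul_left (S : FinGenSet Γ) (g : Γ) :
    IsQIEmbeddingWith 1 0 (X := CayleyVertices S) (Y := CayleyVertices S)
      (fun x : Γ => g * x) :=
  .of_dist_eq (wordDist_mul_left S g)

namespace IsQuasiInversePair

theorem isQIEmbeddingWith_mul_left (h : IsQuasiInversePair (Y := CayleyVertices S) f f' L C)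
    (g : Γ) : IsQIEmbeddingWith (L * L) (L * C + C) (fun x => f (g * f' x)) := by
  have := h.qie.comp ((_root_.isQIEmbeddingWith_mul_left S g).comp h.qie')
  simpa using this

theorem dist_mul_mul_le (h : IsQuasiInversePair (Y := CayleyVertices S) f f' L C) (g k : Γ)
    (x : X) : dist (f (g * f' (f (k * f' x)))) (f (g * k * f' x)) ≤ L * C + C := by
  have hw : wordDist S (g * f' (f (k * f' x))) (g * k * f' x) ≤ C := by
    rw [mul_assoc, wordDist_mul_left]
    exact h.dist_left (k * f' x)
  exact h.qie.dist_map_le_of_le hw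

end IsQuasiInversePair

end leftMultiplication

/-- `Γ` acts on `𝒜` in such a way that the maps `x ↦ f (g * f' x)` send `A` close to `g • A`,
where `f` and `f'` are quasi-inverse quasi-isometries between `Γ` and `X`. -/
structure IsCoarseAction {Γ X : Type*} [Group Γ] (S : FinGenSet Γ) [MetricSpace X]
    (𝒜 : Set (Set X)) [MulAction Γ 𝒜] (f : Γ → X) (f' : X → Γ) (L C M : ℝ) : Prop
    extends IsQuasiInversePair (Y := CayleyVertices S) f f' L C where
  near : ∀ (g : Γ) (A : 𝒜), ∀ x ∈ A.1, ∃ a ∈ (g • A).1, dist (f (g * f' x)) a ≤ M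

namespace IsCoarseAction

variable {Γ X : Type*} [Group Γ] {S : FinGenSet Γ} [MetricSpace X] {𝒜 : Set (Set X)}
  [MulAction Γ 𝒜] {f : Γ → X} {f' : X → Γ} {L C M : ℝ}

theorem exists_map_near (h : IsCoarseAction S 𝒜 f f' L C M) (g : Γ) (A : 𝒜) {x : X}
    (hx : x ∈ (g • A).1) :
    ∃ a ∈ A.1, dist (f (g * f' a)) x ≤ L * L * M + 2 * (L * C + C) + C := by
  obtain ⟨a, ha, hxa⟩ := h.near g⁻¹ (g • A) x hx
  rw [inv_smul_smul] at ha
  refine ⟨a, ha, ?_⟩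
  have h1 := (h.isQIEmbeddingWith_mul_left g).dist_map_le_of_le ((dist_comm _ _).trans_le hxa)
  have h2 := h.dist_mul_mul_le g g⁻¹ x
  rw [mul_inv_cancel, one_mul] at h2
  linarith [dist_triangle4 (f (g * f' a)) (f (g * f' (f (g⁻¹ * f' x)))) (f (f' x)) x,
    h.dist_right x]

theorem isCoarseImage_smul (h : IsCoarseAction S 𝒜 f f' L C M) (g : Γ) (A : 𝒜) :
    IsCoarseImage (fun x => f (g * f' x)) (max M (L * L * M + 2 * (L * C + C) + C)) A.1
      (g • A).1 where
  exists_near_map x hx := by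
    obtain ⟨a, ha, hxa⟩ := h.near g A x hx
    exact ⟨a, ha, hxa.trans (le_max_left _ _)⟩
  exists_map_near a ha := by
    obtain ⟨x, hx, hxa⟩ := h.exists_map_near g A ha
    exact ⟨x, hx, hxa.trans (le_max_right _ _)⟩

theorem quasiIsometric_smul (h : IsCoarseAction S 𝒜 f f' L C M) (g : Γ) (A : 𝒜) :
    QuasiIsometric A.1 (g • A).1 := by
  exact quasiIsometric_of_isCoarseImage
    ((h.isQIEmbeddingWith_mul_left g).comp (isQIEmbeddingWith_subtype_val A.1))
    (isQIEmbeddingWith_subtype_val _) (h.isCoarseImage_smul g A).comp_subtype_val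
    (isCoarseImage_subtype_val _)

theorem exists_dist_map_one_le (h : IsCoarseAction S 𝒜 f f' L C M) (A : 𝒜) {x : X}
    (hx : x ∈ A.1) : ∃ a ∈ ((f' x)⁻¹ • A).1, dist (f 1) a ≤ M := by
  simpa using h.near (f' x)⁻¹ A x hx

theorem finite_orbits (h : IsCoarseAction S 𝒜 f f' L C M) (hne : ∀ A ∈ 𝒜, A.Nonempty)
    (hfin : {A : 𝒜 | ∃ a ∈ A.1, dist (f 1) a ≤ M}.Finite) :
    Finite (MulAction.orbitRel.Quotient Γ 𝒜) := by
  refine Set.finite_univ_iff.1 ((hfin.image Quotient.mk'').subset fun p _ => ?_)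
  induction p using Quotient.inductionOn' with
  | h A =>
    obtain ⟨x, hx⟩ := hne A.1 A.2
    exact ⟨(f' x)⁻¹ • A, h.exists_dist_map_one_le A hx,
      Quotient.sound' (MulAction.orbitRel_apply.2 ⟨(f' x)⁻¹, rfl⟩)⟩

-- Every `(f' x)⁻¹ • A` with `x ∈ A` belongs to the finite set `hfin`; for each member of that set
-- choose one such point `y`. The element `f' x * (f' y)⁻¹` then stabilizes `A`.
theorem exists_dist_le_of_smul_eq (h : IsCoarseAction S 𝒜 f f' L C M)
    (hfin : {A : 𝒜 | ∃ a ∈ A.1, dist (f 1) a ≤ M}.Finite) (A : 𝒜) (a₀ : X) :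
    ∃ R : ℝ, ∀ x ∈ A.1, ∃ y, (f' y)⁻¹ • A = (f' x)⁻¹ • A ∧ dist a₀ y ≤ R := by
  have hR : ∀ᶠ R : ℝ in atTop, ∀ A' ∈ {A : 𝒜 | ∃ a ∈ A.1, dist (f 1) a ≤ M},
      (∃ x, (f' x)⁻¹ • A = A') → ∃ y, (f' y)⁻¹ • A = A' ∧ dist a₀ y ≤ R := by
    refine (eventually_all_finite hfin).2 fun A' _ => ?_
    by_cases hA' : ∃ x, (f' x)⁻¹ • A = A'
    · obtain ⟨y, hy⟩ := hA'
      filter_upwards [eventually_ge_atTop (dist a₀ y)] with R hR _ using ⟨y, hy, hR⟩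
    · exact .of_forall fun R hx => absurd hx hA'
  obtain ⟨R, hR⟩ := hR.exists
  exact ⟨R, fun x hx => hR _ (h.exists_dist_map_one_le A hx) ⟨x, rfl⟩⟩

theorem exists_stabilizer_dist_le (h : IsCoarseAction S 𝒜 f f' L C M)
    (hfin : {A : 𝒜 | ∃ a ∈ A.1, dist (f 1) a ≤ M}.Finite) (A : 𝒜) (a₀ : X) :
    ∃ R : ℝ, ∀ x ∈ A.1, ∃ g ∈ MulAction.stabilizer Γ A, dist (f (g * f' a₀)) x ≤ R := by
  obtain ⟨R, hR⟩ := h.exists_dist_le_of_smul_eq hfin A a₀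
  refine ⟨L * L * R + (L * C + C) + C, fun x hx => ?_⟩
  obtain ⟨y, hyx, hy⟩ := hR x hx
  refine ⟨f' x * (f' y)⁻¹, ?_, ?_⟩
  · rw [MulAction.mem_stabilizer_iff, mul_smul, hyx, smul_inv_smul]
  · have h1 := (h.isQIEmbeddingWith_mul_left (f' x * (f' y)⁻¹)).dist_map_le_of_le hy
    rw [inv_mul_cancel_right] at h1
    linarith [dist_triangle (f (f' x * (f' y)⁻¹ * f' a₀)) (f (f' x)) x, h.dist_right x]

theorem exists_isCoarseImage_coset (h : IsCoarseAction S 𝒜 f f' L C M)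
    (hfin : {A : 𝒜 | ∃ a ∈ A.1, dist (f 1) a ≤ M}.Finite) (A : 𝒜) (hA : A.1.Nonempty) :
    ∃ K, ∀ g : Γ, IsCoarseImage f K {x : Γ | x • A = g • A} (g • A).1 := by
  obtain ⟨a₀, ha₀⟩ := hA
  obtain ⟨R, hR⟩ := h.exists_stabilizer_dist_le hfin A a₀
  have hbase : ∀ x, dist (f x) (f (x * f' a₀)) ≤ L * wordDist S 1 (f' a₀) + C := fun x =>
    h.qie.dist_map_le_of_le (wordDist_self_mul S x (f' a₀)).le
  set W := L * wordDist S 1 (f' a₀) + C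
  set Q := L * C + C
  refine ⟨max (W + M) (W + Q + (L * L * R + Q) + (L * L * M + 2 * Q + C)), fun g => ⟨?_, ?_⟩⟩
  · rintro x (hx : x • A = g • A)
    obtain ⟨a, ha, hxa⟩ := h.near x A a₀ ha₀
    rw [hx] at ha
    exact ⟨a, ha, (dist_triangle _ _ _ |>.trans (add_le_add (hbase x) hxa)).trans (le_max_left _ _)⟩
  · intro y hy
    obtain ⟨a, ha, hay⟩ := h.exists_map_near g A hy
    obtain ⟨p, hp, hpa⟩ := hR a ha
    refine ⟨g * p, ?_, le_trans ?_ (le_max_right _ _)⟩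
    · rw [Set.mem_ofPred_eq, mul_smul, MulAction.mem_stabilizer_iff.1 hp]
    · have hmul := h.dist_mul_mul_le g p a₀
      rw [dist_comm] at hmul
      have hga := (h.isQIEmbeddingWith_mul_left g).dist_map_le_of_le hpa
      linarith [hbase (g * p), dist_triangle (f (g * p)) (f (g * p * f' a₀)) y,
        dist_triangle4 (f (g * p * f' a₀)) (f (g * f' (f (p * f' a₀)))) (f (g * f' a)) y]

theorem stabilizer_quasiIsometric (h : IsCoarseAction S 𝒜 f f' L C M)
    (hfin : {A : 𝒜 | ∃ a ∈ A.1, dist (f 1) a ≤ M}.Finite) (A : 𝒜) (hA : A.1.Nonempty)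
    {B : Type*} [MetricSpace B] {m : B → X} {L' C' c : ℝ} (hm : IsCoarseModel A.1 m L' C' c) :
    GroupQuasiIsometricToSpace (MulAction.stabilizer Γ A) B := by
  obtain ⟨K, hK⟩ := h.exists_isCoarseImage_coset hfin A hA
  have hstab : IsCoarseImage f K (CayleyVertices.ofSubgroup S (MulAction.stabilizer Γ A)) A.1 := by
    have := hK 1
    rwa [one_smul] at this
  refine groupQuasiIsometricToSpace_of_ofSubgroup (S := S) ?_ hm.geodesic
  exact quasiIsometric_of_isCoarseImage
    (h.qie.comp (isQIEmbeddingWith_subtype_val (CayleyVertices.ofSubgroup S _))) hm.qie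
    hstab.comp_subtype_val hm.image

end IsCoarseAction

/-! ### The action of a group quasi-isometric to an asymptotically tree-graded space -/

theorem IsCoarseModel.nonempty {X B : Type*} [MetricSpace X] [MetricSpace B] {A : Set X}
    {f : B → X} {L C c : ℝ} (h : IsCoarseModel A f L C c) (hA : A.Nonempty) : Nonempty B :=
  let ⟨_, ha⟩ := hA
  let ⟨b, _⟩ := h.image.exists_map_near _ ha
  ⟨b⟩

theorem IsCoarseModel.not_isBounded {X B : Type*} [MetricSpace X] [MetricSpace B] [Nonempty B]
    {A : Set X} {f : B → X} {L C c : ℝ} (h : IsCoarseModel A f L C c) :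
    ¬ Bornology.IsBounded A := by
  rw [Metric.isBounded_iff]
  rintro ⟨R, hR⟩
  obtain ⟨b⟩ := ‹Nonempty B›
  obtain ⟨b', hfar, -⟩ := h.exists_dist_mem_Icc
    (le_max_left (2 * c + 1) (L * (R + 2 * c + C) + 1)) b
  obtain ⟨x, hx, hbx⟩ := h.image.exists_near_map b trivial
  obtain ⟨y, hy, hby⟩ := h.image.exists_near_map b' trivial
  have hmap : dist (f b) (f b') ≤ R + 2 * c := by
    linarith [dist_triangle4_right (f b) (f b') x y, hR hx hy]
  linarith [h.qie.dist_le_of_dist_map_le hmap, (le_max_right _ _).trans hfar]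

namespace IsAsymptoticallyTreeGraded

variable {X : Type*} [MetricSpace X] {𝒜 : Set (Set X)}

theorem eq_of_near (h : IsAsymptoticallyTreeGraded 𝒜) {A A₁ A₂ : Set X} (hA₁ : A₁ ∈ 𝒜)
    (hA₂ : A₂ ∈ 𝒜) (hA : ¬ Bornology.IsBounded A) {φ : X → X} {L C δ₁ δ₂ : ℝ}
    (hφ : IsQIEmbeddingWith L C φ) (h₁ : ∀ x ∈ A, ∃ a ∈ A₁, dist (φ x) a ≤ δ₁)
    (h₂ : ∀ x ∈ A, ∃ a ∈ A₂, dist (φ x) a ≤ δ₂) : A₁ = A₂ := by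
  by_contra hne
  obtain ⟨R, hR⟩ := h.exists_dist_le_of_near (max δ₁ δ₂)
  have near₁ : ∀ x ∈ A, ∃ a ∈ A₁, dist (φ x) a ≤ max δ₁ δ₂ := fun x hx =>
    (h₁ x hx).imp fun _ ha => ⟨ha.1, ha.2.trans (le_max_left _ _)⟩
  have near₂ : ∀ x ∈ A, ∃ a ∈ A₂, dist (φ x) a ≤ max δ₁ δ₂ := fun x hx =>
    (h₂ x hx).imp fun _ ha => ⟨ha.1, ha.2.trans (le_max_right _ _)⟩
  refine hA (Metric.isBounded_iff.2 ⟨L * (R + C), fun x hx y hy => ?_⟩)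
  exact hφ.dist_le_of_dist_map_le
    (hR A₁ hA₁ A₂ hA₂ hne _ _ (near₁ x hx) (near₂ x hx) (near₁ y hy) (near₂ y hy))

theorem exists_uniform_near_image (h : IsAsymptoticallyTreeGraded 𝒜)
    (hne : ∀ A ∈ 𝒜, A.Nonempty) {L₀ C₀ c L C : ℝ} (hL₀ : 0 < L₀) (hL : 0 < L)
    (hmodel : ∀ A ∈ 𝒜, ∃ (B : Type*) (_ : MetricSpace B) (m : B → X),
      IsCoarseModel A m L₀ C₀ c) :
    ∃ M : ℝ, ∀ φ : X → X, IsQIEmbeddingWith L C φ →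
      ∀ A ∈ 𝒜, ∃ A' ∈ 𝒜, ∀ x ∈ A, ∃ a ∈ A', dist (φ x) a ≤ M := by
  obtain ⟨M, hM⟩ := h.exists_uniform_near hne (C := C₀) (C' := C) (c := c) hL₀ hL
  refine ⟨L * c + C + M, fun φ hφ A hA => ?_⟩
  obtain ⟨B, _, m, hm⟩ := hmodel A hA
  have := hm.nonempty (hne A hA)
  obtain ⟨A', hA', hnear⟩ := hM B A m hm φ hφ
  refine ⟨A', hA', fun x hx => ?_⟩
  obtain ⟨b, -, hb⟩ := hm.image.exists_map_near x hx
  obtain ⟨a, ha, hba⟩ := hnear b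
  exact ⟨a, ha, by
    linarith [hφ.dist_map_le_of_le hb, dist_triangle_left (φ x) a (φ (m b))]⟩

end IsAsymptoticallyTreeGraded

theorem exists_mulAction_of_existsUnique {Γ α : Type*} [Group Γ] {r : Γ → α → α → Prop}
    (hr : ∀ g a, ∃! b, r g a b) (hone : ∀ a, r 1 a a)
    (hmul : ∀ g k a b c, r k a b → r g b c → r (g * k) a c) :
    ∃ _ : MulAction Γ α, ∀ (g : Γ) (a b : α), r g a b → b = g • a := by
  choose act hact huniq using hr
  let inst : MulAction Γ α :=
    { smul := act
      one_smul a := (huniq 1 a a (hone a)).symm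
      mul_smul g k a := (huniq (g * k) a _ (hmul g k a _ _ (hact k a) (hact g _))).symm }
  exact ⟨inst, huniq⟩

namespace IsQuasiInversePair

variable {Γ X : Type*} [Group Γ] {S : FinGenSet Γ} [MetricSpace X] {f : Γ → X} {f' : X → Γ}
  {L C : ℝ}

theorem near_mul (h : IsQuasiInversePair (Y := CayleyVertices S) f f' L C) {g k : Γ}
    {A B D : Set X} {δ ε : ℝ} (hk : ∀ x ∈ A, ∃ b ∈ B, dist (f (k * f' x)) b ≤ δ)
    (hg : ∀ y ∈ B, ∃ b ∈ D, dist (f (g * f' y)) b ≤ ε) :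
    ∀ x ∈ A, ∃ b ∈ D, dist (f (g * k * f' x)) b ≤ L * C + C + (L * L * δ + (L * C + C)) + ε := by
  intro x hx
  obtain ⟨y, hy, hxy⟩ := hk x hx
  obtain ⟨z, hz, hyz⟩ := hg y hy
  have hmul := h.dist_mul_mul_le g k x
  rw [dist_comm] at hmul
  exact ⟨z, hz, by
    linarith [(h.isQIEmbeddingWith_mul_left g).dist_map_le_of_le hxy,
      dist_triangle4 (f (g * k * f' x)) (f (g * f' (f (k * f' x)))) (f (g * f' y)) z]⟩

theorem exists_isCoarseAction (hf : IsQuasiInversePair (Y := CayleyVertices S) f f' L C)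
    {𝒜 : Set (Set X)} (h : IsAsymptoticallyTreeGraded 𝒜) (hne : ∀ A ∈ 𝒜, A.Nonempty)
    {L₀ C₀ c : ℝ} (hL₀ : 0 < L₀)
    (hmodel : ∀ A ∈ 𝒜, ∃ (B : Type*) (_ : MetricSpace B) (m : B → X),
      IsCoarseModel A m L₀ C₀ c) :
    ∃ (_ : MulAction Γ 𝒜) (M : ℝ), IsCoarseAction S 𝒜 f f' L C M := by
  let r : Γ → 𝒜 → 𝒜 → Prop := fun g A A' => ∃ δ, ∀ x ∈ A.1, ∃ a ∈ A'.1, dist (f (g * f' x)) a ≤ δ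
  have hqie := fun g : Γ => hf.isQIEmbeddingWith_mul_left g
  have huniq : ∀ g A A₁ A₂, r g A A₁ → r g A A₂ → A₁ = A₂ := by
    rintro g A A₁ A₂ ⟨δ₁, h₁⟩ ⟨δ₂, h₂⟩
    obtain ⟨B, _, m, hm⟩ := hmodel A.1 A.2
    have := hm.nonempty (hne A.1 A.2)
    exact Subtype.ext (h.eq_of_near A₁.2 A₂.2 hm.not_isBounded (hqie g) h₁ h₂)
  obtain ⟨M, hM⟩ := h.exists_uniform_near_image hne hL₀ (hqie 1).pos hmodel
  have hnear : ∀ (g : Γ) (A : 𝒜), ∃ A' : 𝒜, ∀ x ∈ A.1, ∃ a ∈ A'.1, dist (f (g * f' x)) a ≤ M :=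
    fun g A => let ⟨A', hA', hAA'⟩ := hM _ (hqie g) A.1 A.2; ⟨⟨A', hA'⟩, hAA'⟩
  obtain ⟨inst, hinst⟩ := exists_mulAction_of_existsUnique (r := r)
    (fun g A => let ⟨A', hA'⟩ := hnear g A; ⟨A', ⟨M, hA'⟩, fun _ h₁ => huniq g A _ _ h₁ ⟨M, hA'⟩⟩)
    (fun A => ⟨C, fun x hx => ⟨x, hx, by rw [one_mul]; exact hf.dist_right x⟩⟩)
    (fun _ _ _ _ _ ⟨_, hk⟩ ⟨_, hg⟩ => ⟨_, hf.near_mul hk hg⟩)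
  refine ⟨inst, M, hf, fun g A => ?_⟩
  obtain ⟨A', hA'⟩ := hnear g A
  rwa [← hinst g A A' ⟨M, hA'⟩]

end IsQuasiInversePair

/-- `a` lists exactly one representative of each orbit of `Γ` on `α`. -/
structure IsOrbitTransversal (Γ : Type*) {α ι : Type*} [Group Γ] [MulAction Γ α] (a : ι → α) :
    Prop where
  exists_eq_smul : ∀ b, ∃ (i : ι) (g : Γ), b = g • a i
  index_eq : ∀ i j (g : Γ), a i = g • a j → i = j

theorem exists_isOrbitTransversal (Γ α : Type*) [Group Γ] [MulAction Γ α]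
    [Finite (MulAction.orbitRel.Quotient Γ α)] :
    ∃ (m : ℕ) (a : Fin m → α), IsOrbitTransversal Γ a := by
  obtain ⟨m, ⟨σ⟩⟩ := Finite.exists_equiv_fin (MulAction.orbitRel.Quotient Γ α)
  have hmk : ∀ i, Quotient.mk'' (σ.symm i).out = σ.symm i := fun i => Quotient.out_eq' _
  refine ⟨m, fun i => (σ.symm i).out, fun b => ?_, fun i j g hg => ?_⟩
  · obtain ⟨i, hi⟩ := σ.symm.surjective (Quotient.mk'' b)
    obtain ⟨g, hg⟩ := MulAction.orbitRel_apply.1 (Quotient.exact' ((hmk i).trans hi).symm)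
    exact ⟨i, g, hg.symm⟩
  · refine σ.symm.injective ?_
    rw [← hmk i, ← hmk j]
    exact Quotient.sound' (MulAction.orbitRel_apply.2 ⟨g, hg.symm⟩)

theorem IsOrbitTransversal.setOf_smul_eq {Γ α ι : Type*} [Group Γ] [MulAction Γ α] {a : ι → α}
    (ha : IsOrbitTransversal Γ a) (g : Γ) (i : ι) :
    {x : Γ | ∃ j, x • a j = g • a i} = {x | x • a i = g • a i} := by
  refine Set.ext fun x => ⟨?_, fun hx => ⟨i, hx⟩⟩
  rintro ⟨j, hj⟩
  have hij : i = j := ha.index_eq i j (g⁻¹ * x) (by rw [mul_smul, hj, inv_smul_smul])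
  subst hij
  exact hj

theorem setOf_inv_mul_mem_stabilizer {Γ α : Type*} [Group Γ] [MulAction Γ α] (g : Γ) (a : α) :
    {x : Γ | g⁻¹ * x ∈ MulAction.stabilizer Γ a} = {x | x • a = g • a} := by
  ext x
  simp only [Set.mem_ofPred_eq, MulAction.mem_stabilizer_iff, mul_smul, inv_smul_eq_iff]

theorem exists_isQIEmbeddingWith_id {G : Type*} [Group G] (S T : FinGenSet G) :
    ∃ L, IsQIEmbeddingWith (X := CayleyVertices T) (Y := CayleyVertices S) L 0
      (fun x : G => x) := by
  obtain ⟨L₁, hL₁, hST⟩ := exists_wordDist_le_mul S T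
  obtain ⟨L₂, -, hTS⟩ := exists_wordDist_le_mul T S
  refine ⟨max L₁ L₂, .of_dist_le_mul (hL₁.trans (le_max_left _ _)) le_rfl
    (fun (a b : G) => ?_) (fun (a b : G) => ?_)⟩
  · rw [add_zero]
    exact (hST a b).trans (mul_le_mul_of_nonneg_right (le_max_left _ _) (wordDist_nonneg T a b))
  · rw [add_zero]
    exact (hTS a b).trans (mul_le_mul_of_nonneg_right (le_max_right _ _) (wordDist_nonneg S a b))

theorem leftCosets_stabilizer {Γ X : Type*} [Group Γ] (T : FinGenSet Γ) {𝒜 : Set (Set X)}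
    [MulAction Γ 𝒜] {m : ℕ} {A : Fin m → 𝒜} (hA : IsOrbitTransversal Γ A) :
    leftCosets T (fun i => MulAction.stabilizer Γ (A i)) =
      (fun B => {x : Γ | ∃ i, (x • A i).1 = B}) '' 𝒜 := by
  have key : ∀ (g : Γ) i, {x : Γ | ∃ j, (x • A j).1 = (g • A i).1} =
      {x | g⁻¹ * x ∈ MulAction.stabilizer Γ (A i)} := fun g i => by
    simp only [← Subtype.ext_iff, hA.setOf_smul_eq, setOf_inv_mul_mem_stabilizer]
  refine Set.ext fun D => ⟨?_, ?_⟩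
  · rintro ⟨g, i, rfl⟩
    exact ⟨(g • A i).1, (g • A i).2, key g i⟩
  · rintro ⟨B, hB, rfl⟩
    obtain ⟨i, g, hg⟩ := hA.exists_eq_smul ⟨B, hB⟩
    refine ⟨g, i, ?_⟩
    rw [← key, ← hg]

theorem IsCoarseAction.isGroupTreeGraded {Γ X : Type*} [Group Γ] {S : FinGenSet Γ} [MetricSpace X]
    {𝒜 : Set (Set X)} [MulAction Γ 𝒜] {f : Γ → X} {f' : X → Γ} {L C M : ℝ}
    (h : IsCoarseAction S 𝒜 f f' L C M) (htg : IsAsymptoticallyTreeGraded 𝒜)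
    (hne : ∀ A ∈ 𝒜, A.Nonempty) (hfin : {A : 𝒜 | ∃ a ∈ A.1, dist (f 1) a ≤ M}.Finite)
    {m : ℕ} {A : Fin m → 𝒜} (hA : IsOrbitTransversal Γ A) (T : FinGenSet Γ) :
    IsGroupTreeGraded T fun i => MulAction.stabilizer Γ (A i) := by
  obtain ⟨L', hid⟩ := exists_isQIEmbeddingWith_id S T
  choose K hK using fun i => h.exists_isCoarseImage_coset hfin (A i) (hne _ (A i).2)
  obtain ⟨K', hK'⟩ := Finite.exists_le K
  rw [IsGroupTreeGraded, leftCosets_stabilizer T hA]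
  refine htg.of_isQIEmbeddingWith (h.qie.comp hid) (K := max C K')
    (fun x => ⟨f' x, (h.dist_right x).trans (le_max_left _ _)⟩)
    (fun _ d e => CayleyVertices.isGeodesicSubset_cone T d e) fun B hB => ?_
  obtain ⟨i, g, hg⟩ := hA.exists_eq_smul ⟨B, hB⟩
  have hB' : B = (g • A i).1 := congrArg Subtype.val hg
  have hcoset := (hK i g).mono ((hK' i).trans (le_max_right C K'))
  rw [← hA.setOf_smul_eq] at hcoset
  simp only [hB', ← Subtype.ext_iff]
  exact hcoset

theorem IsAsymptoticallyTreeGraded.exists_subgroups {Γ : Type*} [Group Γ] {X : Type*}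
    [MetricSpace X] {𝒜 : Set (Set X)} (h : IsAsymptoticallyTreeGraded 𝒜)
    (hne : ∀ A ∈ 𝒜, A.Nonempty) {L₀ C₀ c : ℝ} (hL₀ : 0 < L₀)
    (hmodel : ∀ A ∈ 𝒜, ∃ (B : Type*) (_ : MetricSpace B) (m : B → X), IsCoarseModel A m L₀ C₀ c)
    (x₀ : X) (hfin : ∀ R : ℝ, {A ∈ 𝒜 | (A ∩ Metric.ball x₀ R).Nonempty}.Finite)
    (hΓ : GroupQuasiIsometricToSpace Γ X) :
    ∃ (m : ℕ) (A : Fin m → Set X) (P : Fin m → Subgroup Γ), (∀ i, A i ∈ 𝒜) ∧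
      (∀ B ∈ 𝒜, ∃ i, QuasiIsometric B (A i)) ∧
      (∀ i (B : Type*) [MetricSpace B] (m : B → X), IsCoarseModel (A i) m L₀ C₀ c →
        GroupQuasiIsometricToSpace (P i) B) ∧
      ∀ T : FinGenSet Γ, IsGroupTreeGraded T P := by
  obtain ⟨S, hS⟩ := hΓ
  obtain ⟨(f : Γ → X), (f' : X → Γ), L, C, hf⟩ := hS.exists_isQuasiInversePair
  obtain ⟨_, M, hact⟩ := hf.exists_isCoarseAction h hne hL₀ hmodel
  have hfin' : {A : 𝒜 | ∃ a ∈ A.1, dist (f 1) a ≤ M}.Finite := by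
    refine Set.Finite.of_finite_image ((hfin (dist x₀ (f 1) + M + 1)).subset ?_)
      Subtype.val_injective.injOn
    rintro _ ⟨A, ⟨a, ha, hd⟩, rfl⟩
    refine ⟨A.2, a, ha, ?_⟩
    rw [Metric.mem_ball, dist_comm]
    linarith [dist_triangle x₀ (f 1) a]
  have := hact.finite_orbits hne hfin'
  obtain ⟨m, A, hA⟩ := exists_isOrbitTransversal Γ 𝒜
  refine ⟨m, fun i => (A i).1, fun i => MulAction.stabilizer Γ (A i), fun i => (A i).2,
    fun B hB => ?_, fun i B _ m hm => hact.stabilizer_quasiIsometric hfin' (A i) (hne _ (A i).2) hm,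
    hact.isGroupTreeGraded h hne hfin' hA⟩
  obtain ⟨i, g, hg⟩ := hA.exists_eq_smul ⟨B, hB⟩
  have hB' : B = (g • A i).1 := congrArg Subtype.val hg
  rw [hB']
  exact ⟨i, (hact.quasiIsometric_smul g (A i)).symm⟩

/-! ### Quasi-convexity of the pieces -/

theorem IsAsymptoticallyTreeGraded.exists_dist_lt_of_isQuasiGeodesicOn {X : Type*} [MetricSpace X]
    {𝒜 : Set (Set X)} (h : IsAsymptoticallyTreeGraded 𝒜) {L : ℝ} (hL : 0 < L) (C : ℝ) :
    ∃ D : ℝ, ∀ A ∈ 𝒜, ∀ (a b : ℤ) (γ : ℤ → X), IsQuasiGeodesicOn L C γ a b → γ a ∈ A → γ b ∈ A →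
      ∀ i ∈ Set.Icc a b, ∃ p ∈ A, dist (γ i) p < D := by
  obtain ⟨D, hD, hhalf⟩ := h.exists_infDist_le_half hL C
  refine ⟨D, fun A hA a b γ hγ ha hb i hi => (Metric.infDist_lt_iff ⟨_, ha⟩).1 ?_⟩
  obtain ⟨k, hk, hmax⟩ := Finset.exists_max_image (Finset.Icc a b)
    (fun j => Metric.infDist (γ j) A) ⟨i, Finset.mem_Icc.2 hi⟩
  rw [Finset.mem_Icc] at hk
  refine (hmax i (Finset.mem_Icc.2 hi)).trans_lt ?_
  by_contra! hge
  have hmid := hhalf _ hge A hA ⟨_, ha⟩ (a - k) (b - k) (fun j => γ (k + j))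
    ⟨by omega, by omega⟩ (hγ.comp_add k)
    (fun j hj => hmax _ (Finset.mem_Icc.2 ⟨by linarith [hj.1], by linarith [hj.2]⟩))
    (Or.inl (by rwa [add_sub_cancel])) (Or.inl (by rwa [add_sub_cancel]))
  rw [add_zero] at hmid
  linarith

/-! ### Geodesic subsets as models -/

theorem IsGeodesicSubset.isCoarselyGeodesic {X : Type*} [MetricSpace X] {A : Set X}
    (hA : IsGeodesicSubset A) : IsCoarselyGeodesic A := by
  rintro ⟨b, hb⟩ ⟨b', hb'⟩
  obtain ⟨_, ⟨γ, h0, h1, hγ, rfl⟩, hγA⟩ := hA b hb b' hb'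
  have hD : 0 ≤ dist b b' := dist_nonneg
  have hmem : ∀ i : ℕ, min (i : ℝ) (dist b b') ∈ Set.Icc 0 (dist b b') := fun i =>
    ⟨le_min i.cast_nonneg hD, min_le_right _ _⟩
  refine ⟨⌈dist b b'⌉₊, fun i => ⟨γ (min i (dist b b')), hγA ⟨_, hmem i, rfl⟩⟩, ?_, ?_, ?_,
    (Nat.ceil_lt_add_one hD).le⟩
  · simp only [Nat.cast_zero, min_eq_left hD, h0]
  · simp only [min_eq_right (Nat.le_ceil _), h1]
  · intro i _
    rw [Subtype.dist_eq, hγ _ (hmem i) _ (hmem (i + 1))]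
    refine (abs_min_sub_min_le_max _ _ _ _).trans ?_
    simp

theorem isCoarseModel_subtype_val {X : Type*} [MetricSpace X] {A : Set X} {c : ℝ} (hc : 0 ≤ c)
    (hA : IsGeodesicSubset A) (hu : IsUnconstricted A)
    (hline : ∀ a ∈ A, ∃ γ : ℝ → X, Isometry γ ∧ (∀ t, γ t ∈ A) ∧ ∃ t, dist a (γ t) ≤ c) :
    IsCoarseModel A (Subtype.val : A → X) 1 0 c where
  qie := isQIEmbeddingWith_subtype_val A
  image := (isCoarseImage_subtype_val A).mono hc
  unconstricted := hu
  geodesic := hA.isCoarselyGeodesic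
  line := by
    rintro ⟨b, hb⟩ r
    obtain ⟨γ, hγ, hγA, t, ht⟩ := hline b hb
    refine ⟨fun i => ⟨γ (t + i), hγA _⟩, ?_, isQuasiGeodesicOn_one_zero.2 fun i _ j _ => ?_⟩
    · simpa only [Subtype.dist_eq, Int.cast_zero, add_zero, dist_comm] using ht
    · rw [Subtype.dist_eq, hγ.dist_eq, Real.dist_eq, add_sub_add_left_eq_sub]

/-! ### Peripheral subgroups -/

theorem CayleyVertices.isCoarselyGeodesic {G : Type*} [Group G] (S : FinGenSet G) :
    IsCoarselyGeodesic (CayleyVertices S) := by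
  intro a b
  obtain ⟨N, γ, hN, h0, h1, hadj, -⟩ := exists_word_geodesic S a b
  exact ⟨N, γ, h0, h1, fun i hi => (wordDist_eq_one_of_adj S (hadj i hi)).le,
    hN.le.trans (le_add_of_nonneg_right zero_le_one)⟩

theorem CayleyVertices.exists_isQuasiGeodesicOn_centered {G : Type*} [Group G] [Infinite G]
    (S : FinGenSet G) (b : G) (r : ℕ) :
    ∃ γ : ℤ → G, γ 0 = b ∧ IsQuasiGeodesicOn (X := CayleyVertices S) 1 0 γ (-r) r := by
  obtain ⟨g, hg⟩ : ∃ g : G, (2 * r : ℝ) < wordDist S 1 g := by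
    by_contra! hle
    exact Set.infinite_univ ((finite_wordDist_le S (2 * r)).subset fun g _ => hle g)
  obtain ⟨N, γ, h0, hN, hγ⟩ := exists_isQuasiGeodesicOn S 1 g
  have hgN : wordDist S 1 g = N := by
    have hdist : wordDist S (γ 0) (γ N) = |((0 : ℤ) : ℝ) - (N : ℤ)| :=
      isQuasiGeodesicOn_one_zero.1 hγ 0 ⟨le_rfl, by omega⟩ N ⟨by omega, le_rfl⟩
    simpa [h0, hN] using hdist
  have hrN : 2 * r < N := by exact_mod_cast hg.trans_eq hgN
  have hcenter := ((hγ.comp_add r).mono (a' := -r) (b' := r) (by omega) (by omega)).map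
    (isQIEmbeddingWith_mul_left S (b * (γ r)⁻¹))
  refine ⟨fun i => b * (γ r)⁻¹ * γ (r + i), ?_, ?_⟩
  · simp
  · simpa using hcenter

section subgroups

variable {G : Type*} [Group G] (S : FinGenSet G)

theorem exists_wordDist_coe_le {P : Subgroup G} (T : FinGenSet P) :
    ∃ K : ℝ, ∀ p p' : P, wordDist S p p' ≤ K * wordDist T p p' := by
  obtain ⟨K, hK⟩ := (T.gens.finite_toSet.image fun s : P => wordDist S 1 (s : G)).bddAbove
  refine ⟨K, dist_le_mul_wordDist (Y := CayleyVertices S) T (fun p => (p : G)) fun p s hs => ?_⟩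
  exact (wordDist_self_mul S (p : G) s).trans_le (hK ⟨s, hs, rfl⟩)

theorem exists_wordDist_le_of_wordDist_coe_le {P : Subgroup G} (T : FinGenSet P) (R : ℝ) :
    ∃ K : ℝ, ∀ p p' : P, wordDist S p p' ≤ R → wordDist T p p' ≤ K := by
  have hfin : {p : P | wordDist S 1 (p : G) ≤ R}.Finite :=
    (finite_wordDist_le S R).preimage Subtype.val_injective.injOn
  obtain ⟨K, hK⟩ := (hfin.image fun p => wordDist T 1 p).bddAbove
  refine ⟨K, fun p p' hpp' => ?_⟩
  rw [← wordDist_inv_mul]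
  refine hK ⟨p⁻¹ * p', ?_, rfl⟩
  exact (wordDist_inv_mul S (p : G) p').trans_le hpp'

variable {S} {k : ℕ} {H : Fin k → Subgroup G}

theorem CayleyVertices.ofSubgroup_mem_leftCosets (S : FinGenSet G) (H : Fin k → Subgroup G)
    (j : Fin k) : CayleyVertices.ofSubgroup S (H j) ∈ leftCosets S H :=
  ⟨1, j, Set.ext fun (x : G) => by
    change x ∈ H j ↔ (1 : G)⁻¹ * x ∈ H j
    rw [inv_one, one_mul]⟩

theorem IsGroupTreeGraded.exists_path (h : IsGroupTreeGraded S H) (j : Fin k) :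
    ∃ D : ℝ, ∀ p p' : H j, ∃ (N : ℕ) (q : ℕ → H j), N = wordDist S (p : G) p' ∧
      q 0 = p ∧ q N = p' ∧ ∀ i < N, wordDist S (q i : G) (q (i + 1)) ≤ D := by
  obtain ⟨D, hD⟩ := IsAsymptoticallyTreeGraded.exists_dist_lt_of_isQuasiGeodesicOn h one_pos 0
  refine ⟨2 * D + 1, fun p p' => ?_⟩
  obtain ⟨N, γ, hN, h0, h1, hadj, hdist⟩ := exists_word_geodesic S (p : G) p'
  have hγ : IsQuasiGeodesicOn (X := CayleyVertices S) 1 0 (fun i => γ i.toNat) 0 N :=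
    isQuasiGeodesicOn_toNat (X := CayleyVertices S) hdist
  have hnear : ∀ i ≤ N, ∃ q : H j, wordDist S (γ i) q < D ∧ ∀ r : H j, γ i = r → q = r := by
    intro i hi
    obtain ⟨q, hq, hlt⟩ := hD _ (CayleyVertices.ofSubgroup_mem_leftCosets S H j) 0 N _ hγ
      (h0 ▸ p.2) (h1 ▸ p'.2) i ⟨by omega, by omega⟩
    by_cases hmem : γ i ∈ H j
    · refine ⟨⟨γ i, hmem⟩, ?_, fun r hr => Subtype.ext hr⟩
      exact (wordDist_self S _).trans_lt ((wordDist_nonneg S _ _).trans_lt hlt)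
    · exact ⟨⟨q, hq⟩, hlt, fun r hr => (hmem (hr ▸ r.2)).elim⟩
  choose! q hq hqr using hnear
  refine ⟨N, q, hN, hqr 0 N.zero_le p h0, hqr N le_rfl p' h1, fun i hi => ?_⟩
  have hqi := hq i hi.le
  rw [wordDist_comm] at hqi
  linarith [hq (i + 1) hi, wordDist_eq_one_of_adj S (hadj i hi),
    wordDist_triangle S (q i : G) (γ i) (q (i + 1)),
    wordDist_triangle S (γ i) (γ (i + 1)) (q (i + 1))]

theorem IsGroupTreeGraded.exists_wordDist_le (h : IsGroupTreeGraded S H) (j : Fin k)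
    (T : FinGenSet (H j)) : ∃ K : ℝ, ∀ p p' : H j, wordDist T p p' ≤ K * wordDist S p p' := by
  obtain ⟨D, hD⟩ := h.exists_path j
  obtain ⟨K, hK⟩ := exists_wordDist_le_of_wordDist_coe_le S T D
  refine ⟨K, fun p p' => ?_⟩
  obtain ⟨N, q, hN, rfl, rfl, hstep⟩ := hD p p'
  have hpath := dist_le_mul_of_dist_succ_le (Y := CayleyVertices T)
    (fun i hi => hK _ _ (hstep i hi)) N.zero_le le_rfl
  rw [Nat.cast_zero, sub_zero, hN] at hpath
  exact hpath

theorem IsGroupTreeGraded.exists_isQIEmbeddingWith_coe (h : IsGroupTreeGraded S H) (j : Fin k)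
    (T : FinGenSet (H j)) :
    ∃ L : ℝ, IsQIEmbeddingWith L 0 (X := CayleyVertices T) (Y := CayleyVertices S)
      (fun p : H j => (p : G)) := by
  obtain ⟨K, hK⟩ := exists_wordDist_coe_le S T
  obtain ⟨K', hK'⟩ := h.exists_wordDist_le j T
  refine ⟨max 1 (max K K'), .of_dist_le_mul (le_max_left _ _) le_rfl (fun p p' => ?_)
    fun p p' => ?_⟩
  · rw [add_zero]
    exact (hK p p').trans (mul_le_mul_of_nonneg_right
      ((le_max_left _ _).trans (le_max_right _ _)) (wordDist_nonneg T _ _))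
  · rw [add_zero]
    exact (hK' p p').trans (mul_le_mul_of_nonneg_right
      ((le_max_right _ _).trans (le_max_right _ _)) (wordDist_nonneg S _ _))

theorem isCoarseImage_coset (S : FinGenSet G) (P : Subgroup G) (g : G) :
    IsCoarseImage (X := CayleyVertices S) (fun p : P => g * (p : G)) 0 Set.univ
      {x : G | g⁻¹ * x ∈ P} where
  exists_near_map p _ := by
    refine ⟨g * (p : G), ?_, (wordDist_self S _).le⟩
    change g⁻¹ * (g * (p : G)) ∈ P
    rw [inv_mul_cancel_left]
    exact p.2
  exists_map_near := fun (a : G) (ha : g⁻¹ * a ∈ P) => by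
    refine ⟨⟨g⁻¹ * a, ha⟩, Set.mem_univ _, ?_⟩
    change wordDist S (g * (g⁻¹ * a)) a ≤ 0
    rw [mul_inv_cancel_left, wordDist_self]

theorem isCoarseModel_coset {P : Subgroup G} [Infinite P] {T : FinGenSet P}
    (hT : IsUnconstricted (CayleyVertices T)) {L : ℝ}
    (hP : IsQIEmbeddingWith L 0 (X := CayleyVertices T) (Y := CayleyVertices S)
      (fun p : P => (p : G))) (g : G) :
    IsCoarseModel (X := CayleyVertices S) (B := CayleyVertices T) {x : G | g⁻¹ * x ∈ P}
      (fun p : P => g * (p : G)) L 0 0 where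
  qie := by
    have hg := (isQIEmbeddingWith_mul_left S g).comp hP
    rw [one_mul, one_mul, add_zero] at hg
    exact hg
  image := isCoarseImage_coset S P g
  unconstricted := hT
  geodesic := CayleyVertices.isCoarselyGeodesic T
  line := fun b r => by
    obtain ⟨γ, rfl, hγ⟩ := CayleyVertices.exists_isQuasiGeodesicOn_centered T b r
    exact ⟨γ, (dist_self (α := CayleyVertices T) _).le, hγ⟩

theorem IsGroupTreeGraded.exists_isCoarseModel_coset (h : IsGroupTreeGraded S H)
    (hinf : ∀ j, Infinite (H j)) (T : ∀ j, FinGenSet (H j))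
    (hT : ∀ j, IsUnconstricted (CayleyVertices (T j))) :
    ∃ L : ℝ, 0 < L ∧ ∀ (g : G) (j : Fin k),
      IsCoarseModel (X := CayleyVertices S) (B := CayleyVertices (T j)) {x : G | g⁻¹ * x ∈ H j}
        (fun p : H j => g * (p : G)) L 0 0 := by
  choose K hK using fun j => h.exists_isQIEmbeddingWith_coe j (T j)
  obtain ⟨L, hL⟩ := Finite.exists_le K
  exact ⟨max 1 L, by positivity, fun g j => isCoarseModel_coset (hT j)
    ((hK j).mono ((hL j).trans (le_max_right _ _)) le_rfl) g⟩

theorem leftCosets_nonempty (S : FinGenSet G) (H : Fin k → Subgroup G) :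
    ∀ A ∈ leftCosets S H, A.Nonempty := by
  rintro _ ⟨g, j, rfl⟩
  refine ⟨g, ?_⟩
  change g⁻¹ * g ∈ H j
  rw [inv_mul_cancel]
  exact one_mem _

theorem finite_leftCosets_ball (S : FinGenSet G) (H : Fin k → Subgroup G) (R : ℝ) :
    {A ∈ leftCosets S H | (A ∩ Metric.ball ((1 : G) : CayleyVertices S) R).Nonempty}.Finite := by
  refine (Set.Finite.image2 (fun (x : G) (j : Fin k) =>
    ({y : G | x⁻¹ * y ∈ H j} : Set (CayleyVertices S))) (finite_wordDist_le S R)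
    Set.finite_univ).subset ?_
  rintro _ ⟨⟨g, j, rfl⟩, (x : G), (hx : g⁻¹ * x ∈ H j), (hxR : wordDist S x 1 < R)⟩
  rw [wordDist_comm] at hxR
  refine ⟨x, hxR.le, j, Set.mem_univ j, Set.ext fun (y : G) => ?_⟩
  change x⁻¹ * y ∈ H j ↔ g⁻¹ * y ∈ H j
  rw [← Subgroup.mul_mem_cancel_left (H j) hx, mul_assoc, mul_inv_cancel_left]

theorem GroupsQuasiIsometric.toSpace {Γ : Type*} [Group Γ] (h : GroupsQuasiIsometric Γ G)
    (S : FinGenSet G) : GroupQuasiIsometricToSpace Γ (CayleyVertices S) := by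
  obtain ⟨U, T, hQI⟩ := h
  obtain ⟨f, f', L, C, hf⟩ := hQI.exists_isQuasiInversePair
  obtain ⟨L', hid⟩ := exists_isQIEmbeddingWith_id S T
  exact ⟨U, (hid.comp hf.qie).quasiIsometric fun y =>
    ⟨f' y, hid.dist_map_le_of_le (hf.dist_right y)⟩⟩

end subgroups

theorem IsUniformlyUnconstricted.isUnconstricted {X : Type*} [MetricSpace X] {𝒜 : Set (Set X)}
    (h : IsUniformlyUnconstricted 𝒜) {A : Set X} (hA : A ∈ 𝒜) : IsUnconstricted A :=
  h.2 (fun _ => A) fun _ => hA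

theorem mainTheorem3_general {Γ : Type*} [Group Γ] :
    (∀ {G : Type*} [Group G] (S : FinGenSet G) (k : ℕ) (H : Fin k → Subgroup G),
      IsGroupTreeGraded S H →
      (∀ j, Infinite (H j)) →
      (∀ j, IsUnconstrictedGroup (H j)) →
      GroupsQuasiIsometric Γ G →
      ∃ (m : ℕ) (P : Fin m → Subgroup Γ),
        (∀ T : FinGenSet Γ, IsGroupTreeGraded T P) ∧
        ∀ i, ∃ j, GroupsQuasiIsometric (P i) (H j)) ∧
    (∀ {X : Type*} [MetricSpace X] (𝒜 : Set (Set X)) (c : ℝ) (x₀ : X),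
      (∀ A ∈ 𝒜, A.Nonempty) →
      IsAsymptoticallyTreeGraded 𝒜 →
      (∀ A ∈ 𝒜, IsGeodesicSubset A) →
      (∀ A ∈ 𝒜, IsUnconstricted A) →
      (∀ A ∈ 𝒜, ∀ a ∈ A, ∃ γ : ℝ → X, Isometry γ ∧ (∀ t, γ t ∈ A) ∧ ∃ t, dist a (γ t) ≤ c) →
      (∀ R : ℝ, {A ∈ 𝒜 | (A ∩ Metric.ball x₀ R).Nonempty}.Finite) →
      GroupQuasiIsometricToSpace Γ X →
      ∃ (m : ℕ) (A : Fin m → Set X) (P : Fin m → Subgroup Γ),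
        (∀ i, A i ∈ 𝒜) ∧
        (∀ B ∈ 𝒜, ∃ i, QuasiIsometric B (A i)) ∧
        (∀ i, GroupQuasiIsometricToSpace (P i) (A i)) ∧
        (∀ T : FinGenSet Γ, IsGroupTreeGraded T P)) := by
  constructor
  · intro G _ S k H htg hinf hunc hΓ
    choose T hT using hunc
    obtain ⟨L, hL, hmodel⟩ := htg.exists_isCoarseModel_coset hinf T hT
    obtain ⟨m, A, P, hA, -, hP, htgP⟩ := IsAsymptoticallyTreeGraded.exists_subgroups htg
      (leftCosets_nonempty S H) hL
      (by rintro _ ⟨g, j, rfl⟩; exact ⟨CayleyVertices (T j), inferInstance, _, hmodel g j⟩)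
      _ (finite_leftCosets_ball S H) (hΓ.toSpace S)
    refine ⟨m, P, htgP, fun i => ?_⟩
    obtain ⟨g, j, hj⟩ := hA i
    obtain ⟨U, hU⟩ := hP i (CayleyVertices (T j)) _ (hj ▸ hmodel g j)
    exact ⟨j, U, T j, hU⟩
  · intro X _ 𝒜 c x₀ hne htg hgeod hunc hline hfin hΓ
    have hmodel : ∀ A ∈ 𝒜, IsCoarseModel A (Subtype.val : A → X) 1 0 (max c 0) := fun A hA =>
      isCoarseModel_subtype_val (le_max_right _ _) (hgeod A hA) (hunc A hA) fun a ha =>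
        let ⟨γ, hγ, hγA, t, ht⟩ := hline A hA a ha
        ⟨γ, hγ, hγA, t, ht.trans (le_max_left _ _)⟩
    obtain ⟨m, A, P, hA, hQI, hP, htgP⟩ := htg.exists_subgroups hne one_pos
      (fun A hA => ⟨A, inferInstance, _, hmodel A hA⟩) x₀ hfin hΓ
    exact ⟨m, A, P, hA, hQI, fun i => hP i (A i) _ (hmodel _ (hA i)), htgP⟩

theorem mainTheorem3 {Γ : Type*} [Group Γ] [Group.FG Γ] :
    -- the result for groups
    (∀ {G : Type*} [Group G] (S : FinGenSet G) (k : ℕ) (H : Fin k → Subgroup G),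
      IsGroupTreeGraded S H →
      (∀ j, Infinite (H j)) →
      (∀ j, IsUnconstrictedGroup (H j)) →
      GroupsQuasiIsometric Γ G →
      ∃ (m : ℕ) (P : Fin m → Subgroup Γ),
        (∀ T : FinGenSet Γ, IsGroupTreeGraded T P) ∧
        ∀ i, ∃ j, GroupsQuasiIsometric (P i) (H j)) ∧
    -- the result for spaces
    (∀ {X : Type*} [MetricSpace X] (𝒜 : Set (Set X)) (c : ℝ) (x₀ : X),
      (∀ A ∈ 𝒜, A.Nonempty) →
      IsAsymptoticallyTreeGraded 𝒜 →
      IsUniformlyUnconstricted 𝒜 →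
      (∀ A ∈ 𝒜, ∀ a ∈ A, ∃ γ : ℝ → X, Isometry γ ∧ (∀ t, γ t ∈ A) ∧ ∃ t, dist a (γ t) ≤ c) →
      (∀ R : ℝ, {A ∈ 𝒜 | (A ∩ Metric.ball x₀ R).Nonempty}.Finite) →
      GroupQuasiIsometricToSpace Γ X →
      ∃ (m : ℕ) (A : Fin m → Set X) (P : Fin m → Subgroup Γ),
        (∀ i, A i ∈ 𝒜) ∧
        (∀ B ∈ 𝒜, ∃ i, QuasiIsometric B (A i)) ∧
        (∀ i, GroupQuasiIsometricToSpace (P i) (A i)) ∧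
        (∀ T : FinGenSet Γ, IsGroupTreeGraded T P)) := by
  obtain ⟨hgroups, hspaces⟩ := mainTheorem3_general (Γ := Γ)
  exact ⟨hgroups, fun 𝒜 c x₀ hne htg hunc => hspaces 𝒜 c x₀ hne htg hunc.1
    fun _ => hunc.isUnconstricted⟩
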